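/- A *piece* is a convex polygon in the plane (with nonempty interior). A stream $I=(P_1,\dots,P_n)$ of pieces is presented online: a deterministic online algorithm $\mathcal A$ places each $P_i$ irrevocably, by a translation, knowing only $P_1,\dots,P_i$; placed pieces must be pairwise interior-disjoint (within each bin, for bin packing). * **Strip-Packing:** the pieces are placed in the strip $[0,\infty)\times[0,1]$; the cost is the largest $x$-coordinate of a point of a placed piece. * **Bin-Packing:** the pieces are placed in unit squares (bins); the cost is the number of bins used. * **Perimeter-Packing:** the pieces are placed anywhere in the plane; the cost is the perimeter of their convex hull. * **Square-Packing$[\delta]$:** every stream of pieces of diameter at most $\delta$ and total area at most $\delta$ has to be placed in the unit square $[0,1]^2$. In the first two problems every piece of an instance can be translated into the strip, respectively the unit square. Let $\mathcal A(I)$ be the cost of the packing produced by $\mathcal A$ and $\mathrm{OPT}(I)$ the infimum of the costs of all packings of $I$. On a class of instances, $\mathcal A$ has competitive ratio $f(n)$ if $\mathcal A(I)\le f(n)\,\mathrm{OPT}(I)$ for all instances $I$ of the class with $n$ pieces, for all $n$; it has asymptotic competitive ratio $f(n)$ if for some $\beta>0$ always $\mathcal A(I)\le f(n)\,\mathrm{OPT}(I)+\beta$;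 it is competitive if it has a constant competitive ratio. Then the following hold. **(a), (b)** Let $\delta>0$ and consider Strip-Packing, or Bin-Packing, restricted to pieces of diameter at most $\delta$. 1. For every real $C$, no online algorithm is competitive on the instances with $\mathrm{OPT}(I)\ge C$ (in particular, none is competitive). 2. For every real $C$ there are $c>0$ and $N$, depending only on $\delta$ and $C$, such that for every $n\ge N$ and every online algorithm $\mathcal A$ there is an instance $I$ of $n$ pieces with $\mathrm{OPT}(I)\ge C$ and $$\mathcal A(I)\ \ge\ c\,\sqrt{\frac{\log n}{\log\log n}}\;\mathrm{OPT}(I).$$ 3. There is $c>0$, depending only on $\delta$, such that every asymptotic competitive ratio $f$ of every online algorithm satisfies $f(n)\ge c\sqrt{\log n/\log\log n}$ for all sufficiently large $n$. **(c)** Let $\delta>0$ and consider Perimeter-Packing restricted to pieces of diameter at most $\delta$. No online algorithm is competitive, and there are $c>0$ and $N$, depending only on $\delta$, such that for every $n\ge N$ and every online algorithm $\mathcal A$ there is an instance $I$ of $n$ pieces with $$\mathcal A(I)\ \ge\ c\left(\frac{\log n}{\log\log n}\right)^{1/4}\mathrm{OPT}(I).$$ **(d)** For every $\delta\in(0,1]$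 there is no online algorithm for Square-Packing$[\delta]$; moreover the online critical density is $0$, i.e. $0$ is the largest $V\ge 0$ for which some online algorithm packs every stream of pieces of diameter at most $\delta$ and total area at most $V$ into the unit square. In particular, there is a constant $K>0$ such that for every $\delta\in(0,1]$, every sufficiently large $n$ (depending on $\delta$) and every online algorithm there is a stream of $n$ pieces of diameter at most $\delta$ and total area at most $K\sqrt{\log\log n/\log n}$ that the algorithm does not pack into the unit square. -/

import Mathlib

open MeasureTheory Set

/-- The Euclidean plane; `p 0` and `p 1` are the `x`- and `y`-coordinates. -/
abbrev Plane : Type := EuclideanSpace ℝ (Fin 2)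

/-- A piece: a (nondegenerate) convex polygon, i.e. the convex hull of finitely many points of the
plane, with nonempty interior. -/
structure ConvexPolygon where
  carrier : Set Plane
  exists_vertices : ∃ V : Finset Plane, carrier = convexHull ℝ (V : Set Plane)
  interior_nonempty : (interior carrier).Nonempty

namespace ConvexPolygon

/-- The piece `P` translated by the vector `v`. -/
def translate (P : ConvexPolygon) (v : Plane) : Set Plane := (fun p => p + v) '' P.carrier

noncomputable def diam (P : ConvexPolygon) : ℝ := Metric.diam P.carrier

noncomputable def area (P : ConvexPolygon) : ℝ := (volume P.carrier).toReal

/-- `P` can be translated into the container `S`. -/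
def FitsIn (P : ConvexPolygon) (S : Set Plane) : Prop := ∃ v : Plane, P.translate v ⊆ S

end ConvexPolygon

/-- A stream of `n` pieces, in their order of arrival. -/
abbrev PieceStream (n : ℕ) : Type := Fin n → ConvexPolygon

/-- The horizontal strip of height `1`, bounded to the left and unbounded to the right. -/
def strip : Set Plane := {p | 0 ≤ p 0 ∧ 0 ≤ p 1 ∧ p 1 ≤ 1}

def unitSquare : Set Plane := {p | 0 ≤ p 0 ∧ p 0 ≤ 1 ∧ 0 ≤ p 1 ∧ p 1 ≤ 1}

/-- The translates of the pieces by the vectors `v` are pairwise interior-disjoint. -/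
def InteriorDisjoint {n : ℕ} (I : PieceStream n) (v : Fin n → Plane) : Prop :=
  ∀ i j : Fin n, i ≠ j →
    Disjoint (interior ((I i).translate (v i))) (interior ((I j).translate (v j)))

/-- The translates of the pieces by the vectors `v` form a packing inside the container `S`. -/
def IsPackingIn (S : Set Plane) {n : ℕ} (I : PieceStream n) (v : Fin n → Plane) : Prop :=
  (∀ i, (I i).translate (v i) ⊆ S) ∧ InteriorDisjoint I v

/-- The region covered by the translated pieces. -/
def coveredRegion {n : ℕ} (I : PieceStream n) (v : Fin n → Plane) : Set Plane :=
  ⋃ i, (I i).translate (v i)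

/-- The perimeter of a planar set: the length (one-dimensional Hausdorff measure) of its boundary. -/
noncomputable def perimeter (K : Set Plane) : ℝ :=
  (Measure.hausdorffMeasure 1 (frontier K)).toReal

/-- A deterministic online rule that places each piece of a stream: given the list of the pieces that
have arrived so far, it returns the placement of the last one. (The placements of the earlier pieces
are determined by the rule and the list.) -/
abbrev OnlineRule (Placement : Type) : Type := List ConvexPolygon → Placement

/-- The placements made by `A` on the stream `I`: the placement of the piece with index `i` depends
only on the pieces with indices `0, …, i`. -/
def OnlineRule.run {Placement : Type} (A : OnlineRule Placement) {n : ℕ} (I : PieceStream n) :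
    Fin n → Placement :=
  fun i => A ((List.ofFn I).take (i.val + 1))

/-- A packing problem with a cost to be minimized. `Fits` says which pieces may occur in an
instance, `Valid` which placements are packings. It is only used for the three concrete problems
below. -/
structure PackingProblem where
  Placement : Type
  Fits : ConvexPolygon → Prop
  Valid : ∀ {n : ℕ}, PieceStream n → (Fin n → Placement) → Prop
  cost : ∀ {n : ℕ}, PieceStream n → (Fin n → Placement) → ℝ

/-- Strip packing: the cost is the `x`-coordinate of the rightmost point of a placed piece. -/
noncomputable def stripPacking : PackingProblem where
  Placement := Plane
  Fits P := P.FitsIn strip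
  Valid I v := IsPackingIn strip I v
  cost I v := sSup ((fun p : Plane => p 0) '' coveredRegion I v)

/-- Bin packing: a placement consists of the index of a bin and a translation vector, every bin being
a unit square; the cost is the number of bins used. -/
noncomputable def binPacking : PackingProblem where
  Placement := ℕ × Plane
  Fits P := P.FitsIn unitSquare
  Valid {n} I v := (∀ i, (I i).translate (v i).2 ⊆ unitSquare) ∧
    ∀ i j : Fin n, i ≠ j → (v i).1 = (v j).1 →
      Disjoint (interior ((I i).translate (v i).2)) (interior ((I j).translate (v j).2))
  cost {n} _ v := ((Finset.univ.image fun i : Fin n => (v i).1).card : ℝ)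

/-- Perimeter packing: the pieces can be placed anywhere in the plane; the cost is the perimeter of
their convex hull. -/
noncomputable def perimeterPacking : PackingProblem where
  Placement := Plane
  Fits _ := True
  Valid I v := InteriorDisjoint I v
  cost I v := perimeter (convexHull ℝ (coveredRegion I v))

namespace PackingProblem

/-- The instances of the problem in which all pieces have diameter at most `δ`. -/
def IsInstance (Q : PackingProblem) (δ : ℝ) {n : ℕ} (I : PieceStream n) : Prop :=
  ∀ i, Q.Fits (I i) ∧ (I i).diam ≤ δ

/-- The cost of the offline optimum. -/
noncomputable def opt (Q : PackingProblem) {n : ℕ} (I : PieceStream n) : ℝ :=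
  sInf {c : ℝ | ∃ v : Fin n → Q.Placement, Q.Valid I v ∧ Q.cost I v = c}

/-- `A` is an online algorithm for the problem restricted to pieces of diameter at most `δ`: it
produces a packing on every such instance. -/
def IsOnlineAlgorithm (Q : PackingProblem) (δ : ℝ) (A : OnlineRule Q.Placement) : Prop :=
  ∀ (n : ℕ) (I : PieceStream n), Q.IsInstance δ I → Q.Valid I (A.run I)

/-- The cost of the solution that `A` produces on the stream `I`. -/
noncomputable def algCost (Q : PackingProblem) (A : OnlineRule Q.Placement) {n : ℕ}
    (I : PieceStream n) : ℝ :=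
  Q.cost I (A.run I)

/-- `A` has competitive ratio `f`, a function of the number of pieces, on the instances with pieces
of diameter at most `δ` and offline optimum at least `C`. -/
def HasCompetitiveRatio (Q : PackingProblem) (δ C : ℝ) (A : OnlineRule Q.Placement)
    (f : ℕ → ℝ) : Prop :=
  ∀ (n : ℕ) (I : PieceStream n), Q.IsInstance δ I → C ≤ Q.opt I →
    Q.algCost A I ≤ f n * Q.opt I

/-- `A` is competitive on the instances with pieces of diameter at most `δ` and offline optimum at
least `C`. -/
def IsCompetitive (Q : PackingProblem) (δ C : ℝ) (A : OnlineRule Q.Placement) : Prop :=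
  ∃ K : ℝ, Q.HasCompetitiveRatio δ C A (fun _ => K)

/-- `A` has asymptotic competitive ratio `f` on the instances with pieces of diameter at most `δ`. -/
def HasAsymptoticCompetitiveRatio (Q : PackingProblem) (δ : ℝ) (A : OnlineRule Q.Placement)
    (f : ℕ → ℝ) : Prop :=
  ∃ β : ℝ, 0 < β ∧ ∀ (n : ℕ) (I : PieceStream n), Q.IsInstance δ I →
    Q.algCost A I ≤ f n * Q.opt I + β

end PackingProblem

/-- `A` packs online, into the unit square, every stream of pieces of diameter at most `δ` and total
area at most `V`. Square-Packing`[δ]` asks for such an `A` with `V = δ`. -/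
def PacksIntoSquare (δ V : ℝ) (A : OnlineRule Plane) : Prop :=
  ∀ (n : ℕ) (I : PieceStream n), (∀ i, (I i).diam ≤ δ) → ∑ i, (I i).area ≤ V →
    IsPackingIn unitSquare I (A.run I)

/-! All bounds use one family of pieces, thin parallelograms ("slivers") of height `h`, horizontal
thickness `e = W / n` and slope in `(0, 1)`. Offline, they are sorted by slope and put side by side,
so the optimum stays bounded. Online, the container is cut into slabs of height `h / 4`, and each
sliver is assigned to a slab that it crosses completely. Disjoint slivers of the same slab have the
same order, with distance at least `e`, at the bottom and at the top of it. The sum of both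
coordinates therefore controls `h / 4` times the variation of the slopes from left to right. So a
cheap online packing is an online sorting of slopes, into an array with few cells per item, with
small total variation.

The core is an adversary for this sorting problem. A free cell is worth `w`, and a gap between
neighbours whose values differ by `r` is worth `cst r`, which is `r` plus a small entropy term.
Thanks to this term, an item put deep inside the value range of a gap has a positive gain, and an
item put outside the range gains at least the distance. A region of values is light at level `k` if
its internal gaps have potential at most `k / 64` times its length. By induction on `k`
(`levelOut`), items from a light region force the end of the process, a potential above the bound,
or the use of an external gap, while the amplified potential `Am` loses at most an eighth of the
length.

For the induction step, a light subregion of lower level, beyond which the straddling gaps reach far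
(a lean core), is visited; this either settles the region or does not decrease `Am`. If there is
none, every long subinterval is heavy (`mass_ge_of_not_leanCore`). Then items are wasted in the
middle until the potential has dropped; as the sides stay heavy, a lean core must appear in the
middle. The working interval only grows by amounts that the gains pay for.

A level costs a factor polynomial in `log n` in length, so about `log n / log log n` levels are
available. Hence (`exists_variation_ge`, `RowPlacement.exists_lower_bound`) variation times cells
per item is at least of this order. A cost `X` enters both factors linearly for strips (row length)
and bins (number of rows), which gives the square root. It enters both quadratically for perimeters,
which gives the fourth root. For the square, a small total area increases only the number of cells
per item. -/

/-! ### Gaps and their value ranges. -/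

/-- A gap between two consecutive items: the values `a`, `b` at its ends and the number `m` of
free cells between them. -/
structure Gap where
  a : ℝ
  b : ℝ
  m : ℕ

namespace Gap

noncomputable def lo (g : Gap) : ℝ := min g.a g.b
noncomputable def hi (g : Gap) : ℝ := max g.a g.b
noncomputable def len (g : Gap) : ℝ := |g.a - g.b|

def InUnit (g : Gap) : Prop := g.a ∈ Ioo (0 : ℝ) 1 ∧ g.b ∈ Ioo (0 : ℝ) 1

/-- The value range of `g` lies in `[x, y)`. -/
def Inside (g : Gap) (x y : ℝ) : Prop := x ≤ g.lo ∧ g.hi < y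

/-- The value range of `g` straddles `[x, y)`. -/
def Covers (g : Gap) (x y : ℝ) : Prop := g.lo < x ∧ y ≤ g.hi

/-- Length of the part of the value range in `[x, y]`. -/
noncomputable def clip (g : Gap) (x y : ℝ) : ℝ := |max x (min y g.a) - max x (min y g.b)|

lemma lo_le_hi (g : Gap) : g.lo ≤ g.hi := min_le_max

lemma len_nonneg (g : Gap) : 0 ≤ g.len := abs_nonneg _

lemma InUnit.len_le_one {g : Gap} (h : g.InUnit) : g.len ≤ 1 := by
  obtain ⟨⟨h1, h2⟩, h3, h4⟩ := h
  unfold len; rw [abs_le]; constructor <;> linarith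

lemma clip_nonneg (g : Gap) (x y : ℝ) : 0 ≤ g.clip x y := abs_nonneg _

lemma clip_eq {g : Gap} {x y : ℝ} :
    g.clip x y = max x (min y g.hi) - max x (min y g.lo) := by
  unfold clip hi lo
  rcases le_total g.a g.b with h | h
  · rw [max_eq_right h, min_eq_left h, abs_sub_comm, abs_of_nonneg]
    have : max x (min y g.a) ≤ max x (min y g.b) := by gcongr
    linarith
  · rw [max_eq_left h, min_eq_right h, abs_of_nonneg]
    have : max x (min y g.b) ≤ max x (min y g.a) := by gcongr
    linarith

lemma clip_le_len (g : Gap) (x y : ℝ) : g.clip x y ≤ g.len := by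
  unfold clip len
  calc _ ≤ |min y g.a - min y g.b| := by
        have := abs_max_sub_max_le_max x (min y g.a) x (min y g.b)
        simpa using this
    _ ≤ _ := by
        have := abs_min_sub_min_le_max y g.a y g.b
        simpa using this

lemma Covers.clip_eq {g : Gap} {x y : ℝ} (h : g.Covers x y) (hxy : x ≤ y) :
    g.clip x y = y - x := by
  obtain ⟨h1, h2⟩ := h
  rw [Gap.clip_eq, min_eq_left h2, max_eq_right hxy, max_eq_left]
  exact (min_le_right _ _).trans h1.le

lemma clip_eq_zero_of_hi_le {g : Gap} {x y : ℝ} (h : g.hi ≤ x) : g.clip x y = 0 := by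
  rw [clip_eq, max_eq_left, max_eq_left, sub_self]
  · exact (min_le_right _ _).trans (g.lo_le_hi.trans h)
  · exact (min_le_right _ _).trans h

lemma clip_eq_zero_of_le_lo {g : Gap} {x y : ℝ} (h : y ≤ g.lo) : g.clip x y = 0 := by
  rw [clip_eq, min_eq_left h, min_eq_left (h.trans g.lo_le_hi), sub_self]

lemma clip_add_clip (g : Gap) {x y z : ℝ} (hxy : x ≤ y) (hyz : y ≤ z) :
    g.clip x y + g.clip y z = g.clip x z := by
  have key : ∀ t : ℝ, max x (min z t) = max x (min y t) + max y (min z t) - y := by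
    intro t
    rcases le_total t y with h | h
    · rw [min_eq_right h, min_eq_right (h.trans hyz), max_eq_left h]; ring
    · rw [min_eq_left h, max_eq_right hxy, max_eq_right (le_min hyz h),
        max_eq_right (hxy.trans (le_min hyz h))]; ring
  rw [clip_eq, clip_eq, clip_eq, key g.hi, key g.lo]; ring

/-- The triangle inequality: an insertion never decreases the total clipped length on an interval.
-/
lemma clip_le_split (a b x : ℝ) (m i j : ℕ) (p q : ℝ) :
    (Gap.mk a b m).clip p q ≤ (Gap.mk a x i).clip p q + (Gap.mk x b j).clip p q :=
  abs_sub_le _ _ _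

end Gap

/-! ### The potential of a gap and the gain of an insertion. -/

/-- Parameters of the potential function: the value `w` of a free cell and the value `cst r` of a
gap with value range of length `r`. -/
structure Weights where
  cst : ℝ → ℝ
  w : ℝ
  -- `R` is the relative depth needed for a gain in `split`; `K` is the highest level.
  R : ℕ
  K : ℕ
  w_pos : 0 < w
  R_pos : 1 ≤ R
  self_le : ∀ r, 0 ≤ r → r ≤ 1 → r ≤ cst r
  mono : ∀ r s, 0 ≤ r → r ≤ s → s ≤ 1 → cst r ≤ cst s
  split : ∀ r s d : ℝ, 0 ≤ d → R * d ≤ r → R * d ≤ s → r + s ≤ 1 → cst (r + s) + d ≤ cst r + cst s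

namespace Weights

variable (W : Weights)

/-- `mass_ge_of_straddlers` loses a fraction `4 / groupSize` in each of at most `K / 64 + 1` stages;
the square keeps the total loss of density below `1 / 64`. -/
def groupSize : ℕ := (W.K + 64) ^ 2

/-- The number of zones into which an interval is divided. -/
def zones : ℕ := W.R * W.groupSize * W.groupSize

/-- The least length of a core at level `k`. -/
noncomputable def scale (k : ℕ) : ℝ := 64 * W.w * (16 * W.zones : ℝ) ^ k

lemma groupSize_pos : 4096 ≤ W.groupSize := by
  unfold groupSize; nlinarith [Nat.zero_le W.K]

lemma zones_pos : 1 ≤ W.zones := by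
  have := W.groupSize_pos; have := W.R_pos
  unfold zones
  exact Nat.one_le_iff_ne_zero.2 (by positivity)

lemma one_le_zones : (1 : ℝ) ≤ W.zones := by exact_mod_cast W.zones_pos

lemma scale_pos (k : ℕ) : 0 < W.scale k := by
  have := W.w_pos; have := W.one_le_zones
  unfold scale; positivity

lemma scale_succ (k : ℕ) : W.scale (k + 1) = 16 * W.zones * W.scale k := by
  unfold scale; ring

lemma scale_mono {k l : ℕ} (h : k ≤ l) : W.scale k ≤ W.scale l := by
  unfold scale
  have := W.w_pos; have := W.one_le_zones
  gcongr; linarith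

lemma zones_mul_scale_le {k l : ℕ} (h : k < l) : W.zones * W.scale k ≤ W.scale l := by
  refine le_trans ?_ (W.scale_mono h)
  rw [Nat.succ_eq_add_one, W.scale_succ]
  have := W.scale_pos k; have := W.one_le_zones
  have : 0 ≤ W.zones * W.scale k := by positivity
  linarith

lemma w_le_scale (k : ℕ) : 64 * W.w ≤ W.scale k := by
  have := W.scale_mono (Nat.zero_le k)
  simpa [scale] using this

lemma cst_nonneg {r : ℝ} (h0 : 0 ≤ r) (h1 : r ≤ 1) : 0 ≤ W.cst r := h0.trans (W.self_le r h0 h1)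

/-- The potential of a gap. -/
noncomputable def pot (g : Gap) : ℝ := W.w * g.m + W.cst g.len

/-- The potential of a gap with increased weight on the value range. -/
noncomputable def apot (g : Gap) : ℝ := W.w * g.m + 5 / 4 * W.cst g.len

/-- The increase of the total `cst` if an item of value `x` is put into `g`. -/
noncomputable def gain (g : Gap) (x : ℝ) : ℝ :=
  W.cst |g.a - x| + W.cst |x - g.b| - W.cst g.len

lemma len_le_pot {g : Gap} (h : g.InUnit) : g.len ≤ W.pot g := by
  have h1 := W.self_le _ g.len_nonneg h.len_le_one
  have := W.w_pos
  have : 0 ≤ W.w * g.m := by positivity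
  unfold pot; linarith

lemma pot_nonneg {g : Gap} (h : g.InUnit) : 0 ≤ W.pot g := g.len_nonneg.trans (W.len_le_pot h)

lemma gain_symm (a b x : ℝ) (m : ℕ) : W.gain ⟨a, b, m⟩ x = W.gain ⟨b, a, m⟩ x := by
  unfold gain Gap.len
  rw [abs_sub_comm a b, abs_sub_comm a x, abs_sub_comm x b]; simp only; ring

lemma gain_symm' (g : Gap) (x : ℝ) (h : g.b ≤ g.a) :
    ∃ g' : Gap, g'.a ≤ g'.b ∧ g'.lo = g.lo ∧ g'.hi = g.hi ∧ W.gain g' x = W.gain g x ∧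
      (g.InUnit → g'.InUnit) :=
  ⟨⟨g.b, g.a, g.m⟩, h, min_comm _ _, max_comm _ _, W.gain_symm _ _ _ _, fun h => ⟨h.2, h.1⟩⟩

lemma exists_ordered (g : Gap) (x : ℝ) :
    ∃ g' : Gap, g'.a ≤ g'.b ∧ g'.lo = g.lo ∧ g'.hi = g.hi ∧ W.gain g' x = W.gain g x ∧
      (g.InUnit → g'.InUnit) := by
  rcases le_total g.a g.b with h | h
  · exact ⟨g, h, rfl, rfl, rfl, id⟩
  · exact W.gain_symm' g x h

/-- The new gap towards the near end is worth at least its length by `self_le`; the one towards the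
far end is longer than `g` and costs no less by `mono`. -/
lemma lo_sub_le_gain {g : Gap} {x : ℝ} (hg : g.InUnit) (hx : x ∈ Ioo (0 : ℝ) 1)
    (h : x ≤ g.lo) : g.lo - x ≤ W.gain g x := by
  obtain ⟨g', h1, h2, h3, h4, h5⟩ := W.exists_ordered g x
  rw [← h4, ← h2]; rw [← h2] at h
  obtain ⟨⟨a0, a1⟩, b0, b1⟩ := h5 hg
  have hlo : g'.lo = g'.a := min_eq_left h1
  rw [hlo] at h ⊢
  unfold gain Gap.len
  rw [abs_of_nonneg (by linarith), abs_sub_comm, abs_of_nonneg (by linarith : 0 ≤ g'.b - x),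
    abs_sub_comm, abs_of_nonneg (by linarith : 0 ≤ g'.b - g'.a)]
  have e1 := W.self_le (g'.a - x) (by linarith) (by linarith [hx.1])
  have e2 := W.mono (g'.b - g'.a) (g'.b - x) (by linarith) (by linarith) (by linarith [hx.1])
  linarith

lemma sub_hi_le_gain {g : Gap} {x : ℝ} (hg : g.InUnit) (hx : x ∈ Ioo (0 : ℝ) 1)
    (h : g.hi ≤ x) : x - g.hi ≤ W.gain g x := by
  obtain ⟨g', h1, h2, h3, h4, h5⟩ := W.exists_ordered g x
  rw [← h4, ← h3]; rw [← h3] at h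
  obtain ⟨⟨a0, a1⟩, b0, b1⟩ := h5 hg
  have hhi : g'.hi = g'.b := max_eq_right h1
  rw [hhi] at h ⊢
  unfold gain Gap.len
  rw [abs_sub_comm, abs_of_nonneg (by linarith : 0 ≤ x - g'.a),
    abs_of_nonneg (by linarith : 0 ≤ x - g'.b),
    abs_sub_comm, abs_of_nonneg (by linarith : 0 ≤ g'.b - g'.a)]
  have e1 := W.self_le (x - g'.b) (by linarith) (by linarith [hx.2])
  have e2 := W.mono (g'.b - g'.a) (x - g'.a) (by linarith) (by linarith) (by linarith [hx.2])
  linarith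

/-- Here the total length does not change, and the gain comes from `split` alone. -/
lemma le_gain_of_far {g : Gap} {x d : ℝ} (hg : g.InUnit) (hd : 0 ≤ d)
    (h1 : g.lo ≤ x - W.R * d) (h2 : x + W.R * d ≤ g.hi) : d ≤ W.gain g x := by
  obtain ⟨g', h1', h2', h3, h4, h5⟩ := W.exists_ordered g x
  rw [← h4]; rw [← h2'] at h1; rw [← h3] at h2
  obtain ⟨⟨a0, a1⟩, b0, b1⟩ := h5 hg
  rw [show g'.hi = g'.b from max_eq_right h1'] at h2
  rw [show g'.lo = g'.a from min_eq_left h1'] at h1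
  have : 0 ≤ W.R * d := by positivity
  unfold gain Gap.len
  rw [abs_sub_comm, abs_of_nonneg (by linarith : 0 ≤ x - g'.a), abs_sub_comm x,
    abs_of_nonneg (by linarith : 0 ≤ g'.b - x),
    abs_sub_comm, abs_of_nonneg (by linarith : 0 ≤ g'.b - g'.a)]
  have e := W.split (x - g'.a) (g'.b - x) d hd (by linarith) (by linarith) (by linarith)
  rw [show x - g'.a + (g'.b - x) = g'.b - g'.a by ring] at e
  linarith

lemma gain_nonneg {g : Gap} {x : ℝ} (hg : g.InUnit) (hx : x ∈ Ioo (0 : ℝ) 1) :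
    0 ≤ W.gain g x := by
  rcases le_total x g.lo with h | h
  · linarith [W.lo_sub_le_gain hg hx h]
  · rcases le_total g.hi x with h' | h'
    · linarith [W.sub_hi_le_gain hg hx h']
    · exact W.le_gain_of_far hg le_rfl (by simpa using h) (by simpa using h')

open Classical in
/-- The contribution of `g` to the interval `[x, y)`. -/
noncomputable def part (g : Gap) (x y : ℝ) : ℝ := if g.Inside x y then W.pot g else g.clip x y

lemma clip_le_part {g : Gap} (hg : g.InUnit) (x y : ℝ) : g.clip x y ≤ W.part g x y := by
  unfold part; split_ifs
  · exact (g.clip_le_len x y).trans (W.len_le_pot hg)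
  · rfl

lemma part_nonneg {g : Gap} (hg : g.InUnit) (x y : ℝ) : 0 ≤ W.part g x y :=
  (g.clip_nonneg x y).trans (W.clip_le_part hg x y)

lemma part_le_pot {g : Gap} (hg : g.InUnit) (x y : ℝ) : W.part g x y ≤ W.pot g := by
  unfold part; split_ifs
  · rfl
  · exact (g.clip_le_len x y).trans (W.len_le_pot hg)

/-- A gap inside one of the two intervals has no length in the other and is inside the union.
Otherwise clipped lengths add up, and they never exceed the contribution. -/
lemma part_add_part_le {g : Gap} (hg : g.InUnit) {x y z : ℝ} (hxy : x ≤ y) (hyz : y ≤ z) :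
    W.part g x y + W.part g y z ≤ W.part g x z := by
  have hlh := g.lo_le_hi
  by_cases h1 : g.Inside x y
  · have h2 : ¬ g.Inside y z := fun h => by linarith [h.1, h1.2]
    have h3 : g.Inside x z := ⟨h1.1, h1.2.trans_le hyz⟩
    unfold part
    rw [if_pos h1, if_neg h2, if_pos h3, Gap.clip_eq_zero_of_hi_le h1.2.le, add_zero]
  · by_cases h2 : g.Inside y z
    · have h3 : g.Inside x z := ⟨hxy.trans h2.1, h2.2⟩
      unfold part
      rw [if_neg h1, if_pos h2, if_pos h3, Gap.clip_eq_zero_of_le_lo h2.1, zero_add]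
    · refine le_trans (le_of_eq ?_) (W.clip_le_part hg x z)
      unfold part
      rw [if_neg h1, if_neg h2, g.clip_add_clip hxy hyz]

end Weights

/-! ### Regions of values and their internal gaps. -/

/-- A core, an open interval `(u, v)`, with its hull, the half-open interval `[u', v')`. -/
structure Region where
  u' : ℝ
  u : ℝ
  v : ℝ
  v' : ℝ
  hu : u' ≤ u
  huv : u < v
  hv : v ≤ v'

namespace Region

noncomputable def len (J : Region) : ℝ := J.v - J.u

lemma len_pos (J : Region) : 0 < J.len := sub_pos.2 J.huv

def Meets (J : Region) (g : Gap) : Prop := g.lo < J.v ∧ J.u < g.hi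

/-- `g` is an internal gap of `J`. -/
def Int (J : Region) (g : Gap) : Prop := J.Meets g ∧ g.Inside J.u' J.v'

def Covered (J : Region) (g : Gap) : Prop := g.Covers J.u' J.v'

/-- The gaps that meet the core are internal or straddle the hull. -/
def Closed (J : Region) (S : Multiset Gap) : Prop :=
  ∀ g ∈ S, J.Meets g → g.Inside J.u' J.v' ∨ J.Covered g

open Classical in
/-- The sum of `φ` over the internal gaps. -/
noncomputable def intSum (J : Region) (φ : Gap → ℝ) (S : Multiset Gap) : ℝ :=
  (S.map fun g => if J.Int g then φ g else 0).sum

lemma intSum_cons_of_int {J : Region} {g : Gap} (φ : Gap → ℝ) (S : Multiset Gap)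
    (h : J.Int g) : J.intSum φ (g ::ₘ S) = φ g + J.intSum φ S := by
  simp [intSum, h]

lemma intSum_mono {J : Region} {φ ψ : Gap → ℝ} {S : Multiset Gap}
    (h : ∀ g ∈ S, J.Int g → φ g ≤ ψ g) : J.intSum φ S ≤ J.intSum ψ S := by
  classical
  unfold intSum
  refine Multiset.sum_map_le_sum_map _ _ fun g hg => ?_
  split_ifs with hi
  · exact h g hg hi
  · rfl

lemma intSum_nonneg {J : Region} {φ : Gap → ℝ} {S : Multiset Gap}
    (h : ∀ g ∈ S, J.Int g → 0 ≤ φ g) : 0 ≤ J.intSum φ S := by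
  classical
  unfold intSum
  refine Multiset.sum_nonneg fun r hr => ?_
  obtain ⟨g, hg, rfl⟩ := Multiset.mem_map.1 hr
  split_ifs with hi
  · exact h g hg hi
  · rfl

lemma intSum_add (J : Region) (φ ψ : Gap → ℝ) (S : Multiset Gap) :
    J.intSum φ S + J.intSum ψ S = J.intSum (fun g => φ g + ψ g) S := by
  classical
  unfold intSum
  rw [← Multiset.sum_map_add]
  congr 1
  refine Multiset.map_congr rfl fun g _ => ?_
  split_ifs <;> simp

lemma le_intSum {J : Region} {φ : Gap → ℝ} {S : Multiset Gap} {g : Gap} (hg : g ∈ S)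
    (hi : J.Int g) (h : ∀ g ∈ S, J.Int g → 0 ≤ φ g) : φ g ≤ J.intSum φ S := by
  obtain ⟨R, rfl⟩ := Multiset.exists_cons_of_mem hg
  rw [intSum_cons_of_int φ R hi]
  have := intSum_nonneg (J := J) (φ := φ) (S := R) fun g hg =>
    h g (Multiset.mem_cons_of_mem hg)
  linarith

end Region

/-! ### Superadditive interval functions. -/

/-- A superadditive function of intervals of integers. -/
structure Superadd (F : ℕ → ℕ → ℝ) : Prop where
  nonneg : ∀ a b, a ≤ b → 0 ≤ F a b
  add_le : ∀ a b c, a ≤ b → b ≤ c → F a b + F b c ≤ F a c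

namespace Superadd

variable {F : ℕ → ℕ → ℝ}

lemma mul_le {t : ℝ} (hF : Superadd F) (s a b : ℕ) (hab : a ≤ b)
    (h : ∀ i, a ≤ i → i < b → t ≤ F (i * s) ((i + 1) * s)) :
    (b - a : ℝ) * t ≤ F (a * s) (b * s) := by
  induction b, hab using Nat.le_induction with
  | base => simpa using hF.nonneg _ _ le_rfl
  | succ b hab ih =>
    have h1 := ih fun i hi hib => h i hi (by omega)
    have h2 := h b hab (by omega)
    have h3 := hF.add_le (a * s) (b * s) ((b + 1) * s) (Nat.mul_le_mul_right _ hab)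
      (Nat.mul_le_mul_right _ (by omega))
    push_cast
    linarith

lemma mul_le_one {t : ℝ} (hF : Superadd F) (a b : ℕ) (hab : a ≤ b)
    (h : ∀ i, a ≤ i → i < b → t ≤ F i (i + 1)) : (b - a : ℝ) * t ≤ F a b := by
  have := hF.mul_le (t := t) 1 a b hab (by simpa using h)
  simpa using this

/-- If the intervals that are bounded by thin cells are heavy, then so is every interval, up to two
cells. -/
lemma group_le {t : ℝ} (ht : 0 ≤ t) (hF : Superadd F) (s n : ℕ)
    (h : ∀ α β, s ≤ α → α + 1 < β → β < s + n → F α (α + 1) < t → F β (β + 1) < t →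
      (β - α - 1 : ℝ) * t ≤ F α (β + 1)) : (n - 2 : ℝ) * t ≤ F s (s + n) := by
  classical
  by_cases hall : ∀ i, s ≤ i → i < s + n → t ≤ F i (i + 1)
  · have := hF.mul_le_one s (s + n) (by omega) hall
    push_cast at this
    nlinarith
  push Not at hall
  -- `α` and `β` are the first and the last thin cell. All cells beyond them are heavy, and `h`
  -- treats what lies between; only these two cells are lost.
  obtain ⟨α, ⟨hα1, hα2, hα3⟩, hαm⟩ := WellFounded.has_min (wellFounded_lt (α := ℕ))
    {i | s ≤ i ∧ i < s + n ∧ F i (i + 1) < t} hall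
  obtain ⟨β, ⟨hβ1, hβ2, hβ3⟩, hβm⟩ : ∃ β, (s ≤ β ∧ β < s + n ∧ F β (β + 1) < t) ∧
      ∀ i, s ≤ i ∧ i < s + n ∧ F i (i + 1) < t → i ≤ β := by
    have hfin : ({i | s ≤ i ∧ i < s + n ∧ F i (i + 1) < t} : Set ℕ).Finite :=
      (Set.finite_Iio (s + n)).subset fun i hi => hi.2.1
    obtain ⟨β, hβ, hm⟩ := hfin.exists_maximal hall
    exact ⟨β, hβ, fun i hi => by
      by_contra hlt
      exact absurd (hm hi (by omega)) (by omega)⟩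
  have hαβ : α ≤ β := hβm α ⟨hα1, hα2, hα3⟩
  have e1 := hF.mul_le_one (t := t) s α hα1 fun i hi hiα => by
    by_contra hc
    exact hαm i ⟨hi, by omega, not_le.1 hc⟩ hiα
  have e2 := hF.mul_le_one (t := t) (β + 1) (s + n) (by omega) fun i hi hin => by
    by_contra hc
    have := hβm i ⟨by omega, hin, not_le.1 hc⟩
    omega
  have e3 : (β - α - 1 : ℝ) * t ≤ F α (β + 1) := by
    by_cases hb : α + 1 < β
    · exact h α β hα1 hb hβ2 hα3 hβ3
    · have h0 := hF.nonneg α (β + 1) (by omega)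
      have : (β : ℝ) ≤ α + 1 := by exact_mod_cast not_lt.1 hb
      nlinarith
  have f1 := hF.add_le s α (β + 1) hα1 (by omega)
  have f2 := hF.add_le s (β + 1) (s + n) (by omega) (by omega)
  push_cast at e2
  nlinarith

end Superadd

/-! ### Mass, lean cores and straddling gaps. -/

namespace Weights

variable (W : Weights)

/-- The mass of the internal gaps of `J` in `[x, y)`. -/
noncomputable def mass (S : Multiset Gap) (J : Region) (x y : ℝ) : ℝ :=
  J.intSum (fun g => W.part g x y) S

lemma mass_nonneg {S : Multiset Gap} (hS : ∀ g ∈ S, g.InUnit) (J : Region) (x y : ℝ) :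
    0 ≤ W.mass S J x y :=
  Region.intSum_nonneg fun g hg _ => W.part_nonneg (hS g hg) x y

lemma mass_add_mass_le {S : Multiset Gap} (hS : ∀ g ∈ S, g.InUnit) (J : Region) {x y z : ℝ}
    (hxy : x ≤ y) (hyz : y ≤ z) : W.mass S J x y + W.mass S J y z ≤ W.mass S J x z := by
  unfold mass
  rw [Region.intSum_add]
  exact Region.intSum_mono fun g hg _ => W.part_add_part_le (hS g hg) hxy hyz

lemma mass_le_pot {S : Multiset Gap} (hS : ∀ g ∈ S, g.InUnit) (J : Region) (x y : ℝ) :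
    W.mass S J x y ≤ J.intSum W.pot S :=
  Region.intSum_mono fun g hg _ => W.part_le_pot (hS g hg) x y

/-- There is a light core of a lower level with hull in `[x, y)`, such that the internal gaps of `J`
that straddle the hull reach far beyond it. -/
def LeanCore (S : Multiset Gap) (J : Region) (k : ℕ) (x y : ℝ) : Prop :=
  ∃ c : Region, ∃ k' < k, x ≤ c.u' ∧ c.v' ≤ y ∧ c.Closed S ∧
    c.intSum W.pot S ≤ k' / 64 * c.len ∧ W.scale k' ≤ c.len ∧ c.len ≤ J.len / 2 ∧
    ∀ g ∈ S, J.Int g → c.Covered g → g.lo ≤ c.u - W.R * c.len ∧ c.v + W.R * c.len ≤ g.hi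

variable {W} in
lemma LeanCore.mono {S : Multiset Gap} {J : Region} {k : ℕ} {x y x' y' : ℝ}
    (h : W.LeanCore S J k x y) (hx : x' ≤ x) (hy : y ≤ y') : W.LeanCore S J k x' y' := by
  obtain ⟨c, k', h1, h2, h3, h4⟩ := h
  exact ⟨c, k', h1, hx.trans h2, h3.trans hy, h4⟩

open Classical in
/-- The number of internal gaps of `J` that straddle `[x, y)`. -/
noncomputable def straddlers (S : Multiset Gap) (J : Region) (x y : ℝ) : Multiset Gap :=
  S.filter fun g => J.Int g ∧ g.Covers x y

lemma straddlers_le (S : Multiset Gap) (J : Region) {x y x' y' : ℝ} (hx : x ≤ x') (hy : y' ≤ y) :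
    straddlers S J x y ≤ straddlers S J x' y' := by
  classical
  unfold straddlers
  refine Multiset.monotone_filter_right _ fun g hg => ?_
  exact ⟨hg.1, hg.2.1.trans_le hx, hy.trans hg.2.2⟩

/-- The straddlers of the larger interval form a submultiset of those of the smaller one, so the
bound on the cardinalities makes them equal. -/
lemma covers_of_card_straddlers_le {S : Multiset Gap} {J : Region} {x y x' y' : ℝ} (hx : x ≤ x')
    (hy : y' ≤ y)
    (h : Multiset.card (straddlers S J x' y') ≤ Multiset.card (straddlers S J x y))
    {g : Gap} (hg : g ∈ S) (hi : J.Int g) (hc : g.Covers x' y') : g.Covers x y := by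
  classical
  have heq := Multiset.eq_of_le_of_card_le (straddlers_le S J hx hy) h
  have : g ∈ straddlers S J x y := by
    rw [heq]; exact Multiset.mem_filter.2 ⟨hg, hi, hc⟩
  exact (Multiset.mem_filter.1 this).2.2

lemma straddlers_mul (S : Multiset Gap) (J : Region) (x y d : ℝ) :
    (Multiset.card (straddlers S J x y) : ℝ) * d =
      J.intSum (fun g => open Classical in if g.Covers x y then d else 0) S := by
  classical
  unfold straddlers Region.intSum
  induction S using Multiset.induction_on with
  | empty => simp
  | cons g S ih =>
    by_cases h1 : J.Int g <;> by_cases h2 : g.Covers x y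
    all_goals simp [h1, h2, add_mul] at ih ⊢
    all_goals linarith

lemma straddlers_mul_le_mass {S : Multiset Gap} (hS : ∀ g ∈ S, g.InUnit) (J : Region) {x y : ℝ}
    (hxy : x ≤ y) :
    (Multiset.card (straddlers S J x y) : ℝ) * (y - x) ≤ W.mass S J x y := by
  rw [straddlers_mul]
  refine Region.intSum_mono fun g hg _ => ?_
  split_ifs with h
  · rw [← h.clip_eq hxy]; exact W.clip_le_part (hS g hg) x y
  · exact W.part_nonneg (hS g hg) x y

variable {W}

/-- Between two tight zones `[a, p)` and `[q, b)` of `[x, y)`, the mass is large if there is no lean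
core. -/
lemma core_mass_le {S : Multiset Gap} (hS : ∀ g ∈ S, g.InUnit) {J : Region} (hJ : J.Closed S)
    {k : ℕ} {x y : ℝ} (hno : ¬ W.LeanCore S J k x y) (hx : J.u ≤ x) (hy : y ≤ J.v)
    {a p q b : ℝ} (hxa : x ≤ a) (hap : a ≤ p) (hpq : p < q) (hqb : q ≤ b) (hby : b ≤ y)
    {i : ℕ} (hi : i = Multiset.card (straddlers S J x y))
    (ha : Multiset.card (straddlers S J a p) ≤ i) (hb : Multiset.card (straddlers S J q b) ≤ i)
    (hleft : x ≤ p - W.R * (q - p)) (hright : q + W.R * (q - p) ≤ y)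
    {k' : ℕ} (hk' : k' < k) (hscale : W.scale k' ≤ q - p) (hhalf : q - p ≤ J.len / 2) :
    (k' / 64 + i : ℝ) * (q - p) ≤ W.mass S J a b := by
  have hca : ∀ g ∈ S, J.Int g → g.Covers a p → g.Covers x y := fun g hg hgi hgc =>
    covers_of_card_straddlers_le hxa (by linarith) (by omega) hg hgi hgc
  have hcb : ∀ g ∈ S, J.Int g → g.Covers q b → g.Covers x y := fun g hg hgi hgc =>
    covers_of_card_straddlers_le (by linarith) hby (by omega) hg hgi hgc
  have hJu := J.hu
  have hJv := J.hv
  set c : Region := ⟨a, p, q, b, hap, hpq, hqb⟩ with hc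
  have hJmeet : ∀ g, c.Meets g → J.Meets g := fun g hg =>
    ⟨by have := hg.1; simp only [hc] at this; linarith,
      by have := hg.2; simp only [hc] at this; linarith⟩
  have hJint : ∀ g, c.Int g → J.Int g := fun g hg =>
    ⟨hJmeet g hg.1, by have := hg.2.1; simp only [hc] at this; linarith,
      by have := hg.2.2; simp only [hc] at this; linarith⟩
  -- An internal gap of `J` that meets the core and leaves the hull on some side crosses one of the
  -- two tight zones, hence straddles all of `[x, y)`.
  have hclosed : c.Closed S := by
    intro g hg hm
    have hm1 : g.lo < q := hm.1
    have hm2 : p < g.hi := hm.2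
    show (a ≤ g.lo ∧ g.hi < b) ∨ (g.lo < a ∧ b ≤ g.hi)
    rcases hJ g hg (hJmeet g hm) with hin | hcov
    · have hint : J.Int g := ⟨hJmeet g hm, hin⟩
      rcases lt_or_ge g.lo a with h1 | h1
      · have := hca g hg hint ⟨h1, hm2.le⟩
        exact Or.inr ⟨h1, by linarith [this.2]⟩
      · rcases lt_or_ge g.hi b with h2 | h2
        · exact Or.inl ⟨h1, h2⟩
        · have := hcb g hg hint ⟨hm1, h2⟩
          exact Or.inr ⟨by linarith [this.1], h2⟩
    · exact Or.inr ⟨by linarith [hcov.1], by linarith [hcov.2]⟩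
  -- Otherwise `c` would be a lean core: the gaps that cover it straddle `[x, y)`, which has margins
  -- of `R` core lengths on both sides.
  have hmass : k' / 64 * (q - p) < c.intSum W.pot S := by
    by_contra hcon
    refine hno ⟨c, k', hk', hxa, hby, hclosed, not_lt.1 hcon, hscale, hhalf, ?_⟩
    intro g hg hgi hgc
    have hcx : g.Covers x y := hca g hg hgi ⟨hgc.1, by
      have := hgc.2; simp only [hc] at this; linarith⟩
    exact ⟨by have := hcx.1; show g.lo ≤ p - W.R * (q - p); linarith,
      by have := hcx.2; show q + W.R * (q - p) ≤ g.hi; linarith⟩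
  -- A straddler of `[x, y)` is not internal to `c`, so both kinds of gaps count; each straddler
  -- contributes `b - a ≥ q - p`.
  have hsum : c.intSum W.pot S + (Multiset.card (straddlers S J x y) : ℝ) * (q - p) ≤
      W.mass S J a b := by
    classical
    rw [straddlers_mul]
    unfold mass Region.intSum
    rw [← Multiset.sum_map_add]
    refine Multiset.sum_map_le_sum_map _ _ fun g hg => ?_
    by_cases hcg : c.Int g
    · have hncov : ¬ g.Covers x y := fun h => by
        have := h.1; have := hcg.2.1; simp only [hc] at this; linarith
      have : g.Inside a b := hcg.2
      simp only [hcg, hJint g hcg, hncov, if_true, if_false, add_zero, part, this, le_refl]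
    · by_cases hJg : J.Int g
      · simp only [hcg, hJg, if_true, if_false, zero_add]
        split_ifs with hcov
        · have h1 : g.Covers a b := ⟨by linarith [hcov.1], by linarith [hcov.2]⟩
          have := W.clip_le_part (hS g hg) a b
          rw [h1.clip_eq (by linarith)] at this
          linarith
        · exact W.part_nonneg (hS g hg) a b
      · simp [hcg, hJg]
  rw [← hi] at hsum
  linarith

end Weights

/-! ### Heavy intervals in the absence of lean cores. -/

namespace Weights

variable {W : Weights}

-- A straddler contributes density 1 and thus replaces 64 levels; once `64 * i ≥ k₁`, straddlers
-- alone suffice. With exactly `i` straddlers, the interval is cut into zones. By induction, a zone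
-- with more straddlers is heavy, so a thin zone is crossed only by the straddlers of the whole
-- interval. Two thin zones therefore bound a closed region, which by `core_mass_le` is heavy
-- because it is not a lean core.
set_option maxHeartbeats 1000000 in
lemma mass_ge_of_straddlers {S : Multiset Gap} (hS : ∀ g ∈ S, g.InUnit) {J : Region}
    (hJ : J.Closed S) {k₁ : ℕ} {x₀ y₀ : ℝ} (hno : ¬ W.LeanCore S J (k₁ + 1) x₀ y₀)
    (hx₀ : J.u ≤ x₀) (hy₀ : y₀ ≤ J.v) (j : ℕ) :
    ∀ (i : ℕ) (x y : ℝ), k₁ ≤ 64 * (i + j) → x₀ ≤ x → x < y → y ≤ y₀ →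
      i ≤ Multiset.card (straddlers S J x y) → W.zones * W.scale (k₁ - 64 * i) ≤ y - x →
      (k₁ / 64 - j * (4 * (k₁ / 64) / W.groupSize) : ℝ) * (y - x) ≤ W.mass S J x y := by
  have hg0 : (4096 : ℝ) ≤ W.groupSize := by exact_mod_cast W.groupSize_pos
  set κ : ℝ := 4 * (k₁ / 64) / W.groupSize with hκ
  have hκ0 : 0 ≤ κ := by positivity
  have htriv : ∀ (j : ℕ) (x y : ℝ), x < y → k₁ ≤ 64 * Multiset.card (straddlers S J x y) →
      (k₁ / 64 - j * κ : ℝ) * (y - x) ≤ W.mass S J x y := by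
    intro j x y hxy hq
    refine le_trans ?_ (W.straddlers_mul_le_mass hS J hxy.le)
    have : (k₁ : ℝ) ≤ 64 * Multiset.card (straddlers S J x y) := by exact_mod_cast hq
    have : 0 ≤ j * κ := by positivity
    gcongr
    linarith
  induction j with
  | zero =>
    intro i x y hij hx hxy hy hq _
    exact htriv 0 x y hxy (by omega)
  | succ j ih =>
    intro i x y hij hx hxy hy hq hlen
    have hle : (k₁ / 64 - (j + 1 : ℕ) * κ : ℝ) ≤ k₁ / 64 - j * κ := by push_cast; linarith
    have hxy0 : 0 ≤ y - x := by linarith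
    by_cases hq1 : k₁ ≤ 64 * Multiset.card (straddlers S J x y)
    · exact htriv _ x y hxy hq1
    by_cases hq2 : i + 1 ≤ Multiset.card (straddlers S J x y)
    · refine le_trans (mul_le_mul_of_nonneg_right hle hxy0)
        (ih (i + 1) x y (by omega) hx hxy hy hq2 (le_trans ?_ hlen))
      gcongr
      exact W.scale_mono (by omega)
    have hqi : i = Multiset.card (straddlers S J x y) := by omega
    have hik : 64 * i < k₁ := by omega
    by_cases hT : (k₁ / 64 - j * κ : ℝ) < 0
    · refine le_trans ?_ (W.mass_nonneg hS J x y)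
      nlinarith
    rw [not_lt] at hT
    set T : ℝ := k₁ / 64 - j * κ with hTdef
    have hTle : T ≤ k₁ / 64 := by
      have : 0 ≤ j * κ := by positivity
      linarith
    have hz := W.one_le_zones
    set h : ℝ := (y - x) / W.zones with hh
    have hh0 : 0 < h := div_pos (by linarith) (by linarith)
    have hzh : W.zones * h = y - x := by rw [hh]; field_simp
    have hscale : W.scale (k₁ - 64 * i) ≤ h := by
      rw [hh, le_div_iff₀ (by linarith)]; linarith
    set g := W.groupSize with hg
    have hgR : (W.zones : ℝ) = W.R * g * g := by unfold zones; push_cast; rfl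
    have hR : (1 : ℝ) ≤ W.R := by exact_mod_cast W.R_pos
    have hF : Superadd fun a b : ℕ => W.mass S J (x + a * h) (x + b * h) :=
      ⟨fun a b _ => W.mass_nonneg hS J _ _, fun a b c hab hbc =>
        W.mass_add_mass_le hS J (by gcongr) (by gcongr)⟩
    -- The induction hypothesis applies to a single zone because one zone of the present scale is
    -- long enough for the level lower by 64.
    have htight : ∀ α : ℕ, α + 1 ≤ W.zones →
        W.mass S J (x + α * h) (x + ((α + 1 : ℕ) : ℝ) * h) < T * h →
        Multiset.card (straddlers S J (x + α * h) (x + (α + 1 : ℕ) * h)) ≤ i := by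
      intro α hα hlt
      by_contra hc
      have hα' : ((α + 1 : ℕ) : ℝ) * h ≤ y - x := by
        rw [← hzh]; gcongr
      have h0 : 0 ≤ α * h := by positivity
      have e := ih (i + 1) (x + α * h) (x + (α + 1 : ℕ) * h) (by omega) (by linarith)
        (by push_cast; linarith) (by linarith) (by omega) (by
          have := W.zones_mul_scale_le (show k₁ - 64 * (i + 1) < k₁ - 64 * i by omega)
          push_cast; linarith)
      have : x + (α + 1 : ℕ) * h - (x + α * h) = h := by push_cast; ring
      rw [this] at e
      linarith
    -- A core within a group has at most `g` zones, so leaving out `R` groups at each end provides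
    -- the margins of `R` core lengths.
    have hgroup : ∀ G : ℕ, W.R ≤ G → G < W.R * g - W.R →
        (g - 2 : ℝ) * (T * h) ≤
          W.mass S J (x + (G * g : ℕ) * h) (x + ((G + 1) * g : ℕ) * h) := by
      intro G hG1 hG2
      have := hF.group_le (t := T * h) (by positivity) (G * g) g (by
        intro α β hα hαβ hβ h1 h2
        have hzeq : W.zones = W.R * g * g := rfl
        have hb1 : (G + 1) * g ≤ (W.R * g - W.R) * g := Nat.mul_le_mul_right _ (by omega)
        have hb2 : (W.R * g - W.R) * g + W.R * g = W.zones := by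
          rw [← add_mul, hzeq, Nat.sub_add_cancel]
          exact Nat.le_mul_of_pos_right _ (by have := W.groupSize_pos; omega)
        have hb3 : W.R * g ≤ G * g := Nat.mul_le_mul_right _ hG1
        have hb4 : (G + 1) * g = G * g + g := by ring
        have hβz : β + 1 ≤ W.zones := by omega
        have hαR : (W.R * g : ℝ) ≤ α := by exact_mod_cast hb3.trans hα
        have hβR : (β + 1 + W.R * g : ℝ) ≤ W.zones := by
          exact_mod_cast (show β + 1 + W.R * g ≤ W.zones by omega)
        have hαβg : (β - α : ℝ) ≤ g := by
          have : (β : ℝ) ≤ α + g := by exact_mod_cast (show β ≤ α + g by omega)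
          linarith
        have hαβ1 : (α : ℝ) + 2 ≤ β := by exact_mod_cast hαβ
        have hRd : W.R * (β - α - 1 : ℝ) ≤ W.R * g := by gcongr; linarith
        have hR0 : 0 ≤ W.R * (g : ℝ) := by positivity
        have hgz : 2 * (g : ℝ) ≤ W.zones := by
          rw [hgR]
          have : 0 ≤ (W.R - 1 : ℝ) * (g * g) := by
            apply mul_nonneg <;> first | linarith | positivity
          nlinarith
        have hdiff : x + β * h - (x + (α + 1 : ℕ) * h) = (β - α - 1 : ℝ) * h := by
          push_cast; ring
        have m1 : h ≤ (β - α - 1 : ℝ) * h := le_mul_of_one_le_left hh0.le (by linarith)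
        have m2 : W.R * ((β - α - 1 : ℝ) * h) ≤ W.R * g * h := by
          rw [← mul_assoc]; exact mul_le_mul_of_nonneg_right hRd hh0.le
        have m3 : W.R * g * h ≤ α * h := mul_le_mul_of_nonneg_right hαR hh0.le
        have m4 : β * h + h + W.R * g * h ≤ y - x := by
          rw [← hzh]
          have := mul_le_mul_of_nonneg_right hβR hh0.le
          linarith [add_mul (β + 1 : ℝ) (W.R * g) h, add_mul (β : ℝ) 1 h]
        have m5 : 2 * ((β - α - 1 : ℝ) * h) ≤ y - x := by
          rw [← hzh, ← mul_assoc]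
          exact mul_le_mul_of_nonneg_right (by linarith) hh0.le
        have m6 : ((α + 1 : ℕ) : ℝ) * h = α * h + h := by push_cast; ring
        have m7 : ((β + 1 : ℕ) : ℝ) * h = β * h + h := by push_cast; ring
        have e := core_mass_le (W := W) hS hJ (k := k₁ + 1) (x := x) (y := y)
          (fun hl => hno (hl.mono hx hy)) (by linarith) (by linarith)
          (a := x + α * h) (p := x + (α + 1 : ℕ) * h) (q := x + β * h)
          (b := x + (β + 1 : ℕ) * h)
          (by have : 0 ≤ α * h := by positivity
              linarith)
          (by rw [m6]; linarith) (by linarith) (by rw [m7]; linarith)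
          (by have : 0 ≤ W.R * g * h := by positivity
              rw [m7]; linarith)
          hqi (htight α (by omega) h1) (htight β hβz h2)
          (by rw [hdiff, m6]; linarith)
          (by rw [hdiff]; linarith)
          (k' := k₁ - 64 * i) (by omega)
          (by rw [hdiff]; linarith)
          (by
            rw [hdiff]
            have : y - x ≤ J.len := by unfold Region.len; linarith
            linarith)
        rw [hdiff] at e
        have hk' : ((k₁ - 64 * i : ℕ) : ℝ) / 64 + i = k₁ / 64 := by
          rw [Nat.cast_sub hik.le]; push_cast; ring
        rw [hk'] at e
        refine le_trans ?_ e
        have : 0 ≤ (β - α - 1 : ℝ) * h := mul_nonneg (by linarith) hh0.le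
        rw [mul_left_comm]
        exact mul_le_mul_of_nonneg_right hTle this)
      have e : G * g + g = (G + 1) * g := by ring
      rw [← e]; exact this
    have hRM : W.R ≤ W.R * g - W.R := by
      have := W.groupSize_pos
      have : W.R * 2 ≤ W.R * g := Nat.mul_le_mul_left _ (by omega)
      omega
    have hmid := hF.mul_le (t := (g - 2 : ℝ) * (T * h)) g W.R (W.R * g - W.R) hRM hgroup
    have hle1 := hF.add_le 0 (W.R * g) ((W.R * g - W.R) * g) (by omega)
      (Nat.mul_le_mul_right _ hRM)
    have hle2 := hF.add_le 0 ((W.R * g - W.R) * g) W.zones (by omega)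
      (by unfold zones; exact Nat.mul_le_mul_right _ (Nat.sub_le _ _))
    have n1 := hF.nonneg 0 (W.R * g) (by omega)
    have n2 := hF.nonneg ((W.R * g - W.R) * g) W.zones
      (by unfold zones; exact Nat.mul_le_mul_right _ (Nat.sub_le _ _))
    have hy' : x + (W.zones : ℝ) * h = y := by linarith
    simp only [Nat.cast_zero, zero_mul, add_zero, hy'] at hle1 hle2 n1 n2
    have hcount : ((W.R * g - W.R : ℕ) : ℝ) - W.R = W.R * g - W.R - W.R := by
      rw [Nat.cast_sub (by omega)]; push_cast; rfl
    rw [hcount] at hmid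
    -- There remain `R * (g - 2)` groups that count `g - 2` zones each: the fraction `(1 - 2 / g) ^
    -- 2` of `T`, a loss of at most `4 * T / g ≤ κ`.
    have hfin : (k₁ / 64 - (j + 1 : ℕ) * κ : ℝ) * (y - x) ≤
        (W.R * g - W.R - W.R : ℝ) * ((g - 2) * (T * h)) := by
      have hκg : κ * g = 4 * (k₁ / 64) := by rw [hκ]; field_simp
      have e1 : (k₁ / 64 - (j + 1 : ℕ) * κ : ℝ) = T - κ := by rw [hTdef]; push_cast; ring
      rw [e1, ← hzh, hgR]
      have e2 : (T - κ) * (W.R * g * g * h) = W.R * h * (T * g * g - g * (κ * g)) := by ring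
      have e3 : (W.R * g - W.R - W.R : ℝ) * ((g - 2) * (T * h)) =
          W.R * h * (T * g * g - 4 * g * T + 4 * T) := by ring
      rw [e2, e3, hκg]
      gcongr
      nlinarith
    linarith

/-- Without lean cores, every sufficiently long interval has large mass. -/
lemma mass_ge_of_not_leanCore {S : Multiset Gap} (hS : ∀ g ∈ S, g.InUnit) {J : Region}
    (hJ : J.Closed S) {k₁ : ℕ} (hk : k₁ ≤ W.K) {x y : ℝ} (hno : ¬ W.LeanCore S J (k₁ + 1) x y)
    (hx : J.u ≤ x) (hy : y ≤ J.v) (hlen : W.zones * W.scale k₁ ≤ y - x) :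
    ((k₁ - 1) / 64 : ℝ) * (y - x) ≤ W.mass S J x y := by
  have hxy : x < y := by
    have := W.scale_pos k₁; have := W.one_le_zones
    have : 0 < W.zones * W.scale k₁ := by positivity
    linarith
  -- The number of stages is the rounded-down quotient plus one, so that `i = k₁ / 64 + 1` satisfies
  -- `k₁ ≤ 64 * i`.
  have := mass_ge_of_straddlers hS hJ hno hx hy (k₁ / 64 + 1) 0 x y (by omega) le_rfl hxy le_rfl
    (Nat.zero_le _) (by simpa using hlen)
  refine le_trans ?_ this
  have hxy' : 0 ≤ y - x := by linarith
  gcongr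
  have hg : (W.groupSize : ℝ) = (W.K + 64) ^ 2 := by unfold groupSize; push_cast; rfl
  have h1 : ((k₁ / 64 + 1 : ℕ) : ℝ) ≤ k₁ / 64 + 1 := by
    push_cast; gcongr; exact Nat.cast_div_le
  have hK : (k₁ : ℝ) ≤ W.K := by exact_mod_cast hk
  have h2 : ((k₁ / 64 + 1 : ℕ) : ℝ) * (4 * (k₁ / 64) / W.groupSize) ≤ 1 / 64 := by
    rw [hg]
    calc _ ≤ (k₁ / 64 + 1 : ℝ) * (4 * (k₁ / 64) / (W.K + 64) ^ 2) := by gcongr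
      _ ≤ 1 / 64 := by
        rw [mul_div_assoc', div_le_iff₀ (by positivity)]
        have : (0 : ℝ) ≤ k₁ := by positivity
        nlinarith
  linarith

end Weights

/-! ### The insertion process and runs inside a region. -/

/-- An online insertion process: as long as the state `s` is alive, every value `x` in `(0, 1)` is
put into one of the gaps, where it occupies one of the free cells. -/
structure GapSystem where
  State : Type
  gaps : State → Multiset Gap
  next : State → ℝ → State
  Alive : State → Prop
  inUnit : ∀ s, ∀ g ∈ gaps s, g.InUnit
  step : ∀ s, Alive s → ∀ x ∈ Ioo (0 : ℝ) 1, ∃ (g : Gap) (S : Multiset Gap) (i j : ℕ),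
    g.m = i + j + 1 ∧ gaps s = g ::ₘ S ∧ gaps (next s x) = ⟨g.a, x, i⟩ ::ₘ ⟨x, g.b, j⟩ ::ₘ S

namespace GapSystem

variable {Y : GapSystem} {W : Weights}

/-- In the state `s`, the value `x` is put into the gap `g`. -/
def Uses (Y : GapSystem) (s : Y.State) (x : ℝ) (g : Gap) : Prop :=
  ∃ (S : Multiset Gap) (i j : ℕ), g.m = i + j + 1 ∧ Y.gaps s = g ::ₘ S ∧
    Y.gaps (Y.next s x) = ⟨g.a, x, i⟩ ::ₘ ⟨x, g.b, j⟩ ::ₘ S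

lemma exists_uses {s : Y.State} (hs : Y.Alive s) {x : ℝ} (hx : x ∈ Ioo (0 : ℝ) 1) :
    ∃ g, Y.Uses s x g := by
  obtain ⟨g, S, i, j, h⟩ := Y.step s hs x hx
  exact ⟨g, S, i, j, h⟩

/-- The total number of free cells. -/
def free (Y : GapSystem) (s : Y.State) : ℕ := ((Y.gaps s).map Gap.m).sum

/-- `Th` decides whether a region is light, and `Am` measures the success of the adversary. Their
difference, a quarter of the internal `cst`, never decreases during a run: a step adds a quarter of
its gain. -/
noncomputable def Th (Y : GapSystem) (W : Weights) (J : Region) (s : Y.State) : ℝ :=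
  J.intSum W.pot (Y.gaps s)

noncomputable def Am (Y : GapSystem) (W : Weights) (J : Region) (s : Y.State) : ℝ :=
  J.intSum W.apot (Y.gaps s)

lemma Uses.mem {s : Y.State} {x : ℝ} {g : Gap} (h : Y.Uses s x g) : g ∈ Y.gaps s := by
  obtain ⟨S, i, j, -, h, -⟩ := h
  rw [h]; exact Multiset.mem_cons_self _ _

lemma Uses.free_lt {s : Y.State} {x : ℝ} {g : Gap} (h : Y.Uses s x g) :
    Y.free (Y.next s x) + 1 = Y.free s := by
  obtain ⟨S, i, j, h1, h2, h3⟩ := h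
  unfold free
  rw [h2, h3]
  simp only [Multiset.map_cons, Multiset.sum_cons, h1]
  omega

end GapSystem

lemma Region.Int.split {J : Region} {g : Gap} (hg : J.Int g) {x : ℝ} (hx : x ∈ Ioo J.u J.v)
    (i j : ℕ) : J.Int ⟨g.a, x, i⟩ ∧ J.Int ⟨x, g.b, j⟩ := by
  obtain ⟨⟨h1, h2⟩, h3, h4⟩ := hg
  have hu := J.hu
  have hv := J.hv
  obtain ⟨hx1, hx2⟩ := hx
  unfold Gap.lo at h3; unfold Gap.hi at h4
  rw [le_min_iff] at h3; rw [max_lt_iff] at h4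
  refine ⟨⟨⟨?_, ?_⟩, ?_, ?_⟩, ⟨?_, ?_⟩, ?_, ?_⟩
  · exact min_lt_of_right_lt hx2
  · exact lt_max_of_lt_right hx1
  · exact le_min h3.1 (by linarith)
  · exact max_lt h4.1 (by linarith)
  · exact min_lt_of_left_lt hx2
  · exact lt_max_of_lt_left hx1
  · exact le_min (by linarith) h3.2
  · exact max_lt (by linarith) h4.2

namespace GapSystem

variable {Y : GapSystem} {W : Weights}

lemma Uses.intSum_next {s : Y.State} {x : ℝ} {g : Gap} (h : Y.Uses s x g) {J : Region}
    (hg : J.Int g) (hx : x ∈ Ioo J.u J.v) :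
    ∃ i j : ℕ, g.m = i + j + 1 ∧ ∀ φ : Gap → ℝ, J.intSum φ (Y.gaps (Y.next s x)) =
      J.intSum φ (Y.gaps s) - φ g + φ ⟨g.a, x, i⟩ + φ ⟨x, g.b, j⟩ := by
  obtain ⟨S, i, j, h1, h2, h3⟩ := h
  refine ⟨i, j, h1, fun φ => ?_⟩
  have := hg.split hx i j
  rw [h2, h3, Region.intSum_cons_of_int _ _ hg, Region.intSum_cons_of_int _ _ this.1,
    Region.intSum_cons_of_int _ _ this.2]
  ring

lemma Uses.th_next {s : Y.State} {x : ℝ} {g : Gap} (h : Y.Uses s x g) {J : Region}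
    (hg : J.Int g) (hx : x ∈ Ioo J.u J.v) :
    Y.Th W J (Y.next s x) = Y.Th W J s + W.gain g x - W.w := by
  obtain ⟨i, j, hm, hφ⟩ := h.intSum_next hg hx
  unfold Th
  rw [hφ W.pot]
  unfold Weights.pot Weights.gain Gap.len
  rw [hm]; push_cast; ring

lemma Uses.am_next {s : Y.State} {x : ℝ} {g : Gap} (h : Y.Uses s x g) {J : Region}
    (hg : J.Int g) (hx : x ∈ Ioo J.u J.v) :
    Y.Am W J (Y.next s x) = Y.Am W J s + 5 / 4 * W.gain g x - W.w := by
  obtain ⟨i, j, hm, hφ⟩ := h.intSum_next hg hx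
  unfold Am
  rw [hφ W.apot]
  unfold Weights.apot Weights.gain Gap.len
  rw [hm]; push_cast; ring

/-- A gap that is not inside the interval counts with its clipped length only, which its two parts
retain. Only a gap inside could lose mass, through its used cell. -/
lemma Uses.mass_le_next {s : Y.State} {x : ℝ} {g : Gap} (h : Y.Uses s x g) {J : Region}
    (hg : J.Int g) (hx : x ∈ Ioo J.u J.v) {p q : ℝ} (hn : ¬ g.Inside p q) :
    W.mass (Y.gaps s) J p q ≤ W.mass (Y.gaps (Y.next s x)) J p q := by
  have hU := Y.inUnit (Y.next s x)
  obtain ⟨S, i, j, h1, h2, h3⟩ := h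
  have hsp := hg.split hx i j
  unfold Weights.mass
  rw [h2, h3, Region.intSum_cons_of_int _ _ hg, Region.intSum_cons_of_int _ _ hsp.1,
    Region.intSum_cons_of_int _ _ hsp.2]
  have e1 : W.part g p q = g.clip p q := if_neg hn
  have e2 := Gap.clip_le_split g.a g.b x g.m i j p q
  have e3 := W.clip_le_part (hU ⟨g.a, x, i⟩ (by rw [h3]; simp)) p q
  have e4 := W.clip_le_part (hU ⟨x, g.b, j⟩ (by rw [h3]; simp)) p q
  rw [e1]
  have e5 : (Gap.mk g.a g.b g.m).clip p q = g.clip p q := rfl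
  linarith

lemma Uses.closed_next {s : Y.State} {x : ℝ} {g : Gap} (h : Y.Uses s x g) {J : Region}
    (hg : J.Int g) (hx : x ∈ Ioo J.u J.v) (hJ : J.Closed (Y.gaps s)) :
    J.Closed (Y.gaps (Y.next s x)) := by
  obtain ⟨S, i, j, h1, h2, h3⟩ := h
  have hsp := hg.split hx i j
  intro g' hg' hm
  rw [h3, Multiset.mem_cons, Multiset.mem_cons] at hg'
  rcases hg' with rfl | rfl | hg'
  · exact Or.inl hsp.1.2
  · exact Or.inl hsp.2.2
  · exact hJ g' (by rw [h2]; exact Multiset.mem_cons_of_mem hg') hm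

lemma Uses.mem_of_mem_next {s : Y.State} {x : ℝ} {g : Gap} (h : Y.Uses s x g) {J : Region}
    (hg : J.Int g) (hx : x ∈ Ioo J.u J.v) {g' : Gap} (hg' : g' ∈ Y.gaps (Y.next s x))
    (hn : ¬ J.Int g') : g' ∈ Y.gaps s := by
  obtain ⟨S, i, j, h1, h2, h3⟩ := h
  have hsp := hg.split hx i j
  rw [h3, Multiset.mem_cons, Multiset.mem_cons] at hg'
  rcases hg' with rfl | rfl | hg'
  · exact absurd hsp.1 hn
  · exact absurd hsp.2 hn
  · rw [h2]; exact Multiset.mem_cons_of_mem hg'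

/-- A step that uses an internal gap of `J`. -/
def IStep (Y : GapSystem) (J : Region) (s s' : Y.State) : Prop :=
  ∃ x ∈ Ioo J.u J.v, ∃ g, Y.Uses s x g ∧ J.Int g ∧ s' = Y.next s x

abbrev IRun (Y : GapSystem) (J : Region) : Y.State → Y.State → Prop :=
  Relation.ReflTransGen (Y.IStep J)

lemma IRun.free_le {J : Region} {s s' : Y.State} (h : Y.IRun J s s') :
    s' = s ∨ Y.free s' < Y.free s := by
  induction h with
  | refl => exact Or.inl rfl
  | tail _ hst ih =>
    obtain ⟨x, hx, g, hu, -, rfl⟩ := hst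
    have := hu.free_lt
    rcases ih with rfl | ih
    · right; omega
    · right; omega

/-- The effect of a run in `c` on a region `J` whose core contains the hull of `c`. -/
structure RunEffect (Y : GapSystem) (W : Weights) (c J : Region) (s s' : Y.State) : Prop where
  run : Y.IRun J s s'
  closed : J.Closed (Y.gaps s')
  am : Y.Am W J s' - Y.Am W J s = Y.Am W c s' - Y.Am W c s
  th : Y.Th W J s' - Y.Th W J s = Y.Th W c s' - Y.Th W c s
  diff : Y.Am W J s - Y.Th W J s ≤ Y.Am W J s' - Y.Th W J s'
  mem : ∀ g ∈ Y.gaps s', ¬ c.Int g → g ∈ Y.gaps s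
  mass : ∀ p q, q ≤ c.u' ∨ c.v' ≤ p → W.mass (Y.gaps s) J p q ≤ W.mass (Y.gaps s') J p q

/-- The hull of `c` lies in the core of `J`, so internal gaps of `c` are internal for `J`, and each
step changes the sums of both regions by the same amount. -/
lemma IRun.effect {c J : Region} {s s' : Y.State} (h : Y.IRun c s s') (hu : J.u ≤ c.u')
    (hv : c.v' ≤ J.v) (h0 : 0 ≤ J.u) (h1 : J.v ≤ 1) (hJ : J.Closed (Y.gaps s)) :
    Y.RunEffect W c J s s' := by
  have := c.hu; have := c.hv; have := J.hu; have := J.hv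
  induction h with
  | refl => exact ⟨.refl, hJ, by ring, by ring, le_rfl, fun g h _ => h, fun p q _ => le_rfl⟩
  | @tail s₁ s₂ _ hst ih =>
    obtain ⟨x, hx, g, huse, hg, rfl⟩ := hst
    have hgJ : J.Int g := ⟨⟨by linarith [g.lo_le_hi, hg.2.2], by linarith [hg.1.2]⟩,
      by linarith [hg.2.1], by linarith [hg.2.2]⟩
    have hxJ : x ∈ Ioo J.u J.v := ⟨by linarith [hx.1], by linarith [hx.2]⟩
    have hgain := W.gain_nonneg (x := x) (Y.inUnit _ g huse.mem)
      ⟨by linarith [hxJ.1], by linarith [hxJ.2]⟩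
    have e1 := huse.am_next (W := W) hg hx
    have e2 := huse.am_next (W := W) hgJ hxJ
    have e3 := huse.th_next (W := W) hg hx
    have e4 := huse.th_next (W := W) hgJ hxJ
    refine ⟨ih.run.tail ⟨x, hxJ, g, huse, hgJ, rfl⟩, huse.closed_next hgJ hxJ ih.closed,
      by linarith [ih.am], by linarith [ih.th], by linarith [ih.diff], ?_, ?_⟩
    · intro g' hg' hn
      exact ih.mem g' (huse.mem_of_mem_next hg hx hg' hn) hn
    · intro p q hpq
      refine (ih.mass p q hpq).trans (huse.mass_le_next hgJ hxJ ?_)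
      rintro ⟨i1, i2⟩
      have := hg.2.1; have := hg.2.2; have := g.lo_le_hi
      rcases hpq with h | h <;> linarith

/-- The adversary can force one of the following outcomes with items in the core of `J`: the process
ends, the potential exceeds its bound, or an item is put into an external gap, at a gain that
makes up for all losses unless the gap straddles the hull. -/
def Out (Y : GapSystem) (W : Weights) (k : ℕ) (J : Region) (A₀ : ℝ) (s : Y.State) : Prop :=
  ∃ s', Y.IRun J s s' ∧ A₀ - J.len / 8 ≤ Y.Am W J s' ∧
    (¬ Y.Alive s' ∨ k / 64 * J.len < Y.Th W J s' ∨
      ∃ x ∈ Ioo J.u J.v, ∃ g, Y.Uses s' x g ∧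
        (J.Covered g ∨ ¬ J.Meets g ∧ A₀ ≤ Y.Am W J s' + W.gain g x - W.w))

lemma Out.of_run {k : ℕ} {J : Region} {A₀ : ℝ} {s s' : Y.State} (hr : Y.IRun J s s')
    (h : Y.Out W k J A₀ s') : Y.Out W k J A₀ s := by
  obtain ⟨s₂, h1, h2⟩ := h
  exact ⟨s₂, hr.trans h1, h2⟩

lemma le_gain_of_not_meets {J : Region} {g : Gap} {x d : ℝ} (hg : g.InUnit)
    (hx : x ∈ Ioo (0 : ℝ) 1) (hm : ¬ J.Meets g) (h0 : 0 ≤ d) (h1 : J.u + d ≤ x) (h2 : x + d ≤ J.v) :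
    d ≤ W.gain g x := by
  unfold Region.Meets at hm
  rw [not_and_or, not_lt, not_lt] at hm
  rcases hm with hm | hm
  · have := W.lo_sub_le_gain hg hx (by linarith); linarith
  · have := W.sub_hi_le_gain hg hx (by linarith); linarith

/-- Potential zero means that internal gaps have no free cell. The midpoint of `J` thus goes into a
gap that covers `J` or misses its core; in the latter case it gains half the length, which pays for
`w`. -/
lemma out_zero {J : Region} (h0 : 0 ≤ J.u) (h1 : J.v ≤ 1) {s : Y.State}
    (hJ : J.Closed (Y.gaps s)) (hth : Y.Th W J s ≤ (0 : ℕ) / 64 * J.len)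
    (hlen : W.scale 0 ≤ J.len) : Y.Out W 0 J (Y.Am W J s) s := by
  have hl := J.len_pos
  refine ⟨s, .refl, by linarith, ?_⟩
  by_cases hs : Y.Alive s
  swap
  · exact Or.inl hs
  right; right
  have hlen' : J.len = J.v - J.u := rfl
  set x := J.u + J.len / 2 with hx
  have hx01 : x ∈ Ioo (0 : ℝ) 1 := ⟨by linarith, by linarith⟩
  obtain ⟨g, hg⟩ := Y.exists_uses hs hx01
  refine ⟨x, ⟨by linarith, by linarith⟩, g, hg, ?_⟩
  by_cases hm : J.Meets g
  · left
    refine (hJ g hg.mem hm).resolve_left fun hin => ?_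
    have hU := Y.inUnit s
    have := Region.le_intSum (J := J) (φ := W.pot) hg.mem ⟨hm, hin⟩
      fun g hg _ => W.pot_nonneg (hU g hg)
    have h2 := W.cst_nonneg g.len_nonneg (hU g hg.mem).len_le_one
    obtain ⟨S, i, j, hm', -⟩ := hg
    have hpot : W.pot g = W.w * g.m + W.cst g.len := rfl
    have hw := W.w_pos
    have h3 : W.w ≤ W.w * (g.m : ℝ) :=
      le_mul_of_one_le_right hw.le (by rw [hm']; exact_mod_cast Nat.le_add_left 1 (i + j))
    unfold Th at hth
    rw [Nat.cast_zero, zero_div, zero_mul] at hth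
    linarith
  · refine Or.inr ⟨hm, ?_⟩
    have := le_gain_of_not_meets (W := W) (d := J.len / 2) (Y.inUnit s g hg.mem) hx01 hm
      (by linarith) (by linarith) (by linarith)
    have := W.w_le_scale 0
    have := W.w_pos
    linarith

/-- The interval is enlarged until it reaches the value range, a distance covered by the gain. Then
no interval beside it contains the range, as `Uses.mass_le_next` requires. -/
lemma exists_growth {g : Gap} {x e₀ e₁ : ℝ} (hg : g.InUnit) (hx : x ∈ Ioo (0 : ℝ) 1)
    (h0 : e₀ ≤ x) (h1 : x < e₁) : ∃ e₀' e₁', e₀' ≤ e₀ ∧ e₁ ≤ e₁' ∧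
      (e₀ - e₀') + (e₁' - e₁) ≤ W.gain g x ∧ e₀' ≤ g.hi ∧ g.lo < e₁' := by
  have hlh := g.lo_le_hi
  rcases lt_or_ge x g.lo with h | h
  · have := W.lo_sub_le_gain hg hx h.le
    -- The summand `e₁ - x` makes the last inequality strict, at a total growth of `g.lo - x`.
    exact ⟨e₀, g.lo + (e₁ - x), le_rfl, by linarith, by linarith, by linarith, by linarith⟩
  rcases lt_or_ge g.hi x with h' | h'
  · have := W.sub_hi_le_gain hg hx h'.le
    have h0' := W.gain_nonneg hg hx
    refine ⟨min e₀ g.hi, e₁, min_le_left _ _, le_rfl, ?_, min_le_right _ _, by linarith⟩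
    rcases le_total e₀ g.hi with h2 | h2
    · rw [min_eq_left h2]; linarith
    · rw [min_eq_right h2]; linarith
  · have h0' := W.gain_nonneg hg hx
    exact ⟨e₀, e₁, le_rfl, le_rfl, by linarith, by linarith, by linarith⟩

/-- Progress in `J` from `s` to `s'` with items in `[e₀, e₁)` and gain `r`. -/
structure Progress (Y : GapSystem) (W : Weights) (J : Region) (x₀ x₁ r : ℝ) (s s' : Y.State) :
    Prop where
  run : Y.IRun J s s'
  free : Y.free s' < Y.free s
  closed : J.Closed (Y.gaps s')
  nonneg : 0 ≤ r
  diff : Y.Am W J s - Y.Th W J s + r / 4 ≤ Y.Am W J s' - Y.Th W J s'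
  growth : ∀ e₀ e₁, e₀ ≤ x₀ → x₁ ≤ e₁ → ∃ e₀' e₁', e₀' ≤ e₀ ∧ e₁ ≤ e₁' ∧
    (e₀ - e₀') + (e₁' - e₁) ≤ r ∧ ∀ p q, q ≤ e₀' ∨ e₁' ≤ p →
      W.mass (Y.gaps s) J p q ≤ W.mass (Y.gaps s') J p q

lemma Uses.progress {s : Y.State} {x : ℝ} {g : Gap} (h : Y.Uses s x g) {J : Region}
    (h0 : 0 ≤ J.u) (h1 : J.v ≤ 1) (hg : J.Int g) (hx : x ∈ Ioo J.u J.v)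
    (hJ : J.Closed (Y.gaps s)) {x₀ x₁ : ℝ} (hx₀ : x₀ ≤ x) (hx₁ : x < x₁) :
    Y.Progress W J x₀ x₁ (W.gain g x) s (Y.next s x) := by
  have hx01 : x ∈ Ioo (0 : ℝ) 1 := ⟨by linarith [hx.1], by linarith [hx.2]⟩
  have hU := Y.inUnit s g h.mem
  have e1 := h.am_next (W := W) hg hx
  have e2 := h.th_next (W := W) hg hx
  refine ⟨.single ⟨x, hx, g, h, hg, rfl⟩, by have := h.free_lt; omega, h.closed_next hg hx hJ,
    W.gain_nonneg hU hx01, by linarith, fun e₀ e₁ he₀ he₁ => ?_⟩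
  obtain ⟨e₀', e₁', i1, i2, i3, i4, i5⟩ :=
    exists_growth (W := W) (e₀ := e₀) (e₁ := e₁) hU hx01 (by linarith) (by linarith)
  refine ⟨e₀', e₁', i1, i2, i3, fun p q hpq => h.mass_le_next hg hx ?_⟩
  rintro ⟨j1, j2⟩
  rcases hpq with hh | hh <;> linarith

lemma RunEffect.progress {c J : Region} {x₀ x₁ r : ℝ} {s s' s₂ : Y.State}
    (h : Y.RunEffect W c J s s') (hx₀ : x₀ ≤ c.u') (hx₁ : c.v' ≤ x₁)
    (hp : Y.Progress W J x₀ x₁ r s' s₂) : Y.Progress W J x₀ x₁ r s s₂ := by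
  refine ⟨h.run.trans hp.run, ?_, hp.closed, hp.nonneg, by linarith [hp.diff, h.diff], ?_⟩
  · have := hp.free
    rcases h.run.free_le with rfl | h'
    · exact this
    · omega
  · intro e₀ e₁ he₀ he₁
    obtain ⟨e₀', e₁', i1, i2, i3, i4⟩ := hp.growth e₀ e₁ he₀ he₁
    refine ⟨e₀', e₁', i1, i2, i3, fun p q hpq => (h.mass p q ?_).trans (i4 p q hpq)⟩
    rcases hpq with hh | hh
    · left; linarith
    · right; linarith

/-- Each outcome for `c` settles `J` or is progress in `J`. If the potential of `c` exceeds its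
bound, `Th` has increased, and `Am` with it. If a gap internal to `J` but external to `c` is used,
the gain makes up for the loss and for `w`: a gap that covers `c` reaches far and gains `c.len`. As
`Am` counts gains with factor `5 / 4`, a quarter of the gain remains. -/
lemma visit {J c : Region} {s : Y.State} {k' : ℕ} (h0 : 0 ≤ J.u) (h1 : J.v ≤ 1)
    (hJ : J.Closed (Y.gaps s)) (hu : J.u ≤ c.u') (hv : c.v' ≤ J.v)
    (hth : Y.Th W c s ≤ k' / 64 * c.len) (hw : 64 * W.w ≤ c.len)
    (hfar : ∀ g ∈ Y.gaps s, J.Int g → c.Covered g →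
      g.lo ≤ c.u - W.R * c.len ∧ c.v + W.R * c.len ≤ g.hi)
    (hout : Y.Out W k' c (Y.Am W c s) s) :
    (∃ s', Y.IRun J s s' ∧ Y.Am W J s - c.len / 8 ≤ Y.Am W J s' ∧
      (¬ Y.Alive s' ∨ ∃ x ∈ Ioo c.u c.v, ∃ g, Y.Uses s' x g ∧
        (J.Covered g ∨ ¬ J.Meets g ∧ Y.Am W J s ≤ Y.Am W J s' + W.gain g x - W.w))) ∨
    ∃ s' r, Y.Progress W J c.u' c.v' r s s' ∧ Y.Am W J s + r / 4 ≤ Y.Am W J s' := by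
  have hcl := c.len_pos
  have hcu := c.hu; have hcv := c.hv; have := J.hu; have := J.hv
  obtain ⟨s', hrun, hA, hcase⟩ := hout
  have he := hrun.effect (W := W) hu hv h0 h1 hJ
  have hAJ : Y.Am W J s - c.len / 8 ≤ Y.Am W J s' := by linarith [he.am]
  rcases hcase with hdead | hover | ⟨x, hx, g, huse, hg⟩
  · exact Or.inl ⟨s', he.run, hAJ, Or.inl hdead⟩
  · right
    -- The bound on the potential holds at `s` and fails at `s'`, so the run is nonempty and has
    -- used free cells.
    have hne : s' ≠ s := by rintro rfl; linarith
    refine ⟨s', 0, ⟨he.run, hrun.free_le.resolve_left hne, he.closed, le_rfl,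
      by linarith [he.diff], fun e₀ e₁ he₀ he₁ => ⟨e₀, e₁, le_rfl, le_rfl, by linarith,
        fun p q hpq => he.mass p q ?_⟩⟩, ?_⟩
    · rcases hpq with h | h
      · left; linarith
      · right; linarith
    · linarith [he.diff, he.th]
  have hxJ : x ∈ Ioo J.u J.v := ⟨by linarith [hx.1], by linarith [hx.2]⟩
  have hx01 : x ∈ Ioo (0 : ℝ) 1 := ⟨by linarith [hxJ.1], by linarith [hxJ.2]⟩
  have hU := Y.inUnit s' g huse.mem
  have hw0 := W.w_pos
  by_cases hm : J.Meets g
  · rcases he.closed g huse.mem hm with hin | hcov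
    · right
      have hgJ : J.Int g := ⟨hm, hin⟩
      have hA2 := huse.am_next (W := W) hgJ hxJ
      refine ⟨Y.next s' x, W.gain g x, he.progress le_rfl le_rfl
        (huse.progress h0 h1 hgJ hxJ he.closed (by linarith [hx.1]) (by linarith [hx.2])), ?_⟩
      rcases hg with hcovc | ⟨-, hge⟩
      · have hmem : g ∈ Y.gaps s := he.mem g huse.mem fun hi => by
          have := hi.2.1; have := hcovc.1; linarith
        obtain ⟨f1, f2⟩ := hfar g hmem hgJ hcovc
        have := W.le_gain_of_far (x := x) hU hcl.le (by linarith [hx.1]) (by linarith [hx.2])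
        linarith
      · linarith [he.am]
    · exact Or.inl ⟨s', he.run, hAJ, Or.inr ⟨x, hx, g, huse, Or.inl hcov⟩⟩
  · left
    refine ⟨s', he.run, hAJ, Or.inr ⟨x, hx, g, huse, Or.inr ⟨hm, ?_⟩⟩⟩
    rcases hg with hcovc | ⟨-, hge⟩
    · exfalso
      apply hm
      have a1 := hcovc.1; have a2 := hcovc.2; have a3 := c.huv
      exact ⟨by linarith, by linarith⟩
    · linarith [he.am]

end GapSystem

/-! ### The middle phase and the induction on the level. -/

namespace GapSystem

variable {Y : GapSystem} {W : Weights}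

/-- The state of the adversary while it works in the interval `[e₀, e₁)` in the middle of `J`, after
all lean cores have been used up. `A₁` and `D₁` refer to the start of this phase. -/
structure MiddlePhase (Y : GapSystem) (W : Weights) (k₁ : ℕ) (J : Region) (A₁ D₁ e₀ e₁ : ℝ)
    (s : Y.State) : Prop where
  closed : J.Closed (Y.gaps s)
  th : Y.Th W J s ≤ (k₁ + 1 : ℕ) / 64 * J.len
  start : A₁ - D₁ ≤ (k₁ + 1 : ℕ) / 64 * J.len
  left_le : J.u + J.len / 4 ≤ e₀
  le_left : e₀ ≤ J.u + J.len * (15 / 32)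
  right_le : J.u + J.len * (17 / 32) ≤ e₁
  le_right : e₁ ≤ J.u + J.len * (3 / 4)
  left : ∀ y, J.u + J.len / 16 ≤ y → y ≤ e₀ →
    (k₁ - 1 : ℝ) / 64 * (y - J.u) ≤ W.mass (Y.gaps s) J J.u y
  right : ∀ y, e₁ ≤ y → y ≤ J.v - J.len / 16 →
    (k₁ - 1 : ℝ) / 64 * (J.v - y) ≤ W.mass (Y.gaps s) J y J.v
  am : A₁ - 3 / 64 * J.len + (e₁ - e₀ - J.len / 16) / 4 ≤ Y.Am W J s
  diff : D₁ + (e₁ - e₀ - J.len / 16) / 4 ≤ Y.Am W J s - Y.Th W J s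

/-- `J` can be treated from every state with fewer free cells. -/
def SmallerOut (Y : GapSystem) (W : Weights) (k₁ : ℕ) (J : Region) (A₀ : ℝ) (s : Y.State) :
    Prop :=
  ∀ s', Y.free s' < Y.free s →
    (J.Closed (Y.gaps s') → Y.Th W J s' ≤ (k₁ + 1 : ℕ) / 64 * J.len → A₀ ≤ Y.Am W J s' →
      Y.Out W (k₁ + 1) J A₀ s') ∧
    ∀ A₁ D₁ e₀ e₁, A₀ ≤ A₁ → Y.MiddlePhase W k₁ J A₁ D₁ e₀ e₁ s' → Y.Out W (k₁ + 1) J A₀ s'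

/-- If the enlarged interval leaves the middle half of `J`, it has grown by at least `7 / 32` of the
length. A quarter of this, `7 / 128`, exceeds the debt `3 / 64`, so `Am` has recovered and `J` can
be treated afresh. -/
lemma MiddlePhase.out_of_progress {k₁ : ℕ} {J : Region} {A₀ A₁ D₁ e₀ e₁ x₀ x₁ r : ℝ}
    {s s' : Y.State} (h : Y.MiddlePhase W k₁ J A₁ D₁ e₀ e₁ s) (hA : A₀ ≤ A₁)
    (ih : Y.SmallerOut W k₁ J A₀ s) (hx₀ : e₀ ≤ x₀) (hx₁ : x₁ ≤ e₁)
    (hp : Y.Progress W J x₀ x₁ r s s')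
    (hAm : A₁ - 3 / 64 * J.len + (e₁ - e₀ - J.len / 16 + r) / 4 ≤ Y.Am W J s') :
    Y.Out W (k₁ + 1) J A₀ s := by
  have hl := J.len_pos
  have hlen : J.len = J.v - J.u := rfl
  obtain ⟨e₀', e₁', i1, i2, i3, i4⟩ := hp.growth e₀ e₁ hx₀ hx₁
  have := h.le_left; have := h.right_le; have := hp.nonneg
  have hAm' : A₀ - J.len / 8 ≤ Y.Am W J s' := by linarith
  by_cases hth : Y.Th W J s' ≤ (k₁ + 1 : ℕ) / 64 * J.len
  swap
  · exact ⟨s', hp.run, hAm', Or.inr (Or.inl (not_le.1 hth))⟩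
  refine Out.of_run hp.run ?_
  by_cases hmid : J.u + J.len / 4 ≤ e₀' ∧ e₁' ≤ J.u + J.len * (3 / 4)
  · refine (ih s' hp.free).2 A₁ D₁ e₀' e₁' hA ⟨hp.closed, hth, h.start, hmid.1, by linarith,
      by linarith, hmid.2, ?_, ?_, by linarith, by linarith [h.diff, hp.diff]⟩
    · intro y hy1 hy2
      exact (h.left y hy1 (by linarith)).trans (i4 _ _ (Or.inl hy2))
    · intro y hy1 hy2
      exact (h.right y (by linarith) hy2).trans (i4 _ _ (Or.inr hy1))
  · refine (ih s' hp.free).1 hp.closed hth ?_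
    rw [not_and_or, not_le, not_le] at hmid
    rcases hmid with hm | hm <;> linarith

/-- The statement that is proved by induction on the level `k`. -/
def LevelOut (Y : GapSystem) (W : Weights) (k : ℕ) : Prop :=
  ∀ (J : Region) (s : Y.State), 0 ≤ J.u → J.v ≤ 1 → J.Closed (Y.gaps s) →
    Y.Th W J s ≤ k / 64 * J.len → W.scale k ≤ J.len → Y.Out W k J (Y.Am W J s) s

lemma visit_leanCore {k : ℕ} (hlev : ∀ k' < k, Y.LevelOut W k') {J : Region} {s : Y.State}
    (h0 : 0 ≤ J.u) (h1 : J.v ≤ 1) (hJ : J.Closed (Y.gaps s)) {x y : ℝ} (hx : J.u ≤ x)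
    (hy : y ≤ J.v) (hc : W.LeanCore (Y.gaps s) J k x y) :
    (∃ s', Y.IRun J s s' ∧ Y.Am W J s - J.len / 16 ≤ Y.Am W J s' ∧
      (¬ Y.Alive s' ∨ ∃ z ∈ Ioo x y, ∃ g, Y.Uses s' z g ∧
        (J.Covered g ∨ ¬ J.Meets g ∧ Y.Am W J s ≤ Y.Am W J s' + W.gain g z - W.w))) ∨
    ∃ s' r, Y.Progress W J x y r s s' ∧ Y.Am W J s + r / 4 ≤ Y.Am W J s' := by
  obtain ⟨c, k', hk', hxc, hyc, hcl, hth, hsc, hhalf, hfar⟩ := hc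
  have := c.hu; have := c.hv
  rcases visit h0 h1 hJ (hx.trans hxc) (hyc.trans hy) hth ((W.w_le_scale k').trans hsc) hfar
    (hlev k' hk' c s (by linarith) (by linarith) hcl hth hsc) with
    ⟨s', hr, hA, hh⟩ | ⟨s', r, hp, hA⟩
  · refine Or.inl ⟨s', hr, by linarith, hh.imp_right ?_⟩
    rintro ⟨z, hz, hg⟩
    exact ⟨z, ⟨by linarith [hz.1], by linarith [hz.2]⟩, hg⟩
  · exact Or.inr ⟨s', r, ⟨hp.run, hp.free, hp.closed, hp.nonneg, hp.diff,
      fun e₀ e₁ he₀ he₁ => hp.growth e₀ e₁ (by linarith) (by linarith)⟩, hA⟩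

lemma MiddlePhase.out {k₁ : ℕ} (hk : k₁ ≤ W.K) (hlev : ∀ k' < k₁ + 1, Y.LevelOut W k')
    {J : Region} {A₀ A₁ D₁ e₀ e₁ : ℝ} {s : Y.State} (h0 : 0 ≤ J.u) (h1 : J.v ≤ 1)
    (hlenJ : W.scale (k₁ + 1) ≤ J.len) (h : Y.MiddlePhase W k₁ J A₁ D₁ e₀ e₁ s) (hA : A₀ ≤ A₁)
    (ih : Y.SmallerOut W k₁ J A₀ s) : Y.Out W (k₁ + 1) J A₀ s := by
  have hl := J.len_pos
  have hlen : J.len = J.v - J.u := rfl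
  have := h.left_le; have := h.le_left; have := h.right_le; have := h.le_right
  have := h.am; have := h.diff; have := h.start
  have hw := W.w_pos
  have hw' := (W.w_le_scale (k₁ + 1)).trans hlenJ
  have hU := Y.inUnit s
  by_cases hs : Y.Alive s
  swap
  · exact ⟨s, .refl, by linarith, Or.inl hs⟩
  -- While this holds, an item may be wasted: `Am` is `Th` plus a nondecreasing difference, and `Th`
  -- is at most `2 / 64` of the length below its bound. One further step costs `w`, at most `1 / 64`
  -- of the length; this explains the debt `3 / 64`.
  by_cases hburn : (k₁ - 1 : ℝ) / 64 * J.len ≤ Y.Th W J s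
  · set x := J.u + J.len / 2 with hx
    have hxJ : x ∈ Ioo J.u J.v := ⟨by linarith, by linarith⟩
    have hx01 : x ∈ Ioo (0 : ℝ) 1 := ⟨by linarith, by linarith⟩
    obtain ⟨g, hg⟩ := Y.exists_uses hs hx01
    by_cases hm : J.Meets g
    · rcases h.closed g hg.mem hm with hin | hcov
      · have hgJ : J.Int g := ⟨hm, hin⟩
        refine h.out_of_progress (x₀ := e₀) (x₁ := e₁) hA ih le_rfl le_rfl
          (hg.progress h0 h1 hgJ hxJ h.closed (by linarith) (by linarith)) ?_
        have e1 := hg.am_next (W := W) hgJ hxJ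
        have e2 := W.gain_nonneg (x := x) (hU g hg.mem) hx01
        have e3 := h.start
        push_cast at e3
        linarith
      · exact ⟨s, .refl, by linarith, Or.inr (Or.inr ⟨x, hxJ, g, hg, Or.inl hcov⟩)⟩
    · have := le_gain_of_not_meets (W := W) (d := J.len / 4) (hU g hg.mem) hx01 hm
        (by linarith) (by linarith) (by linarith)
      exact ⟨s, .refl, by linarith, Or.inr (Or.inr ⟨x, hxJ, g, hg, Or.inr ⟨hm, by linarith⟩⟩)⟩
  -- Both sides have kept their mass. If the middle were heavy too, superadditivity would contradict
  -- the drop of the potential.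
  · have hlean : W.LeanCore (Y.gaps s) J (k₁ + 1) e₀ e₁ := by
      by_contra hno
      have hz : W.zones * W.scale k₁ ≤ e₁ - e₀ := by
        have := W.scale_succ k₁; linarith
      have m0 := Weights.mass_ge_of_not_leanCore hU h.closed hk hno (by linarith) (by linarith) hz
      have m1 := h.left e₀ (by linarith) le_rfl
      have m2 := h.right e₁ le_rfl (by linarith)
      have m3 := W.mass_add_mass_le hU J (x := J.u) (y := e₀) (z := e₁) (by linarith) (by linarith)
      have m4 := W.mass_add_mass_le hU J (x := J.u) (y := e₁) (z := J.v) (by linarith) (by linarith)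
      have m5 := W.mass_le_pot hU J J.u J.v
      unfold Th at hburn
      apply hburn
      have : (k₁ - 1 : ℝ) / 64 * J.len = (k₁ - 1 : ℝ) / 64 * (e₀ - J.u) +
        (k₁ - 1 : ℝ) / 64 * (e₁ - e₀) + (k₁ - 1 : ℝ) / 64 * (J.v - e₁) := by rw [hlen]; ring
      linarith
    rcases visit_leanCore hlev h0 h1 h.closed (by linarith) (by linarith) hlean with
      ⟨s', hr, hAm, hh⟩ | ⟨s', r, hp, hAm⟩
    · refine ⟨s', hr, by linarith, ?_⟩
      rcases hh with hh | ⟨z, hz, g, hg, hgc⟩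
      · exact Or.inl hh
      · refine Or.inr (Or.inr ⟨z, ⟨by linarith [hz.1], by linarith [hz.2]⟩, g, hg, ?_⟩)
        refine hgc.imp_right fun hm => ⟨hm.1, ?_⟩
        have := le_gain_of_not_meets (W := W) (x := z) (d := J.len / 4) (Y.inUnit s' g hg.mem)
          ⟨by linarith [hz.1], by linarith [hz.2]⟩ hm.1
          (by linarith) (by linarith [hz.1]) (by linarith [hz.2])
        linarith
    · exact h.out_of_progress (x₀ := e₀) (x₁ := e₁) hA ih le_rfl le_rfl hp (by linarith)

/-- As long as lean cores exist anywhere in `J`, they are visited. When there is none, all intervals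
of length at least `J.len / 16` are heavy, and the middle phase starts in the central sixteenth. -/
lemma out_of_smallerOut {k₁ : ℕ} (hk : k₁ ≤ W.K) (hlev : ∀ k' < k₁ + 1, Y.LevelOut W k')
    {J : Region} {A₀ : ℝ} {s : Y.State} (h0 : 0 ≤ J.u) (h1 : J.v ≤ 1)
    (hlenJ : W.scale (k₁ + 1) ≤ J.len) (hJ : J.Closed (Y.gaps s))
    (hth : Y.Th W J s ≤ (k₁ + 1 : ℕ) / 64 * J.len) (hA : A₀ ≤ Y.Am W J s)
    (ih : Y.SmallerOut W k₁ J A₀ s) : Y.Out W (k₁ + 1) J A₀ s := by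
  have hl := J.len_pos
  have hlen : J.len = J.v - J.u := rfl
  by_cases hlean : W.LeanCore (Y.gaps s) J (k₁ + 1) J.u J.v
  · rcases visit_leanCore hlev h0 h1 hJ le_rfl le_rfl hlean with
      ⟨s', hr, hAm, hh⟩ | ⟨s', r, hp, hAm⟩
    · refine ⟨s', hr, by linarith, ?_⟩
      rcases hh with hh | ⟨z, hz, g, hg, hgc⟩
      · exact Or.inl hh
      · exact Or.inr (Or.inr ⟨z, hz, g, hg, hgc.imp_right fun hm => ⟨hm.1, by linarith [hm.2]⟩⟩)
    · have := hp.nonneg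
      by_cases hth' : Y.Th W J s' ≤ (k₁ + 1 : ℕ) / 64 * J.len
      · exact Out.of_run hp.run ((ih s' hp.free).1 hp.closed hth' (by linarith))
      · exact ⟨s', hp.run, by linarith, Or.inr (Or.inl (not_le.1 hth'))⟩
  · have hz : W.zones * W.scale k₁ ≤ J.len / 16 := by
      have := W.scale_succ k₁; linarith
    have hU := Y.inUnit s
    have hmass : ∀ x y, J.u ≤ x → y ≤ J.v → J.len / 16 ≤ y - x →
        (k₁ - 1 : ℝ) / 64 * (y - x) ≤ W.mass (Y.gaps s) J x y := fun x y hx hy hxy =>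
      Weights.mass_ge_of_not_leanCore hU hJ hk (fun h => hlean (h.mono hx hy)) hx hy
        (by linarith)
    refine MiddlePhase.out (A₁ := Y.Am W J s) (D₁ := Y.Am W J s - Y.Th W J s)
      (e₀ := J.u + J.len * (15 / 32)) (e₁ := J.u + J.len * (17 / 32)) hk hlev h0 h1 hlenJ
      ⟨hJ, hth, by linarith, by linarith, by linarith, by linarith, by linarith, ?_, ?_,
        by linarith, by linarith⟩ hA ih
    · intro y hy1 hy2
      exact hmass _ _ le_rfl (by linarith) (by linarith)
    · intro y hy1 hy2
      exact hmass _ _ (by linarith) le_rfl (by linarith)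

/-- Induction on the level and, within a level, on the number of free cells, which every progress
reduces. -/
lemma levelOut (k : ℕ) (hk : k ≤ W.K) : Y.LevelOut W k := by
  induction k using Nat.strong_induction_on with
  | _ k ihk =>
    rcases k with _ | k₁
    · intro J s h0 h1 hJ hth hlen
      exact out_zero h0 h1 hJ hth hlen
    · have hlev : ∀ k' < k₁ + 1, Y.LevelOut W k' := fun k' h => ihk k' h (by omega)
      intro J s₀ h0 h1 hJ₀ hth₀ hlen
      have key : ∀ n : ℕ, ∀ s, Y.free s < n →
          (J.Closed (Y.gaps s) → Y.Th W J s ≤ (k₁ + 1 : ℕ) / 64 * J.len →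
            Y.Am W J s₀ ≤ Y.Am W J s → Y.Out W (k₁ + 1) J (Y.Am W J s₀) s) ∧
          ∀ A₁ D₁ e₀ e₁, Y.Am W J s₀ ≤ A₁ → Y.MiddlePhase W k₁ J A₁ D₁ e₀ e₁ s →
            Y.Out W (k₁ + 1) J (Y.Am W J s₀) s := by
        intro n
        induction n with
        | zero => intro s hs; omega
        | succ n ihn =>
          intro s hs
          have ih : Y.SmallerOut W k₁ J (Y.Am W J s₀) s := fun s' hs' => ihn s' (by omega)
          exact ⟨fun hJ hth hA => out_of_smallerOut (by omega) hlev h0 h1 hlen hJ hth hA ih,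
            fun A₁ D₁ e₀ e₁ hA h => h.out (by omega) hlev h0 h1 hlen hA ih⟩
      exact (key _ s₀ (Nat.lt_succ_self _)).1 hJ₀ hth₀ le_rfl

end GapSystem

/-! ### Entropy weights and the forced variation. -/

/-- The derivative `-log t - 1` is at least `-1` on `(0, 1]`. After division by `log Q ≥ 1`, the
linear term of `cst` compensates for the decrease. -/
lemma negMulLog_mono_aux {r s : ℝ} (hr : 0 ≤ r) (hrs : r ≤ s) (hs : s ≤ 1) :
    Real.negMulLog r - Real.negMulLog s ≤ s - r := by
  rcases hr.eq_or_lt with rfl | hr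
  · have := Real.negMulLog_nonneg hrs hs
    simp only [Real.negMulLog_zero]; linarith
  · have hs0 : 0 < s := by linarith
    have h1 : Real.log (s / r) ≤ s / r - 1 := Real.log_le_sub_one_of_pos (by positivity)
    rw [Real.log_div hs0.ne' hr.ne'] at h1
    have h2 : r * (Real.log s - Real.log r) ≤ s - r := by
      have := mul_le_mul_of_nonneg_left h1 hr.le
      have e : r * (s / r - 1) = s - r := by field_simp
      linarith
    have h3 : Real.log s ≤ 0 := Real.log_nonpos hs0.le hs
    unfold Real.negMulLog
    nlinarith

/-- The smaller part is at most half of the sum, so its logarithm is smaller by at least `log 2`.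
This provides `split` as soon as `R * log 2 ≥ log Q`. -/
lemma negMulLog_split {r s : ℝ} (hr : 0 ≤ r) (hs : 0 ≤ s) :
    Real.log 2 * min r s ≤ Real.negMulLog r + Real.negMulLog s - Real.negMulLog (r + s) := by
  wlog h : r ≤ s generalizing r s
  · have := this hs hr (le_of_not_ge h)
    rw [min_comm, add_comm r s]; linarith
  rw [min_eq_left h]
  rcases hr.eq_or_lt with rfl | hr
  · simp
  have hs0 : 0 < s := by linarith
  have h1 : Real.log 2 + Real.log r ≤ Real.log (r + s) := by
    rw [← Real.log_mul two_ne_zero hr.ne']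
    exact Real.log_le_log (by positivity) (by linarith)
  have h2 : Real.log s ≤ Real.log (r + s) := Real.log_le_log hs0 (by linarith)
  unfold Real.negMulLog
  nlinarith

/-- This is `log t ≤ t - 1` at `t = 1 / (r * Q)`. Summed over at most `Q` gaps, the last term stays
below 1, so the entropy hardly distorts the variation. -/
lemma negMulLog_le {r Q : ℝ} (hr : 0 ≤ r) (hQ : 0 < Q) :
    Real.negMulLog r ≤ r * Real.log Q + 1 / Q := by
  rcases hr.eq_or_lt with rfl | hr
  · simp [hQ.le]
  have h1 : Real.log (1 / (r * Q)) ≤ 1 / (r * Q) - 1 := Real.log_le_sub_one_of_pos (by positivity)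
  rw [Real.log_div one_ne_zero (by positivity), Real.log_one, Real.log_mul hr.ne' hQ.ne'] at h1
  have h2 := mul_le_mul_of_nonneg_left h1 hr.le
  have e : r * (1 / (r * Q) - 1) = 1 / Q - r := by field_simp
  unfold Real.negMulLog
  linarith

/-- The weights in which a value range of length `r` has the value `r - r log r / log Q`. -/
noncomputable def entropyWeights (Q : ℕ) (R K : ℕ) (w : ℝ) (hQ : 3 ≤ Q) (hw : 0 < w) (hR : 1 ≤ R)
    (hRQ : Real.log Q ≤ R * Real.log 2) : Weights where
  cst r := r + Real.negMulLog r / Real.log Q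
  w := w
  R := R
  K := K
  w_pos := hw
  R_pos := hR
  self_le r h0 h1 := by
    have : 0 ≤ Real.negMulLog r / Real.log Q :=
      div_nonneg (Real.negMulLog_nonneg h0 h1) (Real.log_natCast_nonneg Q)
    linarith
  mono r s h0 h1 h2 := by
    have hlog : 1 ≤ Real.log Q := by
      rw [Real.le_log_iff_exp_le (by positivity)]
      have : (3 : ℝ) ≤ Q := by exact_mod_cast hQ
      linarith [Real.exp_one_lt_d9]
    have h3 := negMulLog_mono_aux h0 h1 h2
    have : (Real.negMulLog r - Real.negMulLog s) / Real.log Q ≤ s - r := by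
      rw [div_le_iff₀ (by linarith)]
      nlinarith
    rw [sub_div] at this
    linarith
  split r s d hd hr hs _ := by
    have hlog : 1 ≤ Real.log Q := by
      rw [Real.le_log_iff_exp_le (by positivity)]
      have : (3 : ℝ) ≤ Q := by exact_mod_cast hQ
      linarith [Real.exp_one_lt_d9]
    have hRd : 0 ≤ R * d := by positivity
    have h1 := negMulLog_split (hRd.trans hr) (hRd.trans hs)
    have h2 : R * d ≤ min r s := le_min hr hs
    have h3 : 0 < Real.log 2 := Real.log_pos (by norm_num)
    have h4 : d ≤ (Real.negMulLog r + Real.negMulLog s - Real.negMulLog (r + s)) / Real.log Q := by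
      rw [le_div_iff₀ (by linarith)]
      calc d * Real.log Q ≤ d * (R * Real.log 2) := by gcongr
        _ = Real.log 2 * (R * d) := by ring
        _ ≤ Real.log 2 * min r s := by gcongr
        _ ≤ _ := h1
    rw [sub_div, add_div] at h4
    linarith

namespace GapSystem

variable {Y : GapSystem}

/-- The total length of the value ranges. -/
noncomputable def variation (Y : GapSystem) (s : Y.State) : ℝ := ((Y.gaps s).map Gap.len).sum

lemma sum_cst_le (W : Weights) {Q : ℕ} (hQ : 3 ≤ Q)
    (hW : ∀ r, W.cst r = r + Real.negMulLog r / Real.log Q) (s : Y.State)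
    (hcard : Multiset.card (Y.gaps s) ≤ Q) :
    ((Y.gaps s).map fun g => W.cst g.len).sum ≤ 2 * Y.variation s + 1 := by
  have hlog : 1 ≤ Real.log Q := by
    rw [Real.le_log_iff_exp_le (by positivity)]
    have : (3 : ℝ) ≤ Q := by exact_mod_cast hQ
    linarith [Real.exp_one_lt_d9]
  have hQ0 : (0 : ℝ) < Q := by positivity
  have h : ∀ g : Gap, W.cst g.len ≤ 2 * g.len + 1 / Q := by
    intro g
    have h1 := negMulLog_le g.len_nonneg hQ0
    have h2 : Real.negMulLog g.len / Real.log Q ≤ g.len + 1 / Q := by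
      rw [div_le_iff₀ (by linarith)]
      have : (0 : ℝ) ≤ 1 / Q := by positivity
      nlinarith [g.len_nonneg]
    rw [hW]; linarith
  calc ((Y.gaps s).map fun g => W.cst g.len).sum
      ≤ ((Y.gaps s).map fun g => 2 * g.len + 1 / (Q : ℝ)).sum :=
        Multiset.sum_map_le_sum_map _ _ fun g _ => h g
    _ = 2 * Y.variation s + Multiset.card (Y.gaps s) * (1 / Q : ℝ) := by
        rw [Multiset.sum_map_add, Multiset.sum_map_mul_left]
        simp [variation]
    _ ≤ _ := by
        have : (Multiset.card (Y.gaps s) : ℝ) * (1 / Q : ℝ) ≤ 1 := by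
          rw [mul_one_div, div_le_one hQ0]; exact_mod_cast hcard
        linarith

/-- In a system with sufficiently many items, the adversary forces a large variation. -/
theorem exists_variation_ge (s₀ : Y.State) (h0 : ∀ g ∈ Y.gaps s₀, g.len = 0)
    {N Q R K : ℕ} {V : ℝ} (hV : 0 ≤ V) (hN : 1 ≤ N) (hQ : 3 ≤ Q) (hR : 1 ≤ R)
    (hdead : ∀ s, ¬ Y.Alive s → Y.free s + N ≤ Y.free s₀)
    (hfree : ∀ s, Y.free s ≤ Y.free s₀) (hcard : ∀ s, Multiset.card (Y.gaps s) ≤ Q)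
    (hRQ : Real.log Q ≤ R * Real.log 2)
    (hK : 64 * ((4 * V + 3) / N * Y.free s₀ + 2 * V + 1) ≤ K)
    (hsize : 64 * (4 * V + 3) * (16 * (R * (K + 64) ^ 4) : ℝ) ^ K ≤ N) :
    ∃ s, V ≤ Y.variation s := by
  have hN0 : (0 : ℝ) < N := by positivity
  set w : ℝ := (4 * V + 3) / N with hw
  have hw0 : 0 < w := by positivity
  set W := entropyWeights Q R K w hQ hw0 hR hRQ with hW
  have hcst : ∀ r, W.cst r = r + Real.negMulLog r / Real.log Q := fun r => rfl
  have hWw : W.w = w := rfl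
  -- With a hull up to 2, every gap is internal and none straddles the hull, which excludes the
  -- outcome with an external gap.
  let J : Region := ⟨0, 0, 1, 2, le_rfl, one_pos, by norm_num⟩
  have hJlen : J.len = 1 := by show (1 : ℝ) - 0 = 1; norm_num
  have hmeet : ∀ s, ∀ g ∈ Y.gaps s, J.Int g := by
    intro s g hg
    obtain ⟨⟨a0, a1⟩, b0, b1⟩ := Y.inUnit s g hg
    refine ⟨⟨?_, ?_⟩, ?_, ?_⟩
    · exact min_lt_of_left_lt a1
    · exact lt_max_of_lt_left a0
    · exact le_min a0.le b0.le
    · exact max_lt (show g.a < 2 by linarith) (show g.b < 2 by linarith)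
  have hsum : ∀ s, ∀ φ : Gap → ℝ, J.intSum φ (Y.gaps s) = ((Y.gaps s).map φ).sum := by
    intro s φ
    unfold Region.intSum
    congr 1
    exact Multiset.map_congr rfl fun g hg => if_pos (hmeet s g hg)
  have hm : ∀ s, ((Y.gaps s).map fun g => W.w * (g.m : ℝ)).sum = w * Y.free s := by
    intro s
    rw [Multiset.sum_map_mul_left, hWw]
    unfold free
    rw [← Nat.coe_castAddMonoidHom (α := ℝ), AddMonoidHom.map_multiset_sum, Multiset.map_map]
    rfl
  set X : Y.State → ℝ := fun s => ((Y.gaps s).map fun g => W.cst g.len).sum with hX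
  have hth : ∀ s, Y.Th W J s = w * Y.free s + X s := by
    intro s
    unfold Th
    rw [hsum, ← hm s, hX, ← Multiset.sum_map_add]
    rfl
  have ham : ∀ s, Y.Am W J s = w * Y.free s + 5 / 4 * X s := by
    intro s
    unfold Am
    rw [hsum, ← hm s, hX]
    simp only
    rw [← Multiset.sum_map_mul_left, ← Multiset.sum_map_add]
    rfl
  have hX0 : X s₀ = 0 := by
    rw [hX]
    refine Multiset.sum_eq_zero fun r hr => ?_
    obtain ⟨g, hg, rfl⟩ := Multiset.mem_map.1 hr
    simp only [h0 g hg, hcst]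
    simp
  have hK' : w * Y.free s₀ + 2 * V + 1 ≤ K / 64 := by linarith
  have hlev := levelOut (Y := Y) (W := W) K le_rfl J s₀ le_rfl le_rfl
    (fun g hg _ => Or.inl (hmeet s₀ g hg).2)
    (by rw [hth, hX0, hJlen]; linarith)
    (by
      rw [hJlen]
      unfold Weights.scale Weights.zones Weights.groupSize
      show 64 * w * (16 * ((R * (K + 64) ^ 2 * (K + 64) ^ 2 : ℕ) : ℝ)) ^ K ≤ 1
      push_cast
      rw [hw, show (R * (K + 64) ^ 2 * (K + 64) ^ 2 : ℝ) = R * (K + 64) ^ 4 by ring,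
        mul_div_assoc', div_mul_eq_mul_div, div_le_one hN0]
      exact hsize)
  obtain ⟨s, -, hA, hcase⟩ := hlev
  refine ⟨s, ?_⟩
  have hfr : (Y.free s : ℝ) ≤ Y.free s₀ := by exact_mod_cast hfree s
  have hXle := sum_cst_le W hQ hcst s (hcard s)
  -- If the process ends, the lost weight `w * N = 4 * V + 3` reappears in `5 / 4 * X`, up to `1 /
  -- 8`; if the potential exceeds `K / 64`, then `X > 2 * V + 1`. Both suffice, as `X` is at most
  -- twice the variation plus 1.
  rcases hcase with hd | ho | ⟨x, -, g, hu, hg⟩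
  · have h1 : (Y.free s : ℝ) + N ≤ Y.free s₀ := by exact_mod_cast hdead s hd
    rw [ham, ham, hX0, hJlen] at hA
    have h2 : w * (Y.free s + N) ≤ w * Y.free s₀ := by gcongr
    have h3 : w * N = 4 * V + 3 := by rw [hw]; field_simp
    rw [mul_add] at h2
    linarith
  · rw [hth, hJlen] at ho
    have h2 : w * Y.free s ≤ w * Y.free s₀ := by gcongr
    linarith
  · have hi := hmeet s g hu.mem
    rcases hg with hg | hg
    · have := hg.2; have := hi.2.2
      linarith
    · exact absurd hi.1 hg.1

end GapSystem

/-! ### Linear arrangements of marks. -/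

/-- An element of a linear arrangement: its position, its value and a monotone coordinate that
controls the variation of the values. -/
structure Mark where
  pos : ℕ
  val : ℝ
  u : ℝ

namespace Mark

/-- `p` precedes `q`, and the coordinate dominates the variation of the values. -/
def Prec (η : ℝ) (p q : Mark) : Prop := p.pos < q.pos ∧ η * |p.val - q.val| ≤ q.u - p.u

/-- The gaps between consecutive elements. -/
def gaps : List Mark → List Gap
  | p :: q :: l => ⟨p.val, q.val, q.pos - p.pos - 1⟩ :: gaps (q :: l)
  | _ => []

open Classical in
/-- Insertion of an element according to its position. -/
noncomputable def insert (z : Mark) : List Mark → List Mark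
  | [] => [z]
  | p :: l => if z.pos < p.pos then z :: p :: l else p :: insert z l

lemma gaps_append (A : List Mark) (p : Mark) (B : List Mark) :
    gaps (A ++ p :: B) = gaps (A ++ [p]) ++ gaps (p :: B) := by
  induction A with
  | nil => simp [gaps]
  | cons a A ih =>
    cases A with
    | nil => simp [gaps]
    | cons b A => simpa [gaps] using ih

lemma mem_insert {z p : Mark} {l : List Mark} : p ∈ insert z l ↔ p = z ∨ p ∈ l := by
  induction l with
  | nil => simp [insert]
  | cons a l ih =>
    unfold insert
    split_ifs
    · simp
    · simp only [List.mem_cons, ih]; tauto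

lemma length_insert (z : Mark) (l : List Mark) : (insert z l).length = l.length + 1 := by
  induction l with
  | nil => simp [insert]
  | cons a l ih =>
    unfold insert
    split_ifs
    · simp
    · simp [ih]

lemma pairwise_insert {η : ℝ} {z : Mark} {l : List Mark} (hl : l.Pairwise (Prec η))
    (hz : ∀ p ∈ l, Prec η p z ∨ Prec η z p) : (insert z l).Pairwise (Prec η) := by
  induction l with
  | nil => simp [insert]
  | cons a l ih =>
    rw [List.pairwise_cons] at hl
    unfold insert
    split_ifs with h
    · refine List.pairwise_cons.2 ⟨fun p hp => ?_, List.pairwise_cons.2 hl⟩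
      refine (hz p hp).resolve_left fun hpz => ?_
      rcases List.mem_cons.1 hp with rfl | hp
      · exact absurd hpz.1 (by omega)
      · have := (hl.1 p hp).1; have := hpz.1; omega
    · refine List.pairwise_cons.2 ⟨fun p hp => ?_,
        ih hl.2 fun p hp => hz p (List.mem_cons_of_mem _ hp)⟩
      rcases mem_insert.1 hp with rfl | hp
      · exact (hz a List.mem_cons_self).resolve_right fun h' => h h'.1
      · exact hl.1 p hp

lemma exists_insert_eq {η : ℝ} {z : Mark} {l : List Mark} (hl : l.Pairwise (Prec η))
    (hz : ∀ p ∈ l, Prec η p z ∨ Prec η z p) (h1 : ∃ p ∈ l, p.pos < z.pos)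
    (h2 : ∃ p ∈ l, z.pos < p.pos) :
    ∃ A p q B, l = A ++ p :: q :: B ∧ insert z l = A ++ p :: z :: q :: B ∧
      p.pos < z.pos ∧ z.pos < q.pos := by
  induction l with
  | nil => simp at h1
  | cons a l ih =>
    have hl' := List.pairwise_cons.1 hl
    have ha : ¬ z.pos < a.pos := by
      intro h
      obtain ⟨p, hp, hpz⟩ := h1
      rcases List.mem_cons.1 hp with rfl | hp
      · omega
      · have := (hl'.1 p hp).1; omega
    have haz : a.pos < z.pos :=
      ((hz a List.mem_cons_self).resolve_right fun h => ha h.1).1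
    have h2' : ∃ p ∈ l, z.pos < p.pos := by
      obtain ⟨p, hp, hpz⟩ := h2
      rcases List.mem_cons.1 hp with rfl | hp
      · omega
      · exact ⟨p, hp, hpz⟩
    have hins : insert z (a :: l) = a :: insert z l := by
      rw [insert, if_neg ha]
    rcases l with _ | ⟨b, l⟩
    · simp at h2'
    by_cases hb : z.pos < b.pos
    · refine ⟨[], a, b, l, rfl, ?_, haz, hb⟩
      rw [hins, insert, if_pos hb]; rfl
    · have hbz : b.pos < z.pos :=
        ((hz b (by simp)).resolve_right fun h => hb h.1).1
      obtain ⟨A, p, q, B, e1, e2, e3⟩ := ih hl'.2 (fun p hp => hz p (List.mem_cons_of_mem _ hp))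
        ⟨b, List.mem_cons_self, hbz⟩ h2'
      refine ⟨a :: A, p, q, B, by rw [e1]; rfl, by rw [hins, e2]; rfl, e3⟩

lemma gaps_step (A : List Mark) (p z q : Mark) (B : List Mark) (h1 : p.pos < z.pos)
    (h2 : z.pos < q.pos) : ∃ (g : Gap) (S : Multiset Gap) (i j : ℕ),
      g.m = i + j + 1 ∧ (gaps (A ++ p :: q :: B) : Multiset Gap) = g ::ₘ S ∧
      (gaps (A ++ p :: z :: q :: B) : Multiset Gap) =
        ⟨g.a, z.val, i⟩ ::ₘ ⟨z.val, g.b, j⟩ ::ₘ S := by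
  refine ⟨⟨p.val, q.val, q.pos - p.pos - 1⟩, (gaps (A ++ [p]) ++ gaps (q :: B) : List Gap),
    z.pos - p.pos - 1, q.pos - z.pos - 1, ?_, ?_, ?_⟩
  · show q.pos - p.pos - 1 = _
    omega
  · rw [gaps_append, gaps, Multiset.cons_coe, Multiset.coe_eq_coe]
    exact List.perm_middle
  · rw [gaps_append, gaps, gaps, Multiset.cons_coe, Multiset.cons_coe, Multiset.coe_eq_coe]
    exact List.perm_middle.trans (List.perm_middle.cons _)

lemma sum_gaps_m_le {η : ℝ} {B : ℕ} {l : List Mark} (hl : l.Pairwise (Prec η))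
    (hB : ∀ p ∈ l, p.pos ≤ B) : ∀ p ∈ l.head?, ((gaps l).map Gap.m).sum + p.pos ≤ B := by
  induction l with
  | nil => simp
  | cons a l ih =>
    intro p hp
    obtain rfl : a = p := by simpa using hp
    rcases l with _ | ⟨b, l⟩
    · simpa [gaps] using hB
    · have hl' := List.pairwise_cons.1 hl
      have := ih hl'.2 (fun p hp => hB p (List.mem_cons_of_mem _ hp)) b (by simp)
      have := (hl'.1 b (by simp)).1
      simp only [gaps, List.map_cons, List.sum_cons]
      omega

lemma sum_gaps_len_le {η B : ℝ} {l : List Mark} (hl : l.Pairwise (Prec η))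
    (hB : ∀ p ∈ l, p.u ≤ B) : ∀ p ∈ l.head?, η * ((gaps l).map Gap.len).sum + p.u ≤ B := by
  induction l with
  | nil => simp
  | cons a l ih =>
    intro p hp
    obtain rfl : a = p := by simpa using hp
    rcases l with _ | ⟨b, l⟩
    · simpa [gaps] using hB
    · have hl' := List.pairwise_cons.1 hl
      have h1 := ih hl'.2 (fun p hp => hB p (List.mem_cons_of_mem _ hp)) b (by simp)
      have h2 := (hl'.1 b (by simp)).2
      simp only [gaps, List.map_cons, List.sum_cons, mul_add]
      have : η * Gap.len ⟨a.val, b.val, b.pos - a.pos - 1⟩ = η * |a.val - b.val| := rfl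
      linarith

lemma length_gaps_le (l : List Mark) : (gaps l).length ≤ l.length := by
  induction l with
  | nil => simp [gaps]
  | cons a l ih =>
    rcases l with _ | ⟨b, l⟩
    · simp [gaps]
    · simp only [gaps, List.length_cons] at ih ⊢
      omega

lemma gaps_mem {P : ℝ → Prop} {l : List Mark} (h : ∀ p ∈ l, P p.val) :
    ∀ g ∈ gaps l, P g.a ∧ P g.b := by
  induction l with
  | nil => simp [gaps]
  | cons a l ih =>
    rcases l with _ | ⟨b, l⟩
    · simp [gaps]
    · intro g hg
      simp only [gaps, List.mem_cons] at hg
      rcases hg with rfl | hg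
      · exact ⟨h a (by simp), h b (by simp)⟩
      · exact ih (fun p hp => h p (List.mem_cons_of_mem _ hp)) g hg

end Mark

/-! ### Row placements as insertion processes. -/

/-- Online placements, in `m` rows of length `L`, of at most `N` items with slopes in `(0, 1)`. The
lists are the histories, with the last item first. In the row of an item, `bot` is its coordinate at
the bottom and `bot + η x` the one at the top. Items in the same row are horizontally separated by
`e`. -/
structure RowPlacement (N m : ℕ) (e η L : ℝ) where
  e_pos : 0 < e
  η_pos : 0 < η
  L_nonneg : 0 ≤ L
  row : List ℝ → ℕ
  bot : List ℝ → ℝ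
  row_lt : ∀ x l, (x :: l).length ≤ N → (∀ y ∈ x :: l, y ∈ Ioo (0 : ℝ) 1) → row (x :: l) < m
  bot_nonneg : ∀ x l, (x :: l).length ≤ N → (∀ y ∈ x :: l, y ∈ Ioo (0 : ℝ) 1) → 0 ≤ bot (x :: l)
  top_le : ∀ x l, (x :: l).length ≤ N → (∀ y ∈ x :: l, y ∈ Ioo (0 : ℝ) 1) →
    bot (x :: l) + η * x ≤ L
  sep : ∀ x l y l', (x :: l).length ≤ N → (∀ y ∈ x :: l, y ∈ Ioo (0 : ℝ) 1) → y :: l' <:+ l →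
    row (x :: l) = row (y :: l') →
    bot (x :: l) + e ≤ bot (y :: l') ∧ bot (x :: l) + η * x + e ≤ bot (y :: l') + η * y ∨
    bot (y :: l') + e ≤ bot (x :: l) ∧ bot (y :: l') + η * y + e ≤ bot (x :: l) + η * x

namespace RowPlacement

variable {N m : ℕ} {e η L : ℝ}

/-- The number of positions that belong to a row. -/
noncomputable def width (e L : ℝ) : ℕ := ⌊L / e⌋₊ + 2

/-- Separators lie before, between and after the rows, so every item falls between two marks. Each
row has one position for its separator and `⌊L / e⌋₊ + 1` cells; `2 * η` of its coordinate range
absorbs the variation to and from the separators. -/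
noncomputable def separator (e η L : ℝ) (i : ℕ) : Mark :=
  ⟨i * width e L, 1 / 2, i * (2 * L + 2 * η)⟩

variable (P : RowPlacement N m e η L)

/-- Up to an offset, `u` is the sum of the bottom and the top coordinate. Their difference is `η *
x`, and within a row both are ordered alike, so `u` dominates `η` times the change of the value.
Separation by `e` gives different cells. -/
noncomputable def mark (x : ℝ) (l : List ℝ) : Mark :=
  ⟨P.row (x :: l) * width e L + 1 + ⌊P.bot (x :: l) / e⌋₊, x,
    P.row (x :: l) * (2 * L + 2 * η) + η + P.bot (x :: l) + (P.bot (x :: l) + η * x)⟩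

noncomputable def arrangement : List ℝ → List Mark
  | [] => (List.range (m + 1)).map (separator e η L)
  | x :: l => Mark.insert (P.mark x l) (arrangement l)

lemma mem_arrangement {p : Mark} {l : List ℝ} (h : p ∈ P.arrangement l) :
    (∃ i ≤ m, p = separator e η L i) ∨ ∃ y l', y :: l' <:+ l ∧ p = P.mark y l' := by
  induction l with
  | nil =>
    left
    simp only [arrangement, List.mem_map, List.mem_range] at h
    obtain ⟨i, hi, rfl⟩ := h
    exact ⟨i, by omega, rfl⟩
  | cons x l ih =>
    rcases Mark.mem_insert.1 h with rfl | h
    · exact Or.inr ⟨x, l, List.suffix_rfl, rfl⟩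
    · refine (ih h).imp_right ?_
      rintro ⟨y, l', h1, h2⟩
      exact ⟨y, l', h1.trans (List.suffix_cons x l), h2⟩

lemma separator_mem_arrangement {i : ℕ} (hi : i ≤ m) (l : List ℝ) :
    separator e η L i ∈ P.arrangement l := by
  induction l with
  | nil =>
    simp only [arrangement, List.mem_map, List.mem_range]
    exact ⟨i, by omega, rfl⟩
  | cons x l ih => exact Mark.mem_insert.2 (Or.inr ih)

/-- A history that may occur. -/
def Adm (N : ℕ) (l : List ℝ) : Prop := l.length ≤ N ∧ ∀ y ∈ l, y ∈ Ioo (0 : ℝ) 1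

lemma Adm.tail {x : ℝ} {l : List ℝ} (h : Adm N (x :: l)) : Adm N l :=
  ⟨(Nat.le_succ _).trans h.1, fun y hy => h.2 y (List.mem_cons_of_mem _ hy)⟩

lemma Adm.suffix {l l' : List ℝ} (h : Adm N l) (hs : l' <:+ l) : Adm N l' :=
  ⟨hs.length_le.trans h.1, fun y hy => h.2 y (hs.subset hy)⟩

lemma floor_bot_lt {x : ℝ} {l : List ℝ} (h : Adm N (x :: l)) :
    ⌊P.bot (x :: l) / e⌋₊ + 1 < width e L := by
  have he := P.e_pos
  have hη := P.η_pos
  have h1 := P.top_le x l h.1 h.2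
  have h2 := (h.2 x (by simp)).1
  have : ⌊P.bot (x :: l) / e⌋₊ ≤ ⌊L / e⌋₊ := by
    apply Nat.floor_le_floor
    gcongr
    nlinarith
  unfold width; omega

lemma mark_prec_separator {x : ℝ} {l : List ℝ} (h : Adm N (x :: l)) (i : ℕ) :
    Mark.Prec η (separator e η L i) (P.mark x l) ∧ i ≤ P.row (x :: l) ∨
      Mark.Prec η (P.mark x l) (separator e η L i) ∧ P.row (x :: l) < i := by
  have hη := P.η_pos
  have hL := P.L_nonneg
  have h1 := P.top_le x l h.1 h.2
  have h2 := P.bot_nonneg x l h.1 h.2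
  have hx := h.2 x (by simp)
  have hηx : 0 < η * x := mul_pos hη hx.1
  have hfl := P.floor_bot_lt h
  rcases le_or_gt i (P.row (x :: l)) with hi | hi
  · refine Or.inl ⟨⟨?_, ?_⟩, hi⟩
    · have := Nat.mul_le_mul_right (width e L) hi
      simp only [separator, mark]; omega
    · have : (i : ℝ) * (2 * L + 2 * η) ≤ P.row (x :: l) * (2 * L + 2 * η) := by gcongr
      have h3 : |1 / 2 - x| ≤ 1 := by rw [abs_le]; constructor <;> linarith [hx.1, hx.2]
      have h4 : η * |1 / 2 - x| ≤ η := mul_le_of_le_one_right hη.le h3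
      simp only [separator, mark]; linarith
  · refine Or.inr ⟨⟨?_, ?_⟩, hi⟩
    · have h5 : (P.row (x :: l) + 1) * width e L ≤ i * width e L := Nat.mul_le_mul_right _ hi
      rw [add_mul, one_mul] at h5
      simp only [separator, mark]; omega
    · have : ((P.row (x :: l) + 1 : ℕ) : ℝ) * (2 * L + 2 * η) ≤ i * (2 * L + 2 * η) := by
        gcongr; exact hi
      have h3 : |x - 1 / 2| ≤ 1 := by rw [abs_le]; constructor <;> linarith [hx.1, hx.2]
      have h4 : η * |x - 1 / 2| ≤ η := mul_le_of_le_one_right hη.le h3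
      push_cast at this
      simp only [separator, mark]; linarith

lemma mark_prec_of_sep {x y : ℝ} {l l' : List ℝ} (hrow : P.row (x :: l) = P.row (y :: l'))
    (h0 : 0 ≤ P.bot (x :: l)) (h1 : P.bot (x :: l) + e ≤ P.bot (y :: l'))
    (h2 : P.bot (x :: l) + η * x + e ≤ P.bot (y :: l') + η * y) :
    Mark.Prec η (P.mark x l) (P.mark y l') := by
  have he := P.e_pos
  have hη := P.η_pos
  refine ⟨?_, ?_⟩
  · have : ⌊P.bot (x :: l) / e⌋₊ + 1 ≤ ⌊P.bot (y :: l') / e⌋₊ := by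
      rw [← Nat.floor_add_one (by positivity)]
      apply Nat.floor_le_floor
      rw [le_div_iff₀ he, add_mul, div_mul_cancel₀ _ he.ne']
      linarith
    simp only [mark, hrow]; omega
  · simp only [mark, hrow]
    have h3 : η * |x - y| = |η * x - η * y| := by rw [← mul_sub, abs_mul, abs_of_pos hη]
    rw [h3, abs_le]
    have := P.e_pos
    constructor <;> linarith

lemma mark_prec_mark {x y : ℝ} {l l' : List ℝ} (h : Adm N (x :: l)) (hs : y :: l' <:+ l) :
    Mark.Prec η (P.mark y l') (P.mark x l) ∨ Mark.Prec η (P.mark x l) (P.mark y l') := by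
  have hη := P.η_pos
  have hL := P.L_nonneg
  have h' : Adm N (y :: l') := h.tail.suffix hs
  have h2 := P.bot_nonneg x l h.1 h.2
  have h2' := P.bot_nonneg y l' h'.1 h'.2
  rcases lt_trichotomy (P.row (x :: l)) (P.row (y :: l')) with hr | hr | hr
  · right
    refine ⟨?_, ?_⟩
    · have := Nat.mul_le_mul_right (width e L) (Nat.succ_le_of_lt hr)
      rw [Nat.succ_mul] at this
      have := P.floor_bot_lt h
      simp only [mark]; omega
    · have h1 := P.top_le x l h.1 h.2
      have hx := h.2 x (by simp)
      have hy := h'.2 y (by simp)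
      have := mul_pos hη hx.1; have := mul_pos hη hy.1
      have : ((P.row (x :: l) + 1 : ℕ) : ℝ) * (2 * L + 2 * η) ≤
          P.row (y :: l') * (2 * L + 2 * η) := by gcongr; exact hr
      have h3 : |x - y| ≤ 1 := by
        rw [abs_le]; constructor <;> linarith [hx.1, hx.2, hy.1, hy.2]
      have h4 : η * |x - y| ≤ η := mul_le_of_le_one_right hη.le h3
      push_cast at this
      simp only [mark]; linarith
  · rcases P.sep x l y l' h.1 h.2 hs hr with ⟨h3, h4⟩ | ⟨h3, h4⟩
    · exact Or.inr (P.mark_prec_of_sep hr h2 h3 h4)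
    · exact Or.inl (P.mark_prec_of_sep hr.symm h2' h3 h4)
  · left
    refine ⟨?_, ?_⟩
    · have := Nat.mul_le_mul_right (width e L) (Nat.succ_le_of_lt hr)
      rw [Nat.succ_mul] at this
      have := P.floor_bot_lt h'
      simp only [mark]; omega
    · have h1 := P.top_le y l' h'.1 h'.2
      have hx := h.2 x (by simp)
      have hy := h'.2 y (by simp)
      have := mul_pos hη hx.1; have := mul_pos hη hy.1
      have : ((P.row (y :: l') + 1 : ℕ) : ℝ) * (2 * L + 2 * η) ≤
          P.row (x :: l) * (2 * L + 2 * η) := by gcongr; exact hr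
      have h3 : |y - x| ≤ 1 := by
        rw [abs_le]; constructor <;> linarith [hx.1, hx.2, hy.1, hy.2]
      have h4 : η * |y - x| ≤ η := mul_le_of_le_one_right hη.le h3
      push_cast at this
      simp only [mark]; linarith

lemma prec_or_prec {x : ℝ} {l : List ℝ} (h : Adm N (x :: l)) :
    ∀ p ∈ P.arrangement l, Mark.Prec η p (P.mark x l) ∨ Mark.Prec η (P.mark x l) p := by
  intro p hp
  rcases P.mem_arrangement hp with ⟨i, -, rfl⟩ | ⟨y, l', hs, rfl⟩
  · exact (P.mark_prec_separator h i).imp And.left And.left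
  · exact P.mark_prec_mark h hs

lemma pairwise_arrangement {l : List ℝ} (h : Adm N l) :
    (P.arrangement l).Pairwise (Mark.Prec η) := by
  have hη := P.η_pos
  have hL := P.L_nonneg
  induction l with
  | nil =>
    simp only [arrangement]
    rw [List.pairwise_map]
    refine List.pairwise_lt_range.imp ?_
    intro i j hij
    refine ⟨?_, ?_⟩
    · simp only [separator]
      exact Nat.mul_lt_mul_of_pos_right hij (by unfold width; omega)
    · simp only [separator, sub_self, abs_zero, mul_zero]
      have : (i : ℝ) * (2 * L + 2 * η) ≤ j * (2 * L + 2 * η) := by gcongr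
      linarith
  | cons x l ih => exact Mark.pairwise_insert (ih h.tail) (P.prec_or_prec h)

lemma exists_arrangement_cons {x : ℝ} {l : List ℝ} (h : Adm N (x :: l)) :
    ∃ (g : Gap) (S : Multiset Gap) (i j : ℕ), g.m = i + j + 1 ∧
      (Mark.gaps (P.arrangement l) : Multiset Gap) = g ::ₘ S ∧
      (Mark.gaps (P.arrangement (x :: l)) : Multiset Gap) =
        ⟨g.a, x, i⟩ ::ₘ ⟨x, g.b, j⟩ ::ₘ S := by
  have hrow := P.row_lt x l h.1 h.2
  obtain ⟨A, p, q, B, e1, e2, e3, e4⟩ := Mark.exists_insert_eq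
    (P.pairwise_arrangement h.tail) (P.prec_or_prec h)
    ⟨_, P.separator_mem_arrangement (Nat.zero_le m) l,
      ((P.mark_prec_separator h 0).resolve_right fun h' => by omega).1.1⟩
    ⟨_, P.separator_mem_arrangement le_rfl l,
      ((P.mark_prec_separator h m).resolve_left fun h' => by omega).1.1⟩
  have := Mark.gaps_step A p (P.mark x l) q B e3 e4
  rw [arrangement, e2, e1]
  exact this

lemma val_mem {l : List ℝ} (h : Adm N l) : ∀ p ∈ P.arrangement l, p.val ∈ Ioo (0 : ℝ) 1 := by
  intro p hp
  rcases P.mem_arrangement hp with ⟨i, -, rfl⟩ | ⟨y, l', hs, rfl⟩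
  · simp only [separator]; norm_num
  · exact h.2 y (hs.subset (by simp))

lemma u_le {l : List ℝ} (h : Adm N l) : ∀ p ∈ P.arrangement l, p.u ≤ m * (2 * L + 2 * η) := by
  have hη := P.η_pos
  have hL := P.L_nonneg
  intro p hp
  rcases P.mem_arrangement hp with ⟨i, hi, rfl⟩ | ⟨y, l', hs, rfl⟩
  · simp only [separator]; gcongr
  · have h' := h.suffix hs
    rcases P.mark_prec_separator h' m with ⟨-, h1⟩ | ⟨h1, -⟩
    · have := P.row_lt y l' h'.1 h'.2; omega
    · have h2 := h1.2
      have : 0 ≤ η * |(P.mark y l').val - (separator e η L m).val| := by positivity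
      simp only [separator] at h2 this ⊢
      linarith

lemma u_nonneg {l : List ℝ} (h : Adm N l) : ∀ p ∈ P.arrangement l, 0 ≤ p.u := by
  have hη := P.η_pos
  have hL := P.L_nonneg
  intro p hp
  rcases P.mem_arrangement hp with ⟨i, -, rfl⟩ | ⟨y, l', hs, rfl⟩
  · simp only [separator]; positivity
  · have h' := h.suffix hs
    have h1 := P.bot_nonneg y l' h'.1 h'.2
    have h2 := (h'.2 y (by simp)).1
    simp only [mark]; positivity

open Classical in
/-- The insertion process of the placements. -/
noncomputable def system : GapSystem where
  State := {l : List ℝ // Adm N l}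
  gaps l := Mark.gaps (P.arrangement l.1)
  next l x := if h : Adm N (x :: l.1) then ⟨x :: l.1, h⟩ else l
  Alive l := l.1.length < N
  inUnit l g hg := Mark.gaps_mem (P := fun v => v ∈ Ioo (0 : ℝ) 1)
    (P.val_mem l.2) g (Multiset.mem_coe.1 hg)
  step l hl x hx := by
    have h : Adm N (x :: l.1) := ⟨hl, fun y hy => by
      rcases List.mem_cons.1 hy with rfl | hy
      · exact hx
      · exact l.2.2 y hy⟩
    have := P.exists_arrangement_cons h
    simpa only [h, dif_pos] using this

lemma free_add_length (l : List ℝ) (h : Adm N l) :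
    P.system.free ⟨l, h⟩ + l.length =
      P.system.free ⟨[], Nat.zero_le _, by simp⟩ := by
  induction l with
  | nil => rfl
  | cons x l ih =>
    rw [← ih h.tail]
    obtain ⟨g, S, i, j, hm, e1, e2⟩ := P.exists_arrangement_cons h
    have f1 : P.system.free ⟨l, h.tail⟩ = ((g ::ₘ S).map Gap.m).sum := by
      rw [← e1]; rfl
    have f2 : P.system.free ⟨x :: l, h⟩ =
        ((⟨g.a, x, i⟩ ::ₘ ⟨x, g.b, j⟩ ::ₘ S : Multiset Gap).map Gap.m).sum := by
      rw [← e2]; rfl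
    rw [f1, f2]
    simp only [Multiset.map_cons, Multiset.sum_cons, List.length_cons, hm]
    omega

/-- Such placements do not exist if there are sufficiently many items. -/
theorem elim (P : RowPlacement N m e η L) (hN : 1 ≤ N) {R K : ℕ} (hR : 1 ≤ R)
    (hRQ : Real.log (m + N + 3 : ℕ) ≤ R * Real.log 2) {V : ℝ} (hV : m * (2 * L / η + 2) < V)
    (hK : 64 * ((4 * V + 3) / N * (m * (L / e + 2)) + 2 * V + 1) ≤ K)
    (hsize : 64 * (4 * V + 3) * (16 * (R * (K + 64) ^ 4) : ℝ) ^ K ≤ N) : False := by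
  have he := P.e_pos
  have hη := P.η_pos
  have hL := P.L_nonneg
  have hV0 : 0 ≤ V := le_trans (by positivity) hV.le
  set s₀ : P.system.State := ⟨[], Nat.zero_le _, by simp⟩ with hs₀
  have hfree0 : (P.system.free s₀ : ℝ) ≤ m * (L / e + 2) := by
    have h1 := Mark.sum_gaps_m_le (B := m * width e L)
      (P.pairwise_arrangement s₀.2) (fun p hp => by
        rcases P.mem_arrangement hp with ⟨i, hi, rfl⟩ | ⟨y, l', hs, rfl⟩
        · exact Nat.mul_le_mul_right _ hi
        · simp [hs₀] at hs) (separator e η L 0) (by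
          simp [hs₀, arrangement, List.head?_range])
    have h2 : P.system.free s₀ ≤ m * width e L := by
      refine le_trans (le_of_eq ?_) ((Nat.le_add_right _ _).trans h1)
      show ((Mark.gaps (P.arrangement [] ) : Multiset Gap).map Gap.m).sum = _
      rw [Multiset.map_coe, Multiset.sum_coe]
    have h3 : (width e L : ℝ) ≤ L / e + 2 := by
      unfold width; push_cast
      have := Nat.floor_le (show 0 ≤ L / e by positivity)
      linarith
    calc (P.system.free s₀ : ℝ) ≤ ((m * width e L : ℕ) : ℝ) := by exact_mod_cast h2
      _ = m * width e L := by push_cast; rfl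
      _ ≤ _ := by gcongr
  have hlenarr : ∀ l, (P.arrangement l).length = m + 1 + l.length := by
    intro l
    induction l with
    | nil => simp [arrangement]
    | cons x l ih => rw [arrangement, Mark.length_insert, ih]; simp; omega
  obtain ⟨s, hs⟩ := GapSystem.exists_variation_ge (Y := P.system) s₀
    (by
      intro g hg
      have := Mark.gaps_mem (P := fun v => v = 1 / 2) (l := P.arrangement []) (by
        intro p hp
        rcases P.mem_arrangement hp with ⟨i, hi, rfl⟩ | ⟨y, l', hs, rfl⟩
        · rfl
        · simp at hs) g (Multiset.mem_coe.1 hg)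
      unfold Gap.len
      rw [this.1, this.2]; simp)
    hV0 hN (Q := m + N + 3) (by omega) hR
    (fun s hs => by
      have h1 := P.free_add_length s.1 s.2
      have h2 : ¬ s.1.length < N := hs
      rw [hs₀, ← h1]
      show P.system.free ⟨s.1, s.2⟩ + N ≤ _
      omega)
    (fun s => by
      have h1 := P.free_add_length s.1 s.2
      rw [hs₀, ← h1]
      exact Nat.le_add_right _ _)
    (fun s => by
      show (Mark.gaps (P.arrangement s.1)).length ≤ _
      have h1 := Mark.length_gaps_le (P.arrangement s.1)
      have h2 := hlenarr s.1
      have h3 := s.2.1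
      omega)
    hRQ (le_trans (by gcongr) hK) hsize
  have hne : ∃ p, p ∈ (P.arrangement s.1).head? := by
    have := hlenarr s.1
    cases h : P.arrangement s.1 with
    | nil => rw [h] at this; simp at this; omega
    | cons a l => exact ⟨a, by simp⟩
  obtain ⟨p, hp⟩ := hne
  have h1 := Mark.sum_gaps_len_le (P.pairwise_arrangement s.2) (P.u_le s.2) p hp
  have h2 := P.u_nonneg s.2 p (List.mem_of_mem_head? hp)
  have h3 : P.system.variation s = ((Mark.gaps (P.arrangement s.1)).map Gap.len).sum := by
    show ((Mark.gaps (P.arrangement s.1) : Multiset Gap).map Gap.len).sum = _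
    rw [Multiset.map_coe, Multiset.sum_coe]
  rw [← h3] at h1
  have h4 : η * V ≤ m * (2 * L + 2 * η) := by
    have : η * V ≤ η * P.system.variation s := by gcongr
    linarith
  have h5 : η * (m * (2 * L / η + 2)) = m * (2 * L + 2 * η) := by field_simp
  have h6 : η * (m * (2 * L / η + 2)) < η * V := mul_lt_mul_of_pos_left hV hη
  linarith

end RowPlacement

/-! ### Choice of the parameters. -/

lemma log_le_two_mul_sqrt {t : ℝ} (ht : 0 < t) : Real.log t ≤ 2 * √t := by
  have h1 : Real.log t = 2 * Real.log (√t) := by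
    rw [Real.log_sqrt ht.le]; ring
  rw [h1]
  have := Real.log_le_self (Real.sqrt_nonneg t)
  linarith

lemma tendsto_log_div_log_log :
    Filter.Tendsto (fun n : ℕ => Real.log n / Real.log (Real.log n)) Filter.atTop Filter.atTop := by
  have h1 : Filter.Tendsto (fun n : ℕ => Real.log n) Filter.atTop Filter.atTop :=
    Real.tendsto_log_atTop.comp tendsto_natCast_atTop_atTop
  have h2 : Filter.Tendsto (fun n : ℕ => √(Real.log n) / 2) Filter.atTop Filter.atTop :=
    (Real.tendsto_sqrt_atTop.comp h1).atTop_div_const two_pos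
  refine Filter.tendsto_atTop_mono' _ ?_ h2
  filter_upwards [h1.eventually_ge_atTop 2] with n hn
  have h3 : 0 < Real.log (Real.log n) := Real.log_pos (by linarith)
  rw [le_div_iff₀ h3]
  have h4 := log_le_two_mul_sqrt (t := Real.log n) (by linarith)
  have h5 := Real.mul_self_sqrt (show 0 ≤ Real.log n by linarith)
  nlinarith [Real.sqrt_nonneg (Real.log n)]

/-- With `ℓ = log n`, the base of the power is at most `ℓ ^ 6`, and `K ≤ ℓ / (12 * log ℓ)` makes the
power at most `√n`. The other factor `√n` absorbs the prefactor, which is at most `ℓ ^ 2`. -/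
lemma size_condition {n : ℕ} (hn : 2000 ≤ Real.log n) {K m : ℕ} {V : ℝ}
    (hVK : V ≤ K) (hK : (K : ℝ) ≤ 1 / 12 * (Real.log n / Real.log (Real.log n))) (hm : m ≤ n) :
    ∃ R : ℕ, 1 ≤ R ∧ Real.log (m + n + 3 : ℕ) ≤ R * Real.log 2 ∧
      64 * (4 * V + 3) * (16 * (R * (K + 64) ^ 4) : ℝ) ^ K ≤ n := by
  set ℓ := Real.log n with hℓ
  have hn0 : (0 : ℝ) < n := by
    rcases Nat.eq_zero_or_pos n with rfl | h
    · simp at hℓ; rw [hℓ] at hn; norm_num at hn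
    · exact_mod_cast h
  have hn4 : 4 ≤ n := by
    have : ℓ ≤ n := Real.log_le_self hn0.le
    have : (4 : ℝ) ≤ n := by linarith
    exact_mod_cast this
  have hll1 : 1 ≤ Real.log ℓ := by
    rw [Real.le_log_iff_exp_le (by linarith)]
    linarith [Real.exp_one_lt_d9]
  have hll4 : 4 * Real.log ℓ ≤ ℓ := by
    have h1 := log_le_two_mul_sqrt (t := ℓ) (by linarith)
    have h2 := Real.mul_self_sqrt (show 0 ≤ ℓ by linarith)
    have h3 : 8 ≤ √ℓ := Real.le_sqrt_of_sq_le (by linarith)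
    nlinarith
  have hKl : K * Real.log ℓ ≤ ℓ / 12 := by
    have := mul_le_mul_of_nonneg_right hK (by linarith : 0 ≤ Real.log ℓ)
    have e : 1 / 12 * (ℓ / Real.log ℓ) * Real.log ℓ = ℓ / 12 := by field_simp
    linarith
  have hK1 : (K : ℝ) ≤ ℓ / 12 := by
    have : (K : ℝ) * 1 ≤ K * Real.log ℓ := by gcongr
    linarith
  have hlog2 := Real.log_two_gt_d9
  have hQ : Real.log (m + n + 3 : ℕ) ≤ 2 * ℓ := by
    have h1 : ((m + n + 3 : ℕ) : ℝ) ≤ (n : ℝ) ^ 2 := by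
      have : m + n + 3 ≤ n ^ 2 := by nlinarith
      exact_mod_cast this
    have h2 := Real.log_le_log (by positivity) h1
    rw [Real.log_pow] at h2
    exact_mod_cast h2
  refine ⟨⌈Real.log (m + n + 3 : ℕ) / Real.log 2⌉₊, ?_, ?_, ?_⟩
  · rw [Nat.one_le_ceil_iff]
    apply div_pos
    · exact Real.log_pos (by push_cast; linarith)
    · linarith
  · rw [← div_le_iff₀ (by linarith)]
    exact Nat.le_ceil _
  · have hR : ((⌈Real.log (m + n + 3 : ℕ) / Real.log 2⌉₊ : ℕ) : ℝ) ≤ 5 * ℓ := by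
      have h1 := (Nat.ceil_lt_add_one (a := Real.log (m + n + 3 : ℕ) / Real.log 2)
        (div_nonneg (Real.log_natCast_nonneg _) (by linarith))).le
      have h2 : Real.log (m + n + 3 : ℕ) / Real.log 2 ≤ 4 * ℓ := by
        rw [div_le_iff₀ (by linarith)]; nlinarith
      linarith
    set R := ⌈Real.log (m + n + 3 : ℕ) / Real.log 2⌉₊
    have h1 : (16 * (R * (K + 64) ^ 4) : ℝ) ≤ ℓ ^ 6 := by
      have : (K + 64 : ℝ) ≤ 2 * ℓ := by linarith
      calc (16 * (R * (K + 64) ^ 4) : ℝ) ≤ 16 * (5 * ℓ * (2 * ℓ) ^ 4) := by gcongr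
        _ = 1280 * ℓ ^ 5 := by ring
        _ ≤ ℓ * ℓ ^ 5 := by gcongr; linarith
        _ = ℓ ^ 6 := by ring
    have h2 : 64 * (4 * V + 3) ≤ ℓ ^ 2 := by nlinarith
    have hℓ0 : 0 < ℓ := by linarith
    calc 64 * (4 * V + 3) * (16 * (R * (K + 64) ^ 4) : ℝ) ^ K ≤ ℓ ^ 2 * (ℓ ^ 6) ^ K := by gcongr
      _ = ℓ ^ (6 * K + 2) := by rw [← pow_mul, ← pow_add, add_comm]
      _ = Real.exp ((6 * K + 2 : ℕ) * Real.log ℓ) := by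
        rw [Real.exp_nat_mul, Real.exp_log hℓ0]
      _ ≤ Real.exp ℓ := by
        apply Real.exp_le_exp.2
        push_cast
        linarith
      _ = n := Real.exp_log hn0

/-- Rows and lengths that suffice for all streams of `n` items. -/
theorem RowPlacement.exists_lower_bound : ∃ N₀ : ℕ, 1 ≤ N₀ ∧ ∀ n ≥ N₀, ∀ (m : ℕ) (e η L : ℝ),
    RowPlacement n m e η L → Real.log n / Real.log (Real.log n) <
      5376 * (m * (2 * L / η + 2) + 1) * (m * (L / e + 2) / n + 1) := by
  have h1 : Filter.Tendsto (fun n : ℕ => Real.log n) Filter.atTop Filter.atTop :=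
    Real.tendsto_log_atTop.comp tendsto_natCast_atTop_atTop
  obtain ⟨N₀, hN₀⟩ := Filter.eventually_atTop.1 (h1.eventually_ge_atTop 2000)
  refine ⟨max N₀ 1, le_max_right _ _, fun n hn m e η L P => ?_⟩
  by_contra hcon
  rw [not_lt] at hcon
  have hℓ := hN₀ n (le_trans (le_max_left _ _) hn)
  have hn1 : 1 ≤ n := le_trans (le_max_right _ _) hn
  have he := P.e_pos; have hη := P.η_pos; have hL := P.L_nonneg
  set V : ℝ := m * (2 * L / η + 2) + 1 with hV
  set B : ℝ := m * (L / e + 2) / n with hB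
  have hV1 : 1 ≤ V := by
    have : (0 : ℝ) ≤ m * (2 * L / η + 2) := by positivity
    linarith
  have hB0 : 0 ≤ B := by positivity
  have hmV : (m : ℝ) ≤ V := by
    have : (m : ℝ) * 2 ≤ m * (2 * L / η + 2) := by
      gcongr
      have : 0 ≤ 2 * L / η := by positivity
      linarith
    linarith [(Nat.cast_nonneg m : (0 : ℝ) ≤ m)]
  set T : ℝ := 64 * ((4 * V + 3) / n * (m * (L / e + 2)) + 2 * V + 1) with hT
  have hTB : T = 64 * ((4 * V + 3) * B + 2 * V + 1) := by rw [hT, hB]; ring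
  have hT0 : 0 ≤ T := by rw [hTB]; positivity
  -- Together with the factor `1 / 12` of `size_condition`, this is the source of `5376 = 12 * 448`.
  have hTle : T + 1 ≤ 448 * V * (B + 1) := by rw [hTB]; nlinarith
  have hKle : ((⌈T⌉₊ : ℕ) : ℝ) ≤ 1 / 12 * (Real.log n / Real.log (Real.log n)) := by
    have := (Nat.ceil_lt_add_one hT0).le
    nlinarith
  have hTK := Nat.le_ceil T
  have hVK : V ≤ (⌈T⌉₊ : ℕ) := by
    refine le_trans ?_ hTK
    rw [hTB]; nlinarith
  have hmn : m ≤ n := by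
    have hll : 1 ≤ Real.log (Real.log n) := by
      rw [Real.le_log_iff_exp_le (by linarith)]
      linarith [Real.exp_one_lt_d9]
    have h2 : Real.log n / Real.log (Real.log n) ≤ Real.log n := div_le_self (by linarith) hll
    have h3 : Real.log n ≤ n := Real.log_le_self (by positivity)
    have : (m : ℝ) ≤ n := by linarith
    exact_mod_cast this
  obtain ⟨R, hR1, hR2, hR3⟩ := size_condition hℓ hVK hKle hmn
  exact P.elim hn1 hR1 hR2 (V := V) (by linarith) hTK hR3

/-! ### Slivers and their rows. -/

namespace ConvexPolygon

lemma mem_translate {P : ConvexPolygon} {v q : Plane} :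
    q ∈ P.translate v ↔ q - v ∈ P.carrier := by
  constructor
  · rintro ⟨p, hp, rfl⟩
    simpa using hp
  · intro h
    exact ⟨q - v, h, by simp⟩

end ConvexPolygon

/-- Thickness and height of a family of parallelograms. -/
structure Sliver where
  e : ℝ
  h : ℝ
  e_pos : 0 < e
  h_pos : 0 < h

namespace Sliver

variable (s : Sliver)

/-- The parallelogram of slope `x`. -/
def region (x : ℝ) : Set Plane :=
  {p | 0 ≤ p 1 ∧ p 1 ≤ s.h ∧ x * p 1 ≤ p 0 ∧ p 0 ≤ x * p 1 + s.e}

/-- The open parallelogram of slope `x`. -/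
def openRegion (x : ℝ) : Set Plane :=
  {p | 0 < p 1 ∧ p 1 < s.h ∧ x * p 1 < p 0 ∧ p 0 < x * p 1 + s.e}

noncomputable def vertices (x : ℝ) : Finset Plane :=
  open Classical in {!₂[0, 0], !₂[s.e, 0], !₂[x * s.h, s.h], !₂[x * s.h + s.e, s.h]}

lemma convex_region (x : ℝ) : Convex ℝ (s.region x) := by
  rintro p ⟨p1, p2, p3, p4⟩ q ⟨q1, q2, q3, q4⟩ a b ha hb hab
  have hb' : b = 1 - a := by linarith
  subst hb'
  refine ⟨?_, ?_, ?_, ?_⟩ <;> simp only [PiLp.add_apply, PiLp.smul_apply, smul_eq_mul] <;> nlinarith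

lemma convexHull_vertices (x : ℝ) : convexHull ℝ (s.vertices x : Set Plane) = s.region x := by
  have he := s.e_pos
  have hh := s.h_pos
  apply subset_antisymm
  · refine convexHull_min ?_ (s.convex_region x)
    intro p hp
    simp only [vertices, Finset.coe_insert, Finset.coe_singleton, mem_insert_iff,
      mem_singleton_iff] at hp
    rcases hp with rfl | rfl | rfl | rfl <;>
      refine ⟨?_, ?_, ?_, ?_⟩ <;> simp <;> linarith
  · rintro p ⟨p1, p2, p3, p4⟩
    set μ : ℝ := (p 0 - x * p 1) / s.e with hμ
    set ν : ℝ := p 1 / s.h with hν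
    have hμ0 : 0 ≤ μ := div_nonneg (by linarith) he.le
    have hμ1 : μ ≤ 1 := by rw [hμ, div_le_one he]; linarith
    have hν0 : 0 ≤ ν := div_nonneg p1 hh.le
    have hν1 : ν ≤ 1 := by rw [hν, div_le_one hh]; exact p2
    have hμe : μ * s.e = p 0 - x * p 1 := by rw [hμ]; field_simp
    have hνh : ν * s.h = p 1 := by rw [hν]; field_simp
    have hC := convex_convexHull ℝ (s.vertices x : Set Plane)
    have hv : ∀ q ∈ s.vertices x, q ∈ convexHull ℝ (s.vertices x : Set Plane) := fun q hq =>
      subset_convexHull ℝ _ hq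
    have h1 := hC (hv !₂[0, 0] (by simp [vertices])) (hv !₂[s.e, 0] (by simp [vertices]))
      (sub_nonneg.2 hμ1) hμ0 (by ring)
    have h2 := hC (hv !₂[x * s.h, s.h] (by simp [vertices]))
      (hv !₂[x * s.h + s.e, s.h] (by simp [vertices])) (sub_nonneg.2 hμ1) hμ0 (by ring)
    have h3 := hC h1 h2 (sub_nonneg.2 hν1) hν0 (by ring)
    convert h3 using 1
    ext i
    fin_cases i
    · simp only [Fin.zero_eta, PiLp.add_apply, PiLp.smul_apply, smul_eq_mul]
      simp
      linear_combination (-1) * hμe - x * hνh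
    · simp only [Fin.mk_one, PiLp.add_apply, PiLp.smul_apply, smul_eq_mul]
      simp
      linear_combination (-1) * hνh

lemma isOpen_openRegion (x : ℝ) : IsOpen (s.openRegion x) := by
  have h0 : Continuous fun p : Plane => p 0 := by fun_prop
  have h1 : Continuous fun p : Plane => p 1 := by fun_prop
  refine (isOpen_lt continuous_const h1).inter ((isOpen_lt h1 continuous_const).inter
    ((isOpen_lt (continuous_const.mul h1) h0).inter
      (isOpen_lt h0 ((continuous_const.mul h1).add continuous_const))))

lemma openRegion_subset (x : ℝ) : s.openRegion x ⊆ s.region x :=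
  fun _ ⟨h1, h2, h3, h4⟩ => ⟨h1.le, h2.le, h3.le, h4.le⟩

/-- The piece of slope `x`. -/
noncomputable def piece (x : ℝ) : ConvexPolygon where
  carrier := convexHull ℝ (s.vertices x : Set Plane)
  exists_vertices := ⟨s.vertices x, rfl⟩
  interior_nonempty := by
    rw [s.convexHull_vertices]
    refine ⟨!₂[x * (s.h / 2) + s.e / 2, s.h / 2],
      interior_maximal (s.openRegion_subset x) (s.isOpen_openRegion x) ?_⟩
    have he := s.e_pos
    have hh := s.h_pos
    refine ⟨?_, ?_, ?_, ?_⟩ <;> simp <;> linarith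

lemma mem_piece {x : ℝ} {p : Plane} : p ∈ (s.piece x).carrier ↔
    0 ≤ p 1 ∧ p 1 ≤ s.h ∧ x * p 1 ≤ p 0 ∧ p 0 ≤ x * p 1 + s.e := by
  show p ∈ convexHull ℝ (s.vertices x : Set Plane) ↔ _
  rw [s.convexHull_vertices]; rfl

lemma mem_interior_translate {x : ℝ} {v q : Plane} (h : q - v ∈ s.openRegion x) :
    q ∈ interior ((s.piece x).translate v) := by
  have ho : IsOpen ((fun q : Plane => q - v) ⁻¹' s.openRegion x) :=
    (s.isOpen_openRegion x).preimage (by fun_prop)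
  refine interior_maximal ?_ ho h
  intro q hq
  rw [ConvexPolygon.mem_translate, mem_piece]
  exact s.openRegion_subset x hq

/-- The open parallelograms of slopes `x` and `y` at `v` and `w` are disjoint. -/
def Apart (x : ℝ) (v : Plane) (y : ℝ) (w : Plane) : Prop :=
  ∀ q : Plane, q - v ∈ s.openRegion x → q - w ∉ s.openRegion y

variable {s}

lemma apart_of_disjoint {x y : ℝ} {v w : Plane}
    (h : Disjoint (interior ((s.piece x).translate v)) (interior ((s.piece y).translate w))) :
    s.Apart x v y w := fun _ h1 h2 =>
  Set.disjoint_left.1 h (s.mem_interior_translate h1) (s.mem_interior_translate h2)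

/-- At every height where both parallelograms are present, they are separated. -/
lemma Apart.le_abs {x y : ℝ} {v w : Plane} (h : s.Apart x v y w) {t : ℝ} (h1 : v 1 < t)
    (h2 : t < v 1 + s.h) (h3 : w 1 < t) (h4 : t < w 1 + s.h) :
    s.e ≤ |(w 0 + y * (t - w 1)) - (v 0 + x * (t - v 1))| := by
  by_contra hcon
  rw [not_le] at hcon
  set a := v 0 + x * (t - v 1) with ha
  set b := w 0 + y * (t - w 1) with hb
  rw [abs_lt] at hcon
  have he := s.e_pos
  -- The midpoint of the common part of the sections `(a, a + e)` and `(b, b + e)`.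
  refine h !₂[(a + b + s.e) / 2, t] ⟨?_, ?_, ?_, ?_⟩ ⟨?_, ?_, ?_, ?_⟩ <;>
    simp <;> linarith [hcon.1, hcon.2]

/-- The signed horizontal distance is continuous in the height and never vanishes, so both ends show
the same order. -/
lemma Apart.separated {x y : ℝ} {v w : Plane} (h : s.Apart x v y w) {t₀ t₁ : ℝ} (ht : t₀ < t₁)
    (h1 : v 1 < t₀) (h2 : t₁ < v 1 + s.h) (h3 : w 1 < t₀) (h4 : t₁ < w 1 + s.h) :
    (v 0 + x * (t₀ - v 1) + s.e ≤ w 0 + y * (t₀ - w 1) ∧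
      v 0 + x * (t₁ - v 1) + s.e ≤ w 0 + y * (t₁ - w 1)) ∨
    (w 0 + y * (t₀ - w 1) + s.e ≤ v 0 + x * (t₀ - v 1) ∧
      w 0 + y * (t₁ - w 1) + s.e ≤ v 0 + x * (t₁ - v 1)) := by
  have he := s.e_pos
  have key : ∀ t, t₀ ≤ t → t ≤ t₁ →
      s.e ≤ |(w 0 + y * (t - w 1)) - (v 0 + x * (t - v 1))| := fun t ha hb =>
    h.le_abs (by linarith) (by linarith) (by linarith) (by linarith)
  have hzero : ∀ t, t₀ ≤ t → t ≤ t₁ → (w 0 + y * (t - w 1)) - (v 0 + x * (t - v 1)) ≠ 0 := by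
    intro t ha hb h0
    have := key t ha hb
    rw [h0, abs_zero] at this
    linarith
  have hcont : ContinuousOn (fun t => (w 0 + y * (t - w 1)) - (v 0 + x * (t - v 1)))
      (Icc t₀ t₁) := by fun_prop
  rcases _root_.le_abs.1 (key t₀ le_rfl ht.le) with k0 | k0 <;>
    rcases _root_.le_abs.1 (key t₁ ht.le le_rfl) with k1 | k1
  · left; constructor <;> linarith
  · obtain ⟨t, ⟨ha, hb⟩, h0⟩ := intermediate_value_Icc' ht.le hcont
      (show (0 : ℝ) ∈ _ from ⟨by linarith, by linarith⟩)
    exact absurd h0 (hzero t ha hb)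
  · obtain ⟨t, ⟨ha, hb⟩, h0⟩ := intermediate_value_Icc ht.le hcont
      (show (0 : ℝ) ∈ _ from ⟨by linarith, by linarith⟩)
    exact absurd h0 (hzero t ha hb)
  · right; constructor <;> linarith

variable (s)

/-- The row of a piece at height `y`. -/
noncomputable def row (y : ℝ) : ℕ := ⌊4 * y / s.h⌋₊

/-- The height of the bottom of a row. -/
noncomputable def level (i : ℕ) : ℝ := (i + 1) * (s.h / 4)

/-- The left end, at the bottom of its row, of the piece of slope `x` at `v`. -/
noncomputable def leftEnd (x : ℝ) (v : Plane) : ℝ := v 0 + x * (s.level (s.row (v 1)) - v 1)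

/-- The next multiple of `h / 4` strictly above `y` starts a slab of height `h / 4` that ends below
`y + h`; a sliver at height `y` crosses it completely. -/
lemma level_bounds {y : ℝ} (hy : 0 ≤ y) :
    y < s.level (s.row y) ∧ s.level (s.row y) + s.h / 4 ≤ y + s.h / 2 := by
  have hh := s.h_pos
  have h0 : 0 ≤ 4 * y / s.h := by positivity
  have h1 := Nat.lt_floor_add_one (4 * y / s.h)
  have h2 := Nat.floor_le h0
  rw [div_lt_iff₀ hh] at h1
  rw [le_div_iff₀ hh] at h2
  unfold level row
  constructor <;> nlinarith

lemma leftEnd_bounds {x : ℝ} (hx0 : 0 ≤ x) (hx1 : x ≤ 1) {v : Plane} (hv : 0 ≤ v 1) :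
    v 0 ≤ s.leftEnd x v ∧ s.leftEnd x v + s.h / 4 * x ≤ v 0 + s.h := by
  obtain ⟨h1, h2⟩ := s.level_bounds hv
  have hh := s.h_pos
  unfold leftEnd
  constructor
  · nlinarith
  · nlinarith

variable {s} in
lemma Apart.leftEnd_separated {x y : ℝ} {v w : Plane} (h : s.Apart x v y w) (hv : 0 ≤ v 1)
    (hw : 0 ≤ w 1) (hr : s.row (v 1) = s.row (w 1)) :
    (s.leftEnd x v + s.e ≤ s.leftEnd y w ∧
      s.leftEnd x v + s.h / 4 * x + s.e ≤ s.leftEnd y w + s.h / 4 * y) ∨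
    (s.leftEnd y w + s.e ≤ s.leftEnd x v ∧
      s.leftEnd y w + s.h / 4 * y + s.e ≤ s.leftEnd x v + s.h / 4 * x) := by
  have hh := s.h_pos
  obtain ⟨a1, a2⟩ := s.level_bounds hv
  obtain ⟨b1, b2⟩ := s.level_bounds hw
  unfold leftEnd
  rw [hr] at a1 a2 ⊢
  have := h.separated (t₀ := s.level (s.row (w 1))) (t₁ := s.level (s.row (w 1)) + s.h / 4)
    (by linarith) a1 (by linarith) b1 (by linarith)
  refine this.imp (fun h => ⟨h.1, ?_⟩) (fun h => ⟨h.1, ?_⟩) <;> linarith [h.2]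

/-- A family of placements of slivers, depending on the history, gives row placements. -/
noncomputable def rowPlacement {n k : ℕ} {H L : ℝ} (hL : 0 ≤ L) (pos : List ℝ → Plane)
    (grp : List ℝ → ℕ)
    (hgrp : ∀ x l, RowPlacement.Adm n (x :: l) → grp (x :: l) < k)
    (hbox : ∀ x l, RowPlacement.Adm n (x :: l) → 0 ≤ pos (x :: l) 0 ∧
      pos (x :: l) 0 + s.h ≤ L ∧ 0 ≤ pos (x :: l) 1 ∧ pos (x :: l) 1 ≤ H)
    (hsep : ∀ x l y l', RowPlacement.Adm n (x :: l) → y :: l' <:+ l →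
      grp (x :: l) = grp (y :: l') → s.Apart x (pos (x :: l)) y (pos (y :: l'))) :
    RowPlacement n (k * (s.row H + 1)) s.e (s.h / 4) L where
  e_pos := s.e_pos
  η_pos := by have := s.h_pos; positivity
  L_nonneg := hL
  -- Groups and rows are numbered lexicographically. The default of `headD` concerns the empty
  -- history only.
  row l := grp l * (s.row H + 1) + s.row (pos l 1)
  bot l := s.leftEnd (l.headD 0) (pos l)
  row_lt x l h1 h2 := by
    have h3 := hgrp x l ⟨h1, h2⟩
    obtain ⟨-, -, b3, b4⟩ := hbox x l ⟨h1, h2⟩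
    have hh := s.h_pos
    have : s.row (pos (x :: l) 1) ≤ s.row H := by
      unfold row
      apply Nat.floor_le_floor
      gcongr
    calc grp (x :: l) * (s.row H + 1) + s.row (pos (x :: l) 1)
        < grp (x :: l) * (s.row H + 1) + (s.row H + 1) := by omega
      _ = (grp (x :: l) + 1) * (s.row H + 1) := by ring
      _ ≤ _ := Nat.mul_le_mul_right _ h3
  bot_nonneg x l h1 h2 := by
    obtain ⟨b1, -, b3, b4⟩ := hbox x l ⟨h1, h2⟩
    have hx := h2 x (by simp)
    exact b1.trans (s.leftEnd_bounds hx.1.le hx.2.le b3).1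
  top_le x l h1 h2 := by
    obtain ⟨b1, b2, b3, b4⟩ := hbox x l ⟨h1, h2⟩
    have hx := h2 x (by simp)
    exact (s.leftEnd_bounds hx.1.le hx.2.le b3).2.trans b2
  sep x l y l' h1 h2 hs hrow := by
    have hadm : RowPlacement.Adm n (x :: l) := ⟨h1, h2⟩
    have hadm' : RowPlacement.Adm n (y :: l') := hadm.tail.suffix hs
    obtain ⟨-, -, b3, b4⟩ := hbox x l hadm
    obtain ⟨-, -, c3, c4⟩ := hbox y l' hadm'
    have hh := s.h_pos
    have r1 : s.row (pos (x :: l) 1) < s.row H + 1 := by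
      unfold row
      refine Nat.lt_succ_of_le (Nat.floor_le_floor ?_)
      gcongr
    have r2 : s.row (pos (y :: l') 1) < s.row H + 1 := by
      unfold row
      refine Nat.lt_succ_of_le (Nat.floor_le_floor ?_)
      gcongr
    have hg : grp (x :: l) = grp (y :: l') := by
      have := congrArg (· / (s.row H + 1)) hrow
      simp only at this
      rwa [Nat.mul_comm, Nat.mul_add_div (Nat.succ_pos _), Nat.div_eq_of_lt r1,
        Nat.mul_comm (grp (y :: l')), Nat.mul_add_div (Nat.succ_pos _), Nat.div_eq_of_lt r2] at this
    have hr : s.row (pos (x :: l) 1) = s.row (pos (y :: l') 1) := by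
      rw [hg] at hrow; omega
    exact (hsep x l y l' hadm hs hg).leftEnd_separated b3 c3 hr

/-- The number of disjoint slivers in `k` boxes is bounded. -/
lemma card_le {n : ℕ} {ι : Type*} [DecidableEq ι] {H L : ℝ} (ξ : Fin n → ℝ)
    (hξ : ∀ i, 0 ≤ ξ i ∧ ξ i ≤ 1) (v : Fin n → Plane) (grp : Fin n → ι)
    (hbox : ∀ i, 0 ≤ v i 0 ∧ v i 0 + s.h ≤ L ∧ 0 ≤ v i 1 ∧ v i 1 ≤ H)
    (hsep : ∀ i j, i ≠ j → grp i = grp j → s.Apart (ξ i) (v i) (ξ j) (v j)) :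
    n ≤ (Finset.univ.image grp).card * ((s.row H + 1) * (⌊L / s.e⌋₊ + 1)) := by
  have he := s.e_pos
  have hh := s.h_pos
  have hle : ∀ i, 0 ≤ s.leftEnd (ξ i) (v i) ∧ s.leftEnd (ξ i) (v i) ≤ L := by
    intro i
    obtain ⟨b1, b2, b3, b4⟩ := hbox i
    obtain ⟨c1, c2⟩ := s.leftEnd_bounds (hξ i).1 (hξ i).2 b3
    have : 0 ≤ s.h / 4 * ξ i := mul_nonneg (by linarith) (hξ i).1
    exact ⟨by linarith, by linarith⟩
  -- A sliver is determined by its group, its row and the cell of length `e` that contains its left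
  -- end.
  have hcard := Finset.card_le_card_of_injOn (s := (Finset.univ : Finset (Fin n)))
    (t := (Finset.univ.image grp) ×ˢ (Finset.range (s.row H + 1) ×ˢ Finset.range (⌊L / s.e⌋₊ + 1)))
    (fun i => (grp i, s.row (v i 1), ⌊s.leftEnd (ξ i) (v i) / s.e⌋₊)) (by
      intro i _
      obtain ⟨b1, b2, b3, b4⟩ := hbox i
      simp only [Finset.coe_product, mem_prod, Finset.mem_coe, Finset.mem_image, Finset.mem_univ,
        true_and, Finset.mem_range, exists_apply_eq_apply]
      refine ⟨Nat.lt_succ_of_le (Nat.floor_le_floor ?_), Nat.lt_succ_of_le (Nat.floor_le_floor ?_)⟩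
      · gcongr
      · gcongr
        exact (hle i).2) (by
      intro i _ j _ hij
      by_contra hne
      simp only [Prod.mk.injEq] at hij
      obtain ⟨h1, h2, h3⟩ := hij
      have hfl : ∀ a b : ℝ, 0 ≤ a → a + s.e ≤ b → ⌊a / s.e⌋₊ ≠ ⌊b / s.e⌋₊ := by
        intro a b ha hab
        have : ⌊a / s.e⌋₊ + 1 ≤ ⌊b / s.e⌋₊ := by
          rw [← Nat.floor_add_one (by positivity)]
          apply Nat.floor_le_floor
          rw [le_div_iff₀ he, add_mul, div_mul_cancel₀ _ he.ne']
          linarith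
        omega
      rcases (hsep i j hne h1).leftEnd_separated (hbox i).2.2.1 (hbox j).2.2.1 h2 with h | h
      · exact hfl _ _ (hle i).1 h.1 h3
      · exact hfl _ _ (hle j).1 h.1 h3.symm)
  simpa [Finset.card_product] using hcard

/-- Slivers that are ordered by their slopes can be put side by side. -/
lemma disjoint_of_le {x y a b : ℝ} (hxy : x ≤ y) (hab : a + s.e ≤ b) :
    Disjoint (interior ((s.piece x).translate !₂[a, 0]))
      (interior ((s.piece y).translate !₂[b, 0])) := by
  rw [Set.disjoint_left]
  intro q h1 h2
  -- A common interior point could be moved slightly to the right within the first sliver, although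
  -- it lies on or beyond the right side of that sliver.
  have hcont : Filter.Tendsto (fun t : ℝ => q + t • (!₂[1, 0] : Plane)) (nhdsWithin 0 (Ioi 0))
      (nhds q) := by
    have : Continuous fun t : ℝ => q + t • (!₂[1, 0] : Plane) := by fun_prop
    have := this.tendsto 0
    simp only [zero_smul, add_zero] at this
    exact this.mono_left nhdsWithin_le_nhds
  obtain ⟨t, ht1, ht2⟩ := ((hcont.eventually (mem_interior_iff_mem_nhds.1 h1)).and
    self_mem_nhdsWithin).exists
  have h3 := ConvexPolygon.mem_translate.1 ht1
  have h4 := ConvexPolygon.mem_translate.1 (interior_subset h2)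
  rw [mem_piece] at h3 h4
  simp at h3 h4
  have ht2' : 0 < t := ht2
  obtain ⟨h3a, h3b, h3c, h3d⟩ := h3
  obtain ⟨h4a, h4b, h4c, h4d⟩ := h4
  nlinarith

end Sliver

/-! ### Streams of slivers and sorted packings. -/

namespace Sliver

variable (s : Sliver)

/-- The slopes of the history `l` (last item first), extended to `n` items. -/
noncomputable def slopes (n : ℕ) (l : List ℝ) (i : Fin n) : ℝ := l.reverse.getD i (1 / 2)

noncomputable def stream {n : ℕ} (ξ : Fin n → ℝ) : PieceStream n := fun i => s.piece (ξ i)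

/-- The placement of the last item of the history `l`. -/
noncomputable def place {Placement : Type} (A : OnlineRule Placement) (l : List ℝ) : Placement :=
  A (l.reverse.map s.piece)

lemma slopes_mem {n : ℕ} {l : List ℝ} (hl : ∀ y ∈ l, y ∈ Ioo (0 : ℝ) 1) (i : Fin n) :
    0 ≤ slopes n l i ∧ slopes n l i ≤ 1 := by
  unfold slopes
  rw [List.getD_eq_getElem?_getD]
  rcases h : l.reverse[(i : ℕ)]? with _ | y
  · simp; norm_num
  · have : y ∈ l.reverse := List.mem_of_getElem? h
    have := hl y (List.mem_reverse.1 this)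
    exact ⟨this.1.le, this.2.le⟩

lemma slopes_suffix {n : ℕ} {y : ℝ} {l l' : List ℝ} (hs : y :: l' <:+ l) (h : l'.length < n) :
    slopes n l ⟨l'.length, h⟩ = y := by
  obtain ⟨t, rfl⟩ := hs
  unfold slopes
  simp [List.getD_eq_getElem?_getD]

/-- Placements depend on prefixes only, so the padding in `slopes` is harmless; it makes assumptions
on streams of exactly `n` pieces available for shorter histories. -/
lemma run_stream {Placement : Type} (A : OnlineRule Placement) {n : ℕ} {y : ℝ} {l l' : List ℝ}
    (hs : y :: l' <:+ l) (h : l'.length < n) :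
    A.run (s.stream (slopes n l)) ⟨l'.length, h⟩ = s.place A (y :: l') := by
  unfold OnlineRule.run place
  congr 1
  obtain ⟨t, rfl⟩ := hs
  apply List.ext_getElem
  · simp; omega
  · intro i h1 h2
    have hi : i < l'.length + 1 := by simpa using h2
    simp only [List.getElem_take, List.getElem_ofFn, List.getElem_map, stream, slopes]
    congr 1
    rw [List.getD_eq_getElem _ _ (by simp; omega)]
    simp only [List.reverse_append]
    rw [List.getElem_append_left]

lemma mem_box {x : ℝ} (h0 : 0 ≤ x) (h1 : x ≤ 1) {p : Plane} (hp : p ∈ (s.piece x).carrier) :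
    0 ≤ p 0 ∧ p 0 ≤ s.e + s.h ∧ 0 ≤ p 1 ∧ p 1 ≤ s.h := by
  rw [mem_piece] at hp
  obtain ⟨a, b, c, d⟩ := hp
  have : x * p 1 ≤ 1 * p 1 := by gcongr
  have := mul_nonneg h0 a
  exact ⟨by linarith, by linarith, a, b⟩

lemma zero_mem_piece (x : ℝ) : (0 : Plane) ∈ (s.piece x).carrier := by
  rw [mem_piece]
  have := s.e_pos; have := s.h_pos
  refine ⟨?_, ?_, ?_, ?_⟩ <;> simp <;> linarith

lemma self_mem_translate (x : ℝ) (v : Plane) : v ∈ (s.piece x).translate v := by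
  rw [ConvexPolygon.mem_translate, sub_self]; exact s.zero_mem_piece x

lemma dist_le_add (p q : Plane) : dist p q ≤ |p 0 - q 0| + |p 1 - q 1| := by
  rw [EuclideanSpace.dist_eq, Fin.sum_univ_two, Real.dist_eq, Real.dist_eq]
  apply Real.sqrt_le_iff.2
  constructor
  · positivity
  · nlinarith [abs_nonneg (p 0 - q 0), abs_nonneg (p 1 - q 1)]

lemma diam_piece_le {x : ℝ} (h0 : 0 ≤ x) (h1 : x ≤ 1) : (s.piece x).diam ≤ s.e + 2 * s.h := by
  have he := s.e_pos; have hh := s.h_pos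
  refine Metric.diam_le_of_forall_dist_le (by linarith) fun p hp q hq => ?_
  obtain ⟨a1, a2, a3, a4⟩ := s.mem_box h0 h1 hp
  obtain ⟨b1, b2, b3, b4⟩ := s.mem_box h0 h1 hq
  have e1 : |p 0 - q 0| ≤ s.e + s.h := by rw [abs_le]; constructor <;> linarith
  have e2 : |p 1 - q 1| ≤ s.h := by rw [abs_le]; constructor <;> linarith
  linarith [dist_le_add p q]

lemma translate_bounds {x : ℝ} (h0 : 0 ≤ x) (h1 : x ≤ 1) {v p : Plane}
    (hp : p ∈ (s.piece x).translate v) :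
    v 0 ≤ p 0 ∧ p 0 ≤ v 0 + s.e + s.h ∧ v 1 ≤ p 1 ∧ p 1 ≤ v 1 + s.h := by
  have := s.mem_box h0 h1 (ConvexPolygon.mem_translate.1 hp)
  simp at this
  obtain ⟨h1, h2, h3, h4⟩ := this
  exact ⟨by linarith, by linarith, by linarith, by linarith⟩

/-- The rank of an index when the values are sorted. -/
noncomputable def rank {n : ℕ} (ξ : Fin n → ℝ) (i : Fin n) : ℕ := ((Tuple.sort ξ)⁻¹ i : Fin n)

lemma rank_lt {n : ℕ} (ξ : Fin n → ℝ) (i : Fin n) : rank ξ i < n := Fin.is_lt _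

lemma rank_injective {n : ℕ} (ξ : Fin n → ℝ) : Function.Injective (rank ξ) := by
  intro i j h
  exact ((Tuple.sort ξ)⁻¹).injective (Fin.ext h)

lemma le_of_rank_lt {n : ℕ} {ξ : Fin n → ℝ} {i j : Fin n} (h : rank ξ i < rank ξ j) :
    ξ i ≤ ξ j := by
  have := Tuple.monotone_sort ξ (show (Tuple.sort ξ)⁻¹ i ≤ (Tuple.sort ξ)⁻¹ j from h.le)
  simpa using this

/-- Slivers sorted by slope and put side by side are interior-disjoint. -/
lemma disjoint_sorted {n : ℕ} (ξ : Fin n → ℝ) {r : Fin n → ℕ} {i j : Fin n} (hij : i ≠ j)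
    (hr : rank ξ i < rank ξ j → r i < r j) (hr' : rank ξ j < rank ξ i → r j < r i) :
    Disjoint (interior ((s.piece (ξ i)).translate !₂[r i * s.e, 0]))
      (interior ((s.piece (ξ j)).translate !₂[r j * s.e, 0])) := by
  have he := s.e_pos
  have key : ∀ a b : ℕ, a < b → (a : ℝ) * s.e + s.e ≤ b * s.e := by
    intro a b hab
    have : ((a + 1 : ℕ) : ℝ) ≤ b := by exact_mod_cast hab
    push_cast at this
    nlinarith
  rcases lt_trichotomy (rank ξ i) (rank ξ j) with h | h | h
  · exact s.disjoint_of_le (le_of_rank_lt h) (key _ _ (hr h))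
  · exact absurd (rank_injective ξ h) hij
  · exact (s.disjoint_of_le (le_of_rank_lt h) (key _ _ (hr' h))).symm

end Sliver

/-! ### Consequences of a lower bound of square-root order. -/

lemma exists_quadratic_bound {a : ℝ} (ha : 1 ≤ a) : ∃ N : ℕ, ∀ n ≥ N,
    a * (1 / (2 * a) * √(Real.log n / Real.log (Real.log n)) + 1) ^ 2 ≤
      Real.log n / Real.log (Real.log n) := by
  obtain ⟨N, hN⟩ := Filter.eventually_atTop.1
    (tendsto_log_div_log_log.eventually_ge_atTop ((2 * a) ^ 2))
  refine ⟨N, fun n hn => ?_⟩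
  set y := Real.log n / Real.log (Real.log n)
  have hy := hN n hn
  have hy0 : 0 ≤ y := (sq_nonneg _).trans hy
  have h1 : 2 * a ≤ √y := Real.le_sqrt_of_sq_le hy
  have h2 : √y * √y = y := Real.mul_self_sqrt hy0
  have h3 : 1 / (2 * a) * √y + 1 ≤ √y / a := by
    rw [div_mul_eq_mul_div, one_mul, le_div_iff₀ (by linarith)]
    have : √y / (2 * a) * a = √y / 2 := by field_simp
    nlinarith
  calc a * (1 / (2 * a) * √y + 1) ^ 2 ≤ a * (√y / a) ^ 2 := by gcongr
    _ = y / a := by rw [div_pow, sq (√y), h2]; field_simp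
    _ ≤ y := div_le_self hy0 ha

namespace PackingProblem

/-- The lower bound of order `√(log n / log log n)` for instances with optimum at least `C`. -/
def SqrtLowerBound (Q : PackingProblem) (δ C : ℝ) : Prop :=
  ∃ c : ℝ, 0 < c ∧ ∃ N : ℕ, ∀ n : ℕ, N ≤ n →
    ∀ A : OnlineRule Q.Placement, Q.IsOnlineAlgorithm δ A →
      ∃ I : PieceStream n, Q.IsInstance δ I ∧ C ≤ Q.opt I ∧
        c * √(Real.log n / Real.log (Real.log n)) * Q.opt I ≤ Q.algCost A I

lemma tendsto_mul_sqrt {c : ℝ} (hc : 0 < c) :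
    Filter.Tendsto (fun n : ℕ => c * √(Real.log n / Real.log (Real.log n)))
      Filter.atTop Filter.atTop :=
  (Real.tendsto_sqrt_atTop.comp tendsto_log_div_log_log).const_mul_atTop hc

lemma not_competitive_of_sqrtLowerBound {Q : PackingProblem} {δ : ℝ}
    (h : ∀ C, Q.SqrtLowerBound δ C) (C : ℝ) :
    ¬ ∃ A : OnlineRule Q.Placement, Q.IsOnlineAlgorithm δ A ∧ Q.IsCompetitive δ C A := by
  rintro ⟨A, hA, K, hK⟩
  -- An optimum of at least 1 is positive, so that the ratios can be compared.
  obtain ⟨c, hc, N, hN⟩ := h (max C 1)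
  obtain ⟨n, hn, hnK⟩ := ((Filter.eventually_ge_atTop N).and
    ((tendsto_mul_sqrt hc).eventually_gt_atTop K)).exists
  obtain ⟨I, hI, hopt, hle⟩ := hN n hn A hA
  have h1 := hK n I hI ((le_max_left _ _).trans hopt)
  have h2 : 0 < Q.opt I := lt_of_lt_of_le one_pos ((le_max_right _ _).trans hopt)
  nlinarith

/-- Since `opt ≥ 1` and the bound tends to infinity, half of the constant absorbs `β`. -/
lemma asymptotic_of_sqrtLowerBound {Q : PackingProblem} {δ : ℝ}
    (h : Q.SqrtLowerBound δ 1) : ∃ c : ℝ, 0 < c ∧ ∀ A : OnlineRule Q.Placement,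
      Q.IsOnlineAlgorithm δ A → ∀ f : ℕ → ℝ, Q.HasAsymptoticCompetitiveRatio δ A f →
        ∃ N : ℕ, ∀ n : ℕ, N ≤ n → c * √(Real.log n / Real.log (Real.log n)) ≤ f n := by
  obtain ⟨c, hc, N, hN⟩ := h
  refine ⟨c / 2, by positivity, fun A hA f ⟨β, hβ, hf⟩ => ?_⟩
  obtain ⟨N', hN'⟩ := Filter.eventually_atTop.1
    ((tendsto_mul_sqrt (half_pos hc)).eventually_ge_atTop β)
  refine ⟨max N N', fun n hn => ?_⟩
  obtain ⟨I, hI, hopt, hle⟩ := hN n (le_trans (le_max_left _ _) hn) A hA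
  have h1 := hf n I hI
  have h2 := hN' n (le_trans (le_max_right _ _) hn)
  by_contra hcon
  rw [not_le] at hcon
  nlinarith

end PackingProblem

/-! ### Strip packing. -/

namespace Sliver

variable (s : Sliver)

lemma card_image_const_le {n : ℕ} :
    (Finset.univ.image fun _ : Fin n => ()).card ≤ 1 :=
  Finset.card_le_one.2 fun _ _ _ _ => rfl

lemma strip_bddAbove {n : ℕ} {ξ : Fin n → ℝ} (hξ : ∀ i, 0 ≤ ξ i ∧ ξ i ≤ 1) (v : Fin n → Plane) :
    BddAbove ((fun p : Plane => p 0) '' coveredRegion (s.stream ξ) v) := by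
  refine ⟨∑ i, |v i 0| + s.e + s.h, ?_⟩
  rintro _ ⟨p, hp, rfl⟩
  obtain ⟨i, hi⟩ := mem_iUnion.1 hp
  have h1 := (s.translate_bounds (hξ i).1 (hξ i).2 hi).2.1
  have h2 : |v i 0| ≤ ∑ i, |v i 0| :=
    Finset.single_le_sum (f := fun i => |v i 0|) (fun _ _ => abs_nonneg _) (Finset.mem_univ i)
  have := le_abs_self (v i 0)
  simp only
  linarith

lemma strip_bounds {n : ℕ} {ξ : Fin n → ℝ} (hξ : ∀ i, 0 ≤ ξ i ∧ ξ i ≤ 1) {v : Fin n → Plane}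
    (hv : stripPacking.Valid (s.stream ξ) v) (i : Fin n) :
    0 ≤ v i 0 ∧ v i 0 ≤ stripPacking.cost (s.stream ξ) v ∧ 0 ≤ v i 1 ∧ v i 1 ≤ 1 := by
  have hmem : v i ∈ (s.stream ξ i).translate (v i) := s.self_mem_translate _ _
  have h1 := hv.1 i hmem
  refine ⟨h1.1, ?_, h1.2.1, h1.2.2⟩
  exact le_csSup (s.strip_bddAbove hξ v) ⟨v i, mem_iUnion.2 ⟨i, hmem⟩, rfl⟩

lemma strip_cost_nonneg {n : ℕ} {I : PieceStream n} {v : Fin n → Plane}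
    (hv : stripPacking.Valid I v) : 0 ≤ stripPacking.cost I v := by
  apply Real.sSup_nonneg
  rintro _ ⟨p, hp, rfl⟩
  obtain ⟨i, hi⟩ := mem_iUnion.1 hp
  exact (hv.1 i hi).1

lemma strip_sorted_valid (hh : s.h ≤ 1) {n : ℕ} {ξ : Fin n → ℝ} (hξ : ∀ i, 0 ≤ ξ i ∧ ξ i ≤ 1) :
    stripPacking.Valid (s.stream ξ) fun i => (!₂[rank ξ i * s.e, 0] : Plane) := by
  have he := s.e_pos
  refine ⟨fun i p hp => ?_, fun i j hij => ?_⟩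
  · have h1 := s.translate_bounds (hξ i).1 (hξ i).2 hp
    simp at h1
    have : (0 : ℝ) ≤ rank ξ i * s.e := by positivity
    exact ⟨by linarith, by linarith, by linarith⟩
  · exact s.disjoint_sorted ξ (r := rank ξ) hij id id

lemma strip_opt_le (hh : s.h ≤ 1) {n : ℕ} (hn : 1 ≤ n) {ξ : Fin n → ℝ}
    (hξ : ∀ i, 0 ≤ ξ i ∧ ξ i ≤ 1) : stripPacking.opt (s.stream ξ) ≤ n * s.e + s.h := by
  have he := s.e_pos
  have hval := s.strip_sorted_valid hh hξ
  have hbdd : BddBelow {c : ℝ | ∃ v : Fin n → stripPacking.Placement,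
      stripPacking.Valid (s.stream ξ) v ∧ stripPacking.cost (s.stream ξ) v = c} := by
    refine ⟨0, ?_⟩
    rintro _ ⟨v, hv, rfl⟩
    exact strip_cost_nonneg hv
  refine (csInf_le hbdd ⟨_, hval, rfl⟩).trans ?_
  refine csSup_le ?_ ?_
  · exact ⟨_, _, mem_iUnion.2 ⟨⟨0, hn⟩, s.self_mem_translate _ _⟩, rfl⟩
  · rintro _ ⟨p, hp, rfl⟩
    obtain ⟨i, hi⟩ := mem_iUnion.1 hp
    have h1 := (s.translate_bounds (hξ i).1 (hξ i).2 hi).2.1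
    have h2 : ((rank ξ i + 1 : ℕ) : ℝ) ≤ n := by exact_mod_cast rank_lt ξ i
    push_cast at h2
    simp at h1 ⊢
    nlinarith

lemma le_strip_opt (hh : s.h ≤ 1) {n : ℕ} {ξ : Fin n → ℝ}
    (hξ : ∀ i, 0 ≤ ξ i ∧ ξ i ≤ 1) :
    n * s.e / (s.row 1 + 1) - s.e - s.h ≤ stripPacking.opt (s.stream ξ) := by
  have he := s.e_pos
  refine le_csInf ⟨_, _, s.strip_sorted_valid hh hξ, rfl⟩ ?_
  rintro _ ⟨v, hv, rfl⟩
  set X := stripPacking.cost (s.stream ξ) v with hX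
  have hX0 : 0 ≤ X := strip_cost_nonneg hv
  have h1 := s.card_le (H := 1) (L := X + s.h) ξ hξ v (fun _ => ()) (fun i => by
    obtain ⟨b1, b2, b3, b4⟩ := s.strip_bounds hξ hv i
    exact ⟨b1, by linarith, b3, b4⟩) (fun i j hij _ => apart_of_disjoint (hv.2 i j hij))
  have hhp := s.h_pos
  have h2 : n ≤ (s.row 1 + 1) * (⌊(X + s.h) / s.e⌋₊ + 1) :=
    h1.trans ((Nat.mul_le_mul_right _ card_image_const_le).trans (one_mul _).le)
  have h3 : (n : ℝ) ≤ (s.row 1 + 1) * ((X + s.h) / s.e + 1) := by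
    have h4 := Nat.floor_le (show 0 ≤ (X + s.h) / s.e by positivity)
    calc (n : ℝ) ≤ (((s.row 1 + 1) * (⌊(X + s.h) / s.e⌋₊ + 1) : ℕ) : ℝ) := by exact_mod_cast h2
      _ = (s.row 1 + 1) * ((⌊(X + s.h) / s.e⌋₊ : ℝ) + 1) := by push_cast; rfl
      _ ≤ _ := by gcongr
  have h5 : n * s.e / (s.row 1 + 1) ≤ X + s.h + s.e := by
    rw [div_le_iff₀ (by positivity)]
    have := mul_le_mul_of_nonneg_right h3 he.le
    have e : (s.row 1 + 1 : ℝ) * ((X + s.h) / s.e + 1) * s.e = (X + s.h + s.e) * (s.row 1 + 1) := by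
      field_simp
    linarith
  linarith

/-- If a strip packing algorithm uses length at most `X` on all slivers, it gives row placements. -/
lemma strip_rowPlacement {δ : ℝ} {A : OnlineRule Plane}
    (hA : stripPacking.IsOnlineAlgorithm δ A) {n : ℕ}
    (hinst : ∀ ξ : Fin n → ℝ, (∀ i, 0 ≤ ξ i ∧ ξ i ≤ 1) → stripPacking.IsInstance δ (s.stream ξ))
    {X : ℝ} (hX : 0 ≤ X) (hcost : ∀ ξ : Fin n → ℝ, (∀ i, 0 ≤ ξ i ∧ ξ i ≤ 1) →
      stripPacking.algCost A (s.stream ξ) ≤ X) :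
    Nonempty (RowPlacement n (1 * (s.row 1 + 1)) s.e (s.h / 4) (X + s.h)) := by
  have hhp := s.h_pos
  refine ⟨s.rowPlacement (H := 1) (by linarith) (s.place A) (fun _ => 0)
    (fun _ _ _ => one_pos) ?_ ?_⟩
  · intro x l hl
    have hξ := slopes_mem (n := n) hl.2
    have hlen : l.length < n := hl.1
    have hb := s.strip_bounds hξ (hA n _ (hinst _ hξ)) ⟨l.length, hlen⟩
    have hc := hcost _ hξ
    unfold PackingProblem.algCost at hc
    rw [← s.run_stream A (List.suffix_refl (x :: l)) hlen]
    have hb2 := hb.2.1.trans hc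
    exact ⟨hb.1, add_le_add_left hb2 s.h, hb.2.2⟩
  · intro x l y l' hl hs _
    have hξ := slopes_mem (n := n) hl.2
    have hlen : l.length < n := hl.1
    have hlen' : l'.length < l.length := hs.length_le
    have hd := (hA n _ (hinst _ hξ)).2 ⟨l.length, hlen⟩ ⟨l'.length, hlen'.trans hlen⟩
      (by simp; omega)
    have hs' : y :: l' <:+ x :: l := hs.trans (List.suffix_cons x l)
    have h1 := apart_of_disjoint hd
    rw [slopes_suffix (List.suffix_refl (x :: l)), slopes_suffix hs'] at h1
    rw [← s.run_stream A (List.suffix_refl (x :: l)) hlen,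
      ← s.run_stream A hs' (hlen'.trans hlen)]
    exact h1

end Sliver

/-- As `n * e = W`, both factors in `RowPlacement.exists_lower_bound` are linear in `X + 1` once the
total row length is. All four problems use this estimate. -/
lemma row_placement_bound {M n : ℕ} {e h L W X a : ℝ} {k : ℝ} (hW : 0 < W) (hh : 0 < h)
    (hn : 1 ≤ n) (he : e = W / n) (hX : 0 ≤ X) (hL0 : 0 ≤ L) (hk : 0 ≤ k)
    (hM : (M : ℝ) * (L + 1) ≤ k * (X + 1))
    (ha : a = 5376 * (k * (8 / h + 2) + 1) * (k / W + 2 * k + 1)) :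
    5376 * (M * (2 * L / (h / 4) + 2) + 1) * (M * (L / e + 2) / n + 1) ≤ a * (X + 1) ^ 2 := by
  have hn0 : (1 : ℝ) ≤ n := by exact_mod_cast hn
  have hM0 : (0 : ℝ) ≤ M := by positivity
  have hML : M * L ≤ k * (X + 1) := by nlinarith
  have h1 : M * (2 * L / (h / 4) + 2) + 1 ≤ (k * (8 / h + 2) + 1) * (X + 1) := by
    have e1 : M * (2 * L / (h / 4) + 2) = M * L * (8 / h) + M * 2 := by field_simp; ring
    have e2 : M * L * (8 / h) ≤ k * (X + 1) * (8 / h) :=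
      mul_le_mul_of_nonneg_right hML (by positivity)
    have e3 : (M : ℝ) * 2 ≤ k * (X + 1) * 2 := by nlinarith
    rw [e1]; nlinarith
  have h2 : M * (L / e + 2) / n + 1 ≤ (k / W + 2 * k + 1) * (X + 1) := by
    have e1 : M * (L / e + 2) / n = M * L / W + M * 2 / n := by
      rw [he]; field_simp
    have e2 : M * L / W ≤ k * (X + 1) / W :=
      div_le_div_of_nonneg_right hML hW.le
    have e3 : (M : ℝ) * 2 / n ≤ k * (X + 1) * 2 := by
      rw [div_le_iff₀ (by linarith)]
      have h4 : (M : ℝ) * 2 ≤ k * (X + 1) * 2 := by nlinarith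
      have h5 : (0 : ℝ) ≤ k * (X + 1) * 2 := by positivity
      nlinarith
    have e4 : (k / W + 2 * k + 1) * (X + 1) = k * (X + 1) / W + k * (X + 1) * 2 + (X + 1) := by
      field_simp
    rw [e1, e4]; linarith
  have h3 : 0 ≤ M * (L / e + 2) / n + 1 := by
    have : 0 < e := by rw [he]; positivity
    positivity
  calc 5376 * (M * (2 * L / (h / 4) + 2) + 1) * (M * (L / e + 2) / n + 1)
      ≤ 5376 * ((k * (8 / h + 2) + 1) * (X + 1)) * ((k / W + 2 * k + 1) * (X + 1)) := by
        gcongr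
    _ = a * (X + 1) ^ 2 := by rw [ha]; ring

lemma exists_threshold {a W h : ℝ} (ha : 1 ≤ a) (hh : 0 < h) : ∃ N : ℕ, 1 ≤ N ∧ ∀ n ≥ N,
    W ≤ h * n ∧
    (∀ (m : ℕ) (e η L : ℝ), RowPlacement n m e η L →
      Real.log n / Real.log (Real.log n) <
        5376 * (m * (2 * L / η + 2) + 1) * (m * (L / e + 2) / n + 1)) ∧
    a * (1 / (2 * a) * √(Real.log n / Real.log (Real.log n)) + 1) ^ 2 ≤
      Real.log n / Real.log (Real.log n) := by
  obtain ⟨N₀, h0, hN₀⟩ := RowPlacement.exists_lower_bound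
  obtain ⟨N₁, hN₁⟩ := exists_quadratic_bound ha
  obtain ⟨N₂, hN₂⟩ := exists_nat_ge (W / h)
  refine ⟨max N₀ (max N₁ N₂), h0.trans (le_max_left _ _), fun n hn => ⟨?_, hN₀ n ?_, hN₁ n ?_⟩⟩
  · have : (N₂ : ℝ) ≤ n := by
      exact_mod_cast (le_max_right N₁ N₂).trans ((le_max_right N₀ _).trans hn)
    have := hN₂.trans this
    rw [div_le_iff₀ hh] at this
    linarith
  · exact (le_max_left _ _).trans hn
  · exact (le_max_left N₁ N₂).trans ((le_max_right N₀ _).trans hn)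

lemma Sliver.strip_isInstance {s : Sliver} {δ : ℝ} (hh : s.h ≤ 1) (hδ : s.e + 2 * s.h ≤ δ) {n : ℕ}
    {ξ : Fin n → ℝ} (hξ : ∀ i, 0 ≤ ξ i ∧ ξ i ≤ 1) : stripPacking.IsInstance δ (s.stream ξ) := by
  refine fun i => ⟨⟨0, fun p hp => ?_⟩, (s.diam_piece_le (hξ i).1 (hξ i).2).trans hδ⟩
  have := s.translate_bounds (hξ i).1 (hξ i).2 hp
  simp at this
  exact ⟨this.1, this.2.2.1, this.2.2.2.trans hh⟩

lemma exists_sliver_height {δ : ℝ} (hδ : 0 < δ) : ∃ h : ℝ, 0 < h ∧ h ≤ 1 / 8 ∧ 3 * h ≤ δ :=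
  ⟨min δ 1 / 8, by positivity, by linarith [min_le_right δ 1], by linarith [min_le_left δ 1]⟩

theorem strip_sqrtLowerBound {δ : ℝ} (hδ : 0 < δ) (C : ℝ) : stripPacking.SqrtLowerBound δ C := by
  obtain ⟨h, h0, h1, h2⟩ := exists_sliver_height hδ
  set m : ℕ := ⌊4 * 1 / h⌋₊ + 1 with hm
  have hm1 : (1 : ℝ) ≤ m := by rw [hm]; push_cast; linarith [(⌊4 * 1 / h⌋₊ : ℕ).cast_nonneg (α := ℝ)]
  -- `le_strip_opt` gives the optimum at least `W / m - e - h`, where `e + h ≤ 2`.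
  set W : ℝ := m * (|C| + 2) with hW
  have hW0 : 0 < W := by positivity
  set k : ℝ := 2 * m with hk
  set a : ℝ := 5376 * (k * (8 / h + 2) + 1) * (k / W + 2 * k + 1) with ha
  have ha1 : 1 ≤ a := by
    have e1 : 0 ≤ k * (8 / h + 2) := by positivity
    have e2 : 0 ≤ k / W + 2 * k := by positivity
    rw [ha]; nlinarith
  obtain ⟨N, hN1, hN⟩ := exists_threshold (W := W) (h := h) ha1 h0
  -- `1 / (2 * a)` comes from `exists_quadratic_bound`, and `W + 1` bounds the optimum from above.
  refine ⟨1 / (2 * a) / (W + 1), by positivity, N, fun n hn A hA => ?_⟩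
  obtain ⟨hWn, hrow, hquad⟩ := hN n hn
  have hn1 : 1 ≤ n := hN1.trans hn
  have hn0 : (0 : ℝ) < n := by positivity
  set s : Sliver := ⟨W / n, h, by positivity, h0⟩ with hs
  have hse : s.e ≤ h := by
    show W / n ≤ h
    rw [div_le_iff₀ hn0]; exact hWn
  have hne : n * s.e = W := by show n * (W / n) = W; field_simp
  have hsh : s.h = h := rfl
  have hrow1 : (s.row 1 : ℝ) + 1 = m := by rw [hm]; push_cast; rfl
  by_contra hcon
  push Not at hcon
  have hinst : ∀ ξ : Fin n → ℝ, (∀ i, 0 ≤ ξ i ∧ ξ i ≤ 1) →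
      stripPacking.IsInstance δ (s.stream ξ) := fun ξ hξ =>
    Sliver.strip_isInstance (by linarith) (by linarith) hξ
  set y := Real.log n / Real.log (Real.log n) with hy
  obtain ⟨P⟩ := s.strip_rowPlacement hA hinst (X := 1 / (2 * a) * √y) (by positivity) (by
    intro ξ hξ
    have hopt1 : C ≤ stripPacking.opt (s.stream ξ) := by
      refine le_trans ?_ (s.le_strip_opt (by linarith) hξ)
      rw [hne, hrow1, hW, mul_div_cancel_left₀ _ (by positivity)]
      linarith [le_abs_self C]
    have hopt2 : stripPacking.opt (s.stream ξ) ≤ W + 1 := by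
      refine (s.strip_opt_le (by linarith) hn1 hξ).trans ?_
      rw [hne]; linarith
    refine (hcon _ (hinst ξ hξ) hopt1).le.trans ?_
    calc 1 / (2 * a) / (W + 1) * √y * stripPacking.opt (s.stream ξ)
        ≤ 1 / (2 * a) / (W + 1) * √y * (W + 1) := by gcongr
      _ = 1 / (2 * a) * √y := by field_simp)
  have h3 := hrow _ _ _ _ P
  have h4 := row_placement_bound (M := 1 * (s.row 1 + 1)) (n := n) (e := s.e) (h := h)
    (L := 1 / (2 * a) * √y + s.h) (W := W) (X := 1 / (2 * a) * √y) (k := k) hW0 h0 hn1 rfl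
    (by positivity) (by have := s.h_pos; positivity) (by positivity) (by
      push_cast
      rw [one_mul, hrow1, hk, hsh]
      have : 0 ≤ 1 / (2 * a) * √y := by positivity
      nlinarith) ha
  exact absurd (h3.trans_le (h4.trans hquad)) (lt_irrefl _)

/-! ### Bin packing. -/

namespace Sliver

variable (s : Sliver)

/-- The bins of the items of the history `l`. -/
noncomputable def bins (A : OnlineRule (ℕ × Plane)) : List ℝ → List ℕ
  | [] => []
  | x :: l => (s.place A (x :: l)).1 :: bins A l

/-- The bins used on the history `l`, in the order of their first use. -/
noncomputable def usedBins (A : OnlineRule (ℕ × Plane)) (l : List ℝ) : List ℕ :=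
  (s.bins A l).dedup.reverse

lemma bins_suffix {A : OnlineRule (ℕ × Plane)} {l l' : List ℝ} (h : l' <:+ l) :
    s.bins A l' <:+ s.bins A l := by
  obtain ⟨t, rfl⟩ := h
  induction t with
  | nil => exact List.suffix_rfl
  | cons x t ih => exact ih.trans (List.suffix_cons _ _)

lemma dedup_suffix {l l' : List ℕ} (h : l' <:+ l) : l'.dedup <:+ l.dedup := by
  obtain ⟨t, rfl⟩ := h
  induction t with
  | nil => exact List.suffix_rfl
  | cons x t ih =>
    rw [List.cons_append]
    by_cases hx : x ∈ t ++ l'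
    · rwa [List.dedup_cons_of_mem hx]
    · rw [List.dedup_cons_of_notMem hx]
      exact ih.trans (List.suffix_cons _ _)

lemma usedBins_prefix {A : OnlineRule (ℕ × Plane)} {l l' : List ℝ} (h : l' <:+ l) :
    s.usedBins A l' <+: s.usedBins A l :=
  List.reverse_prefix.2 (dedup_suffix (s.bins_suffix h))

lemma mem_usedBins (A : OnlineRule (ℕ × Plane)) (x : ℝ) (l : List ℝ) :
    (s.place A (x :: l)).1 ∈ s.usedBins A (x :: l) := by
  simp [usedBins, bins]

lemma mem_bins {A : OnlineRule (ℕ × Plane)} {l : List ℝ} {b : ℕ} (h : b ∈ s.bins A l) :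
    ∃ y l', y :: l' <:+ l ∧ b = (s.place A (y :: l')).1 := by
  induction l with
  | nil => simp [bins] at h
  | cons x l ih =>
    rcases List.mem_cons.1 h with rfl | h
    · exact ⟨x, l, List.suffix_rfl, rfl⟩
    · obtain ⟨y, l', h1, h2⟩ := ih h
      exact ⟨y, l', h1.trans (List.suffix_cons _ _), h2⟩

/-- The number of the bin of the last item of `l`, in the order of first use. -/
noncomputable def binIndex (A : OnlineRule (ℕ × Plane)) (l : List ℝ) : ℕ :=
  (s.usedBins A l).idxOf (s.place A l).1

/-- Later items only append to the list of used bins, so the numbers by first use are stable. Unlike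
the labels of the bins, they are bounded by the cost. -/
lemma bin_eq_of_binIndex_eq {A : OnlineRule (ℕ × Plane)} {x y : ℝ} {l l' : List ℝ}
    (hs : y :: l' <:+ x :: l) (h : s.binIndex A (x :: l) = s.binIndex A (y :: l')) :
    (s.place A (x :: l)).1 = (s.place A (y :: l')).1 := by
  unfold binIndex at h
  obtain ⟨t, ht⟩ := s.usedBins_prefix (A := A) hs
  rw [← List.idxOf_append_of_mem (l₂ := t) (s.mem_usedBins A y l'), ht] at h
  exact (List.idxOf_inj (s.mem_usedBins A x l)).1 h

lemma binIndex_lt {A : OnlineRule (ℕ × Plane)} {n : ℕ} {x : ℝ} {l : List ℝ}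
    (h : (x :: l).length ≤ n) {X : ℝ}
    (hX : binPacking.algCost A (s.stream (slopes n (x :: l))) ≤ X) :
    s.binIndex A (x :: l) < ⌊X⌋₊ + 1 := by
  have h1 : s.binIndex A (x :: l) < (s.usedBins A (x :: l)).length :=
    List.idxOf_lt_length_iff.2 (s.mem_usedBins A x l)
  have h2 : (s.usedBins A (x :: l)).length ≤ (Finset.univ.image fun i : Fin n =>
      (A.run (s.stream (slopes n (x :: l))) i).1).card := by
    unfold usedBins
    rw [List.length_reverse, ← List.card_toFinset]
    apply Finset.card_le_card
    intro b hb
    obtain ⟨y, l', h1, rfl⟩ := s.mem_bins (List.mem_toFinset.1 hb)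
    have hlen : l'.length < n := lt_of_lt_of_le h1.length_le h
    exact Finset.mem_image.2 ⟨⟨l'.length, hlen⟩, Finset.mem_univ _, by rw [s.run_stream A h1]⟩
  have h3 : (Finset.univ.image fun i : Fin n =>
      (A.run (s.stream (slopes n (x :: l))) i).1).card ≤ ⌊X⌋₊ := Nat.le_floor hX
  omega

lemma bin_rowPlacement {δ : ℝ} {A : OnlineRule (ℕ × Plane)}
    (hA : binPacking.IsOnlineAlgorithm δ A) {n : ℕ}
    (hinst : ∀ ξ : Fin n → ℝ, (∀ i, 0 ≤ ξ i ∧ ξ i ≤ 1) → binPacking.IsInstance δ (s.stream ξ))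
    {X : ℝ} (hcost : ∀ ξ : Fin n → ℝ, (∀ i, 0 ≤ ξ i ∧ ξ i ≤ 1) →
      binPacking.algCost A (s.stream ξ) ≤ X) :
    Nonempty (RowPlacement n ((⌊X⌋₊ + 1) * (s.row 1 + 1)) s.e (s.h / 4) (1 + s.h)) := by
  have hhp := s.h_pos
  refine ⟨s.rowPlacement (H := 1) (by linarith) (fun l => (s.place A l).2) (s.binIndex A)
    (fun x l hl => s.binIndex_lt hl.1 (hcost _ (slopes_mem hl.2))) ?_ ?_⟩
  · intro x l hl
    have hξ := slopes_mem (n := n) hl.2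
    have hlen : l.length < n := hl.1
    have hb := (hA n _ (hinst _ hξ)).1 ⟨l.length, hlen⟩ (s.self_mem_translate _ _)
    simp only
    rw [← s.run_stream A (List.suffix_refl (x :: l)) hlen]
    have hb2 := hb.2.1
    exact ⟨hb.1, add_le_add_left hb2 s.h, hb.2.2⟩
  · intro x l y l' hl hs hbin
    have hξ := slopes_mem (n := n) hl.2
    have hlen : l.length < n := hl.1
    have hlen' : l'.length < l.length := hs.length_le
    have hs' : y :: l' <:+ x :: l := hs.trans (List.suffix_cons x l)
    have hbin' := s.bin_eq_of_binIndex_eq hs' hbin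
    rw [← s.run_stream A (List.suffix_refl (x :: l)) hlen,
      ← s.run_stream A hs' (hlen'.trans hlen)] at hbin' ⊢
    have hd := (hA n _ (hinst _ hξ)).2 ⟨l.length, hlen⟩ ⟨l'.length, hlen'.trans hlen⟩
      (by simp; omega) hbin'
    have h1 := apart_of_disjoint hd
    rw [slopes_suffix (List.suffix_refl (x :: l)), slopes_suffix hs'] at h1
    exact h1

lemma bin_sorted_valid (hh : s.h ≤ 1 / 8) (he : s.e ≤ 1 / 8) {n : ℕ} {ξ : Fin n → ℝ}
    (hξ : ∀ i, 0 ≤ ξ i ∧ ξ i ≤ 1) :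
    binPacking.Valid (s.stream ξ) fun i => ((rank ξ i / ⌊(1 - s.h) / s.e⌋₊,
      (!₂[(rank ξ i % ⌊(1 - s.h) / s.e⌋₊ : ℕ) * s.e, 0] : Plane)) : ℕ × Plane) := by
  have he0 := s.e_pos
  set q := ⌊(1 - s.h) / s.e⌋₊ with hq
  have hq1 : 1 ≤ q := by
    rw [hq, Nat.one_le_floor_iff, le_div_iff₀ he0]; linarith
  have hqe : q * s.e ≤ 1 - s.h := by
    rw [← le_div_iff₀ he0]
    exact Nat.floor_le (div_nonneg (by linarith) he0.le)
  refine ⟨fun i p hp => ?_, fun i j hij hb => ?_⟩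
  · have h1 := s.translate_bounds (hξ i).1 (hξ i).2 hp
    have h2 : (((rank ξ i % q : ℕ) + 1 : ℕ) : ℝ) ≤ q := by exact_mod_cast Nat.mod_lt _ hq1
    push_cast at h2
    simp at h1
    obtain ⟨a1, a2, a3, a4⟩ := h1
    have : (0 : ℝ) ≤ (rank ξ i % q : ℕ) * s.e := by positivity
    have h3 : ((rank ξ i % q : ℕ) : ℝ) * s.e + s.e ≤ q * s.e := by nlinarith
    push_cast at *
    exact ⟨by linarith, by linarith, by linarith, by linarith⟩
  · have h1 := Nat.div_add_mod (rank ξ i) q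
    have h2 := Nat.div_add_mod (rank ξ j) q
    simp only at hb
    rw [← hb] at h2
    exact s.disjoint_sorted ξ (r := fun i => rank ξ i % q) hij (fun h => by omega)
      (fun h => by omega)

lemma bin_opt_le (hh : s.h ≤ 1 / 8) (he : s.e ≤ 1 / 8) {n : ℕ} {ξ : Fin n → ℝ}
    (hξ : ∀ i, 0 ≤ ξ i ∧ ξ i ≤ 1) : binPacking.opt (s.stream ξ) ≤ 2 * (n * s.e) + 1 := by
  have he0 := s.e_pos
  have hval := s.bin_sorted_valid hh he hξ
  have hbdd : BddBelow {c : ℝ | ∃ v : Fin n → binPacking.Placement,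
      binPacking.Valid (s.stream ξ) v ∧ binPacking.cost (s.stream ξ) v = c} := by
    refine ⟨0, ?_⟩
    rintro _ ⟨v, hv, rfl⟩
    exact Nat.cast_nonneg _
  refine (csInf_le hbdd ⟨_, hval, rfl⟩).trans ?_
  set q := ⌊(1 - s.h) / s.e⌋₊ with hq
  have hq2 : 1 / 2 ≤ q * s.e := by
    have h1 := Nat.lt_floor_add_one ((1 - s.h) / s.e)
    rw [div_lt_iff₀ he0] at h1
    nlinarith
  have hq0 : (0 : ℝ) < q := by
    by_contra hcon
    have : (q : ℝ) = 0 := le_antisymm (not_lt.1 hcon) (Nat.cast_nonneg _)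
    rw [this] at hq2; linarith
  have h1 : (Finset.univ.image fun i : Fin n => rank ξ i / q).card ≤ n / q + 1 := by
    rw [← Finset.card_range (n / q + 1)]
    apply Finset.card_le_card
    intro b hb
    obtain ⟨i, -, rfl⟩ := Finset.mem_image.1 hb
    exact Finset.mem_range.2 (Nat.lt_succ_of_le (Nat.div_le_div_right (rank_lt ξ i).le))
  calc (((Finset.univ.image fun i : Fin n => rank ξ i / q).card : ℕ) : ℝ)
      ≤ ((n / q + 1 : ℕ) : ℝ) := by exact_mod_cast h1
    _ ≤ n / q + 1 := by push_cast; gcongr; exact Nat.cast_div_le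
    _ ≤ 2 * (n * s.e) + 1 := by
      gcongr
      rw [div_le_iff₀ hq0]
      have : (0 : ℝ) ≤ n := by positivity
      nlinarith

lemma le_bin_opt (hh : s.h ≤ 1 / 8) (he : s.e ≤ 1 / 8) {n : ℕ} {ξ : Fin n → ℝ}
    (hξ : ∀ i, 0 ≤ ξ i ∧ ξ i ≤ 1) :
    n * s.e / (2 * (s.row 1 + 1)) ≤ binPacking.opt (s.stream ξ) := by
  have he0 := s.e_pos
  have hhp := s.h_pos
  refine le_csInf ⟨_, _, s.bin_sorted_valid hh he hξ, rfl⟩ ?_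
  rintro _ ⟨v, hv, rfl⟩
  have h1 := s.card_le (H := 1) (L := 1 + s.h) ξ hξ (fun i => (v i).2) (fun i => (v i).1)
    (fun i => by
      have hb := hv.1 i (s.self_mem_translate _ _)
      have hb2 := hb.2.1
      exact ⟨hb.1, add_le_add_left hb2 s.h, hb.2.2⟩)
    (fun i j hij hb => apart_of_disjoint (hv.2 i j hij hb))
  show _ ≤ (((Finset.univ.image fun i : Fin n => (v i).1).card : ℕ) : ℝ)
  set X := (Finset.univ.image fun i : Fin n => (v i).1).card
  have h3 : (n : ℝ) ≤ X * ((s.row 1 + 1) * ((1 + s.h) / s.e + 1)) := by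
    have h4 := Nat.floor_le (show 0 ≤ (1 + s.h) / s.e by positivity)
    calc (n : ℝ) ≤ ((X * ((s.row 1 + 1) * (⌊(1 + s.h) / s.e⌋₊ + 1)) : ℕ) : ℝ) := by
          exact_mod_cast h1
      _ = X * ((s.row 1 + 1) * ((⌊(1 + s.h) / s.e⌋₊ : ℝ) + 1)) := by push_cast; rfl
      _ ≤ _ := by gcongr
  rw [div_le_iff₀ (by positivity)]
  have h5 := mul_le_mul_of_nonneg_right h3 he0.le
  have e : X * ((s.row 1 + 1 : ℝ) * ((1 + s.h) / s.e + 1)) * s.e =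
      X * (s.row 1 + 1) * (1 + s.h + s.e) := by field_simp
  have h6 : (X : ℝ) * (s.row 1 + 1) * (1 + s.h + s.e) ≤ X * (s.row 1 + 1) * 2 := by
    gcongr; linarith
  linarith

lemma bin_isInstance {δ : ℝ} (hh : s.h ≤ 1 / 8) (he : s.e ≤ 1 / 8) (hδ : s.e + 2 * s.h ≤ δ) {n : ℕ}
    {ξ : Fin n → ℝ} (hξ : ∀ i, 0 ≤ ξ i ∧ ξ i ≤ 1) : binPacking.IsInstance δ (s.stream ξ) := by
  refine fun i => ⟨⟨0, fun p hp => ?_⟩, (s.diam_piece_le (hξ i).1 (hξ i).2).trans hδ⟩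
  have := s.translate_bounds (hξ i).1 (hξ i).2 hp
  simp at this
  exact ⟨this.1, by linarith, this.2.2.1, by linarith⟩

end Sliver

theorem bin_sqrtLowerBound {δ : ℝ} (hδ : 0 < δ) (C : ℝ) : binPacking.SqrtLowerBound δ C := by
  obtain ⟨h, h0, h1, h2⟩ := exists_sliver_height hδ
  set m : ℕ := ⌊4 * 1 / h⌋₊ + 1 with hm
  have hm1 : (1 : ℝ) ≤ m := by rw [hm]; push_cast; linarith [(⌊4 * 1 / h⌋₊ : ℕ).cast_nonneg (α := ℝ)]
  set W : ℝ := 2 * m * (|C| + 1) with hW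
  have hW0 : 0 < W := by positivity
  set k : ℝ := 3 * m with hk
  set a : ℝ := 5376 * (k * (8 / h + 2) + 1) * (k / W + 2 * k + 1) with ha
  have ha1 : 1 ≤ a := by
    have e1 : 0 ≤ k * (8 / h + 2) := by positivity
    have e2 : 0 ≤ k / W + 2 * k := by positivity
    rw [ha]; nlinarith
  obtain ⟨N, hN1, hN⟩ := exists_threshold (W := W) (h := h) ha1 h0
  refine ⟨1 / (2 * a) / (2 * W + 1), by positivity, N, fun n hn A hA => ?_⟩
  obtain ⟨hWn, hrow, hquad⟩ := hN n hn
  have hn1 : 1 ≤ n := hN1.trans hn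
  have hn0 : (0 : ℝ) < n := by positivity
  set s : Sliver := ⟨W / n, h, by positivity, h0⟩ with hs
  have hse : s.e ≤ h := by
    show W / n ≤ h
    rw [div_le_iff₀ hn0]; exact hWn
  have hne : n * s.e = W := by show n * (W / n) = W; field_simp
  have hsh : s.h = h := rfl
  have hrow1 : (s.row 1 : ℝ) + 1 = m := by rw [hm]; push_cast; rfl
  by_contra hcon
  push Not at hcon
  have hinst : ∀ ξ : Fin n → ℝ, (∀ i, 0 ≤ ξ i ∧ ξ i ≤ 1) →
      binPacking.IsInstance δ (s.stream ξ) := fun ξ hξ =>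
    s.bin_isInstance (by linarith) (by linarith) (by linarith) hξ
  set y := Real.log n / Real.log (Real.log n) with hy
  obtain ⟨P⟩ := s.bin_rowPlacement hA hinst (X := 1 / (2 * a) * √y) (by
    intro ξ hξ
    have hopt1 : C ≤ binPacking.opt (s.stream ξ) := by
      refine le_trans ?_ (s.le_bin_opt (by linarith) (by linarith) hξ)
      rw [hne, hrow1, hW, mul_div_cancel_left₀ _ (by positivity)]
      linarith [le_abs_self C]
    have hopt2 : binPacking.opt (s.stream ξ) ≤ 2 * W + 1 := by
      refine (s.bin_opt_le (by linarith) (by linarith) hξ).trans ?_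
      rw [hne]
    refine (hcon _ (hinst ξ hξ) hopt1).le.trans ?_
    calc 1 / (2 * a) / (2 * W + 1) * √y * binPacking.opt (s.stream ξ)
        ≤ 1 / (2 * a) / (2 * W + 1) * √y * (2 * W + 1) := by gcongr
      _ = 1 / (2 * a) * √y := by field_simp)
  have h3 := hrow _ _ _ _ P
  -- Here the number of rows grows with the cost, and their length is constant.
  have h4 := row_placement_bound (M := (⌊1 / (2 * a) * √y⌋₊ + 1) * (s.row 1 + 1)) (n := n)
    (e := s.e) (h := h) (L := 1 + s.h) (W := W) (X := 1 / (2 * a) * √y) (k := k) hW0 h0 hn1 rfl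
    (by positivity) (by have := s.h_pos; positivity) (by positivity) (by
      push_cast
      rw [hrow1, hk, hsh]
      have := Nat.floor_le (show 0 ≤ 1 / (2 * a) * √y by positivity)
      calc ((⌊1 / (2 * a) * √y⌋₊ : ℝ) + 1) * m * (1 + h + 1)
          ≤ (1 / (2 * a) * √y + 1) * m * 3 := by gcongr; linarith
        _ = _ := by ring) ha
  exact absurd (h3.trans_le (h4.trans hquad)) (lt_irrefl _)

/-! ### Square packing. -/

namespace ConvexPolygon

lemma isCompact_carrier (P : ConvexPolygon) : IsCompact P.carrier := by
  obtain ⟨V, hV⟩ := P.exists_vertices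
  rw [hV]
  exact V.finite_toSet.isCompact_convexHull ℝ

lemma area_pos (P : ConvexPolygon) : 0 < P.area := by
  refine ENNReal.toReal_pos ?_ P.isCompact_carrier.measure_lt_top.ne
  exact (Measure.measure_pos_of_nonempty_interior _ P.interior_nonempty).ne'

end ConvexPolygon

namespace Sliver

variable (s : Sliver)

/-- The sliver is the image of a rectangle under a shear of determinant 1. -/
lemma area_piece (x : ℝ) : (s.piece x).area = s.e * s.h := by
  have he := s.e_pos; have hh := s.h_pos
  unfold ConvexPolygon.area
  have hmeas : MeasurableSet (s.piece x).carrier := (s.piece x).isCompact_carrier.measurableSet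
  have h1 := (PiLp.volume_preserving_toLp (Fin 2)).measure_preimage hmeas.nullMeasurableSet
  have h2 : WithLp.toLp 2 ⁻¹' (s.piece x).carrier =
      Matrix.toLin' !![1, x; 0, 1] '' Icc ![0, 0] ![s.e, s.h] := by
    ext p
    rw [mem_preimage, mem_piece]
    constructor
    · rintro ⟨a1, a2, a3, a4⟩
      simp only at a1 a2 a3 a4
      refine ⟨![p 0 - x * p 1, p 1], ?_, ?_⟩
      · rw [mem_Icc, Pi.le_def, Pi.le_def, Fin.forall_fin_two, Fin.forall_fin_two]
        simp
        exact ⟨⟨a3, a1⟩, by linarith, a2⟩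
      · ext i
        fin_cases i <;> simp [Matrix.mulVec, dotProduct, Fin.sum_univ_two]
    · rintro ⟨q, hq, rfl⟩
      rw [mem_Icc, Pi.le_def, Pi.le_def, Fin.forall_fin_two, Fin.forall_fin_two] at hq
      simp at hq
      obtain ⟨⟨a1, a2⟩, a3, a4⟩ := hq
      simp [Matrix.mulVec, dotProduct, Fin.sum_univ_two]
      exact ⟨a2, a4, a1, by linarith⟩
  rw [← h1, h2, Measure.addHaar_image_linearMap, LinearMap.det_toLin', Real.volume_Icc_pi]
  simp [Matrix.det_fin_two, Fin.prod_univ_two, he.le, hh.le]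

lemma square_rowPlacement {A : OnlineRule Plane} {n : ℕ}
    (hA : ∀ ξ : Fin n → ℝ, (∀ i, 0 ≤ ξ i ∧ ξ i ≤ 1) →
      IsPackingIn unitSquare (s.stream ξ) (A.run (s.stream ξ))) :
    Nonempty (RowPlacement n (1 * (s.row 1 + 1)) s.e (s.h / 4) (1 + s.h)) := by
  have hhp := s.h_pos
  refine ⟨s.rowPlacement (H := 1) (by linarith) (s.place A) (fun _ => 0)
    (fun _ _ _ => one_pos) ?_ ?_⟩
  · intro x l hl
    have hξ := slopes_mem (n := n) hl.2
    have hlen : l.length < n := hl.1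
    have hb := (hA _ hξ).1 ⟨l.length, hlen⟩ (s.self_mem_translate _ _)
    rw [← s.run_stream A (List.suffix_refl (x :: l)) hlen]
    have hb2 := hb.2.1
    exact ⟨hb.1, add_le_add_left hb2 s.h, hb.2.2⟩
  · intro x l y l' hl hs _
    have hξ := slopes_mem (n := n) hl.2
    have hlen : l.length < n := hl.1
    have hlen' : l'.length < l.length := hs.length_le
    have hs' : y :: l' <:+ x :: l := hs.trans (List.suffix_cons x l)
    have hd := (hA _ hξ).2 ⟨l.length, hlen⟩ ⟨l'.length, hlen'.trans hlen⟩
      (by simp; omega)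
    have h1 := apart_of_disjoint hd
    rw [slopes_suffix (List.suffix_refl (x :: l)), slopes_suffix hs'] at h1
    rw [← s.run_stream A (List.suffix_refl (x :: l)) hlen,
      ← s.run_stream A hs' (hlen'.trans hlen)]
    exact h1

end Sliver

/-- Streams of small total area that are not packed into the unit square. -/
theorem square_lower_bound {δ : ℝ} (hδ : 0 < δ) : ∃ N : ℕ, ∀ n : ℕ, N ≤ n →
    ∀ A : OnlineRule Plane, ∃ I : PieceStream n, (∀ i, (I i).diam ≤ δ) ∧
      ∑ i, (I i).area ≤ 1 * √(Real.log (Real.log n) / Real.log n) ∧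
      ¬ IsPackingIn unitSquare I (A.run I) := by
  obtain ⟨h, h0, h1, h2⟩ := exists_sliver_height hδ
  set m : ℕ := ⌊4 * 1 / h⌋₊ + 1 with hm
  have hm1 : (1 : ℝ) ≤ m := by rw [hm]; push_cast; linarith [(⌊4 * 1 / h⌋₊ : ℕ).cast_nonneg (α := ℝ)]
  set k : ℝ := 3 * m with hk
  set b : ℝ := 5376 * (k * (8 / h + 2) + 1) * (k * h + 2 * k + 1) with hb
  have hb0 : 0 < b := by positivity
  obtain ⟨N₀, hN₀1, hN₀⟩ := RowPlacement.exists_lower_bound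
  obtain ⟨N₁, hN₁⟩ := Filter.eventually_atTop.1
    (tendsto_log_div_log_log.eventually_ge_atTop (max 1 (b ^ 2)))
  obtain ⟨N₂, hN₂⟩ := exists_nat_ge (1 / h ^ 2)
  refine ⟨max N₀ (max N₁ N₂), fun n hn A => ?_⟩
  have hnN₀ : N₀ ≤ n := (le_max_left _ _).trans hn
  have hn1 : 1 ≤ n := hN₀1.trans hnN₀
  have hn0 : (0 : ℝ) < n := by positivity
  have hy := hN₁ n ((le_max_left N₁ N₂).trans ((le_max_right N₀ _).trans hn))
  have hyinv : √(Real.log (Real.log n) / Real.log n) =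
      1 / √(Real.log n / Real.log (Real.log n)) := by
    rw [one_div, ← Real.sqrt_inv, inv_div]
  rw [hyinv]
  set y := Real.log n / Real.log (Real.log n) with hydef
  have hy1 : 1 ≤ y := (le_max_left _ _).trans hy
  have hsy : 1 ≤ √y := Real.one_le_sqrt.2 hy1
  have hby : b ≤ √y := Real.le_sqrt_of_sq_le ((le_max_right _ _).trans hy)
  have hyy : √y * √y = y := Real.mul_self_sqrt (by linarith)
  -- The total area is `W * h = 1 / √y`. As `W` enters the final bound only through `k / W`, of
  -- order `√y`, the other `√y` absorbs all constants that depend on `δ`; so the constant 1 serves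
  -- for every `δ`.
  set W : ℝ := 1 / (√y * h) with hW
  have hW0 : 0 < W := by positivity
  set s : Sliver := ⟨W / n, h, by positivity, h0⟩ with hs
  have hse : s.e ≤ h := by
    show W / n ≤ h
    have hn2 : (1 : ℝ) / h ^ 2 ≤ n := hN₂.trans (by
      exact_mod_cast (le_max_right N₁ N₂).trans ((le_max_right N₀ _).trans hn))
    rw [div_le_iff₀ (by positivity)] at hn2
    rw [hW, div_div, div_le_iff₀ (by positivity)]
    have : n * h ^ 2 * 1 ≤ n * h ^ 2 * √y := by gcongr
    nlinarith
  have hsh : s.h = h := rfl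
  by_contra hcon
  push Not at hcon
  obtain ⟨P⟩ := s.square_rowPlacement (A := A) (n := n) (fun ξ hξ => by
    refine hcon _ (fun i => (s.diam_piece_le (hξ i).1 (hξ i).2).trans (by linarith)) ?_
    have : ∀ i, (s.stream ξ i).area = s.e * s.h := fun i => s.area_piece _
    simp only [this, Finset.sum_const, Finset.card_univ, Fintype.card_fin, nsmul_eq_mul]
    show n * (W / n * h) ≤ 1 * (1 / √y)
    apply le_of_eq
    rw [hW]; field_simp)
  have h3 := hN₀ n hnN₀ _ _ _ _ P
  have hrow1 : (s.row 1 : ℝ) + 1 = m := by rw [hm]; push_cast; rfl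
  have h4 := row_placement_bound (M := 1 * (s.row 1 + 1)) (n := n) (e := s.e) (h := h)
    (L := 1 + s.h) (W := W) (X := 0) (k := k) hW0 h0 hn1 rfl le_rfl
    (by have := s.h_pos; positivity) (by positivity) (by
      push_cast
      rw [one_mul, hrow1, hk, hsh]
      nlinarith) rfl
  rw [zero_add, one_pow, mul_one] at h4
  have h5 : 5376 * (k * (8 / h + 2) + 1) * (k / W + 2 * k + 1) ≤ b * √y := by
    have e1 : k / W = k * h * √y := by rw [hW]; field_simp
    rw [e1, hb]
    have h6 : k * h * √y + 2 * k + 1 ≤ (k * h + 2 * k + 1) * √y := by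
      have : (2 * k + 1) * 1 ≤ (2 * k + 1) * √y := by gcongr
      linarith
    calc 5376 * (k * (8 / h + 2) + 1) * (k * h * √y + 2 * k + 1)
        ≤ 5376 * (k * (8 / h + 2) + 1) * ((k * h + 2 * k + 1) * √y) := by gcongr
      _ = _ := by ring
  have h6 : b * √y ≤ y := by
    calc b * √y ≤ √y * √y := by gcongr
      _ = y := hyy
  exact absurd (h3.trans_le (h4.trans (h5.trans h6))) (lt_irrefl _)

theorem not_packsIntoSquare {δ V : ℝ} (hδ : 0 < δ) (hV : 0 < V) (A : OnlineRule Plane) :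
    ¬ PacksIntoSquare δ V A := by
  intro hA
  obtain ⟨N, hN⟩ := square_lower_bound hδ
  have ht : Filter.Tendsto (fun n : ℕ => √(Real.log (Real.log n) / Real.log n)) Filter.atTop
      (nhds 0) := by
    have h1 := (Real.tendsto_sqrt_atTop.comp tendsto_log_div_log_log).inv_tendsto_atTop
    refine h1.congr fun n => ?_
    simp only [Pi.inv_apply, Function.comp]
    rw [← Real.sqrt_inv, inv_div]
  obtain ⟨n, hn, hnV⟩ := ((Filter.eventually_ge_atTop N).and
    (ht.eventually (eventually_le_nhds hV))).exists
  obtain ⟨I, hI1, hI2, hI3⟩ := hN n hn A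
  exact hI3 (hA n I hI1 (by linarith))

theorem isGreatest_square {δ : ℝ} (hδ : 0 < δ) :
    IsGreatest {V : ℝ | 0 ≤ V ∧ ∃ A : OnlineRule Plane, PacksIntoSquare δ V A} 0 := by
  -- Pieces have positive area, so only the empty stream has total area at most 0.
  refine ⟨⟨le_rfl, fun _ => 0, fun n I _ hsum => ?_⟩, ?_⟩
  · have hn : IsEmpty (Fin n) := by
      by_contra hne
      rw [not_isEmpty_iff] at hne
      have := Finset.sum_pos (fun i _ => (I i).area_pos) (Finset.univ_nonempty (α := Fin n))
      linarith
    exact ⟨fun i => isEmptyElim i, fun i => isEmptyElim i⟩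
  · rintro V ⟨-, A, hA⟩
    by_contra hV
    exact not_packsIntoSquare hδ (not_le.1 hV) A hA
-- The length of the boundary of a plane convex set.
open scoped RealInnerProductSpace

lemma IsPreconnected.exists_mem_frontier {X : Type*} [TopologicalSpace X] {S K : Set X}
    (hS : IsPreconnected S) (h1 : (S ∩ K).Nonempty) (h2 : (S ∩ Kᶜ).Nonempty) :
    (S ∩ frontier K).Nonempty := by
  by_contra hcon
  rw [not_nonempty_iff_eq_empty] at hcon
  have hn : ∀ x ∈ S, x ∈ closure K → x ∈ interior K := by
    intro x hx hc
    by_contra hi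
    exact (Set.ext_iff.1 hcon x).1 ⟨hx, hc, hi⟩
  obtain ⟨x, hxS, hxK⟩ := h1
  obtain ⟨y, hyS, hyK⟩ := h2
  obtain ⟨z, hzS, hz1, hz2⟩ := hS (interior K) (closure K)ᶜ isOpen_interior
    isClosed_closure.isOpen_compl (fun w hw => by
      by_cases hc : w ∈ closure K
      · exact Or.inl (hn w hw hc)
      · exact Or.inr hc)
    ⟨x, hxS, hn x hxS (subset_closure hxK)⟩
    ⟨y, hyS, fun hc => hyK (interior_subset (hn y hyS hc))⟩
  exact hz2 (interior_subset_closure hz1)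

/-- A ray that starts in a bounded set meets its boundary. -/
lemma exists_ray_mem_frontier {E : Type*} [NormedAddCommGroup E] [NormedSpace ℝ E] {K : Set E}
    (hK : Bornology.IsBounded K) {z d : E} (hz : z ∈ K) (hd : d ≠ 0) :
    ∃ t : ℝ, 0 ≤ t ∧ z + t • d ∈ frontier K := by
  obtain ⟨C, hC⟩ := hK.exists_norm_le
  have hd0 : 0 < ‖d‖ := norm_pos_iff.2 hd
  have hcont : Continuous fun t : ℝ => z + t • d := by fun_prop
  have hC0 : 0 ≤ C := (norm_nonneg z).trans (hC z hz)
  have hS : IsPreconnected ((fun t : ℝ => z + t • d) '' Ici 0) :=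
    isPreconnected_Ici.image _ hcont.continuousOn
  obtain ⟨_, ⟨t, ht, rfl⟩, hf⟩ := hS.exists_mem_frontier (K := K)
    ⟨z, ⟨0, self_mem_Ici, by simp⟩, hz⟩
    ⟨_, ⟨(C + ‖z‖ + 1) / ‖d‖, div_nonneg (by positivity) hd0.le, rfl⟩, fun hmem => by
      have h1 := hC _ hmem
      have h2 := norm_sub_le (z + ((C + ‖z‖ + 1) / ‖d‖) • d) z
      rw [add_sub_cancel_left, norm_smul, Real.norm_of_nonneg (by positivity),
        div_mul_cancel₀ _ hd0.ne'] at h2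
      linarith⟩
  exact ⟨t, ht, hf⟩

lemma lipschitzWith_coord (i : Fin 2) : LipschitzWith 1 fun p : Plane => p i := by
  refine LipschitzWith.of_dist_le_mul fun p q => ?_
  rw [NNReal.coe_one, one_mul, dist_eq_norm, dist_eq_norm, ← PiLp.sub_apply]
  exact PiLp.norm_apply_le (p - q) i

/-- The width of a bounded convex set is at most the length of its boundary. -/
lemma width_le_hausdorffMeasure {K : Set Plane} (hc : Convex ℝ K) (hK : Bornology.IsBounded K)
    {p q : Plane} (hp : p ∈ K) (hq : q ∈ K) (i : Fin 2) :
    ENNReal.ofReal (q i - p i) ≤ Measure.hausdorffMeasure 1 (frontier K) := by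
  rcases le_or_gt (q i) (p i) with h | h
  · rw [ENNReal.ofReal_of_nonpos (by linarith)]; exact zero_le
  -- From each point of the segment from `p` to `q`, a ray in the other coordinate direction `1 - i`
  -- meets the boundary; so the 1-Lipschitz projection of the boundary covers the interval.
  have hsub : Icc (p i) (q i) ⊆ (fun p : Plane => p i) '' frontier K := by
    intro c hcc
    set t := (c - p i) / (q i - p i) with ht
    have ht0 : 0 ≤ t := div_nonneg (by linarith [hcc.1]) (by linarith)
    have ht1 : t ≤ 1 := by rw [ht, div_le_one (by linarith)]; linarith [hcc.2]
    have htc : t * (q i - p i) = c - p i := by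
      rw [ht]; exact div_mul_cancel₀ _ (by linarith)
    have hz := hc hp hq (sub_nonneg.2 ht1) ht0 (by ring)
    obtain ⟨r, -, hr⟩ := exists_ray_mem_frontier hK hz
      (d := EuclideanSpace.single (1 - i) (1 : ℝ)) (by simp)
    refine ⟨_, hr, ?_⟩
    have hi : i ≠ 1 - i := by fin_cases i <;> simp
    simp [hi]
    linarith
  calc ENNReal.ofReal (q i - p i) = volume (Icc (p i) (q i)) := Real.volume_Icc.symm
    _ = Measure.hausdorffMeasure 1 (Icc (p i) (q i)) := by rw [hausdorffMeasure_real]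
    _ ≤ Measure.hausdorffMeasure 1 ((fun p : Plane => p i) '' frontier K) := measure_mono hsub
    _ ≤ _ := by
      have := (lipschitzWith_coord i).hausdorffMeasure_image_le (d := 1) zero_le_one (frontier K)
      simpa using this

/-- The square with lower left corner `(a, b)` and side `S`. -/
def box (a b S : ℝ) : Set Plane := {p | a ≤ p 0 ∧ p 0 ≤ a + S ∧ b ≤ p 1 ∧ p 1 ≤ b + S}

lemma isClosed_box (a b S : ℝ) : IsClosed (box a b S) := by
  have h0 : Continuous fun p : Plane => p 0 := by fun_prop
  have h1 : Continuous fun p : Plane => p 1 := by fun_prop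
  exact (isClosed_le continuous_const h0).inter ((isClosed_le h0 continuous_const).inter
    ((isClosed_le continuous_const h1).inter (isClosed_le h1 continuous_const)))

lemma isBounded_box (a b S : ℝ) : Bornology.IsBounded (box a b S) := by
  refine Metric.isBounded_iff.2 ⟨2 * |S|, fun p hp q hq => ?_⟩
  obtain ⟨p1, p2, p3, p4⟩ := hp
  obtain ⟨q1, q2, q3, q4⟩ := hq
  have hS := le_abs_self S
  have e1 : |p 0 - q 0| ≤ |S| := by rw [abs_le]; constructor <;> linarith
  have e2 : |p 1 - q 1| ≤ |S| := by rw [abs_le]; constructor <;> linarith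
  linarith [Sliver.dist_le_add p q]

lemma mem_segment_of_coord {p q r : Plane} {t : ℝ} (h0 : 0 ≤ t) (h1 : t ≤ 1)
    (e0 : r 0 = p 0 + t * (q 0 - p 0)) (e1 : r 1 = p 1 + t * (q 1 - p 1)) :
    r ∈ segment ℝ p q := by
  refine ⟨1 - t, t, by linarith, h0, by ring, ?_⟩
  ext i
  fin_cases i
  · simp [e0]; ring
  · simp [e1]; ring

lemma frontier_box_subset {a b S : ℝ} (hS : 0 < S) : frontier (box a b S) ⊆
    (segment ℝ !₂[a, b] !₂[a + S, b] ∪ segment ℝ !₂[a, b + S] !₂[a + S, b + S]) ∪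
    (segment ℝ !₂[a, b] !₂[a, b + S] ∪ segment ℝ !₂[a + S, b] !₂[a + S, b + S]) := by
  intro p hp
  rw [(isClosed_box a b S).frontier_eq] at hp
  obtain ⟨⟨p1, p2, p3, p4⟩, hpi⟩ := hp
  have hopen : IsOpen {p : Plane | a < p 0 ∧ p 0 < a + S ∧ b < p 1 ∧ p 1 < b + S} := by
    have h0 : Continuous fun p : Plane => p 0 := by fun_prop
    have h1 : Continuous fun p : Plane => p 1 := by fun_prop
    exact (isOpen_lt continuous_const h0).inter ((isOpen_lt h0 continuous_const).inter
      ((isOpen_lt continuous_const h1).inter (isOpen_lt h1 continuous_const)))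
  have hsub : {p : Plane | a < p 0 ∧ p 0 < a + S ∧ b < p 1 ∧ p 1 < b + S} ⊆ box a b S :=
    fun q hq => ⟨hq.1.le, hq.2.1.le, hq.2.2.1.le, hq.2.2.2.le⟩
  have hnot : ¬ (a < p 0 ∧ p 0 < a + S ∧ b < p 1 ∧ p 1 < b + S) := fun h =>
    hpi (interior_maximal hsub hopen h)
  have hx0 : 0 ≤ (p 0 - a) / S := div_nonneg (by linarith) hS.le
  have hx1 : (p 0 - a) / S ≤ 1 := by rw [div_le_one hS]; linarith
  have hy0 : 0 ≤ (p 1 - b) / S := div_nonneg (by linarith) hS.le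
  have hy1 : (p 1 - b) / S ≤ 1 := by rw [div_le_one hS]; linarith
  have hx : (p 0 - a) / S * S = p 0 - a := div_mul_cancel₀ _ hS.ne'
  have hy : (p 1 - b) / S * S = p 1 - b := div_mul_cancel₀ _ hS.ne'
  by_cases c1 : a < p 0
  · by_cases c2 : p 0 < a + S
    · by_cases c3 : b < p 1
      · have c4 : p 1 = b + S := le_antisymm p4 (not_lt.1 fun h => hnot ⟨c1, c2, c3, h⟩)
        refine Or.inl (Or.inr (mem_segment_of_coord hx0 hx1 ?_ ?_))
        · simp [hx]
        · simp [c4]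
      · refine Or.inl (Or.inl (mem_segment_of_coord hx0 hx1 ?_ ?_))
        · simp [hx]
        · simp; linarith
    · refine Or.inr (Or.inr (mem_segment_of_coord hy0 hy1 ?_ ?_))
      · simp; linarith
      · simp [hy]
  · refine Or.inr (Or.inl (mem_segment_of_coord hy0 hy1 ?_ ?_))
    · simp; linarith
    · simp [hy]

lemma hausdorffMeasure_frontier_box_le {a b S : ℝ} (hS : 0 < S) :
    Measure.hausdorffMeasure 1 (frontier (box a b S)) ≤ ENNReal.ofReal (4 * S) := by
  have hseg : ∀ p q : Plane, |p 0 - q 0| + |p 1 - q 1| ≤ S →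
      Measure.hausdorffMeasure 1 (segment ℝ p q) ≤ ENNReal.ofReal S := by
    intro p q h
    rw [hausdorffMeasure_segment, edist_dist]
    exact ENNReal.ofReal_le_ofReal ((Sliver.dist_le_add p q).trans h)
  refine (measure_mono (frontier_box_subset hS)).trans ?_
  refine (measure_union_le _ _).trans ((add_le_add (measure_union_le _ _)
    (measure_union_le _ _)).trans ((add_le_add (add_le_add (hseg _ _ ?_) (hseg _ _ ?_))
    (add_le_add (hseg _ _ ?_) (hseg _ _ ?_))).trans ?_))
  · simp [abs_of_pos hS]
  · simp [abs_of_pos hS]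
  · simp [abs_of_pos hS]
  · simp [abs_of_pos hS]
  · rw [← ENNReal.ofReal_add hS.le hS.le, ← ENNReal.ofReal_add (by linarith) (by linarith)]
    exact ENNReal.ofReal_le_ofReal (by linarith)

/-- The boundary of a convex set in a square is at most as long as the boundary of the square. -/
lemma hausdorffMeasure_frontier_le {K : Set Plane} (hc : Convex ℝ K)
    (hi : (interior K).Nonempty) {a b S : ℝ} (hS : 0 < S) (hK : K ⊆ box a b S) :
    Measure.hausdorffMeasure 1 (frontier K) ≤ ENNReal.ofReal (4 * S) := by
  have hKc : closure K ⊆ box a b S := closure_minimal hK (isClosed_box a b S)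
  -- The variational form of "`p` is the point of `closure K` nearest to `q`".
  let Foot : Plane → Plane → Prop := fun q p => p ∈ closure K ∧ ∀ k ∈ closure K, ⟪q - p, k - p⟫ ≤ 0
  -- An outer normal at `p`, followed to the boundary of the square, ends in such a point `q`.
  have hfoot : ∀ p ∈ frontier K, ∃ q ∈ frontier (box a b S), Foot q p := by
    intro p hp
    obtain ⟨f, hf⟩ := geometric_hahn_banach_open_point hc.interior isOpen_interior hp.2
    have hf' : ∀ k ∈ closure K, f k ≤ f p := by
      intro k hk
      rw [← hc.closure_interior_eq_closure_of_nonempty_interior hi] at hk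
      exact closure_minimal (t := {k | f k ≤ f p}) (fun k hk => (hf k hk).le)
        (isClosed_le f.continuous continuous_const) hk
    set d := (InnerProductSpace.toDual ℝ Plane).symm f with hd
    have hdf : ∀ k, ⟪d, k⟫ = f k := fun k => InnerProductSpace.toDual_symm_apply
    have hd0 : d ≠ 0 := by
      intro h0
      obtain ⟨k, hk⟩ := hi
      have h1 := hf k hk
      rw [← hdf, ← hdf, h0, inner_zero_left, inner_zero_left] at h1
      exact lt_irrefl _ h1
    obtain ⟨t, ht, hq⟩ := exists_ray_mem_frontier (isBounded_box a b S) (hKc hp.1) hd0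
    refine ⟨_, hq, hp.1, fun k hk => ?_⟩
    rw [add_sub_cancel_left, real_inner_smul_left, inner_sub_right, hdf, hdf]
    exact mul_nonpos_of_nonneg_of_nonpos ht (by linarith [hf' k hk])
  -- The nearest-point map is a contraction, so it does not increase the Hausdorff measure.
  have hexp : ∀ q p q' p', Foot q p → Foot q' p' → dist p p' ≤ dist q q' := by
    rintro q p q' p' ⟨hp, h1⟩ ⟨hp', h2⟩
    have h3 := h1 p' hp'
    have h4 := h2 p hp
    have h5 : ‖p - p'‖ ^ 2 ≤ ⟪q - q', p - p'⟫ := by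
      rw [← real_inner_self_eq_norm_sq]
      have e : ⟪q - q', p - p'⟫ - ⟪p - p', p - p'⟫ = -⟪q - p, p' - p⟫ - ⟪q' - p', p - p'⟫ := by
        rw [← inner_neg_right, neg_sub, ← inner_sub_left, ← inner_sub_left]
        congr 1
        abel
      linarith
    have h6 := real_inner_le_norm (q - q') (p - p')
    rw [dist_eq_norm, dist_eq_norm]
    rcases (norm_nonneg (p - p')).eq_or_lt with h7 | h7
    · rw [← h7]; exact norm_nonneg _
    · nlinarith
  classical
  set T : Set Plane := {q | q ∈ frontier (box a b S) ∧ ∃ p, Foot q p} with hT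
  let g : Plane → Plane := fun q => if h : ∃ p, Foot q p then h.choose else 0
  have hg : ∀ q ∈ T, Foot q (g q) := by
    rintro q ⟨-, hq⟩
    simp only [g, dif_pos hq]
    exact hq.choose_spec
  have hlip : LipschitzOnWith 1 g T := LipschitzOnWith.of_dist_le_mul fun q hq q' hq' => by
    rw [NNReal.coe_one, one_mul]
    exact hexp _ _ _ _ (hg q hq) (hg q' hq')
  have hsub : frontier K ⊆ g '' T := by
    intro p hp
    obtain ⟨q, hq, hqp⟩ := hfoot p hp
    have hqT : q ∈ T := ⟨hq, p, hqp⟩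
    refine ⟨q, hqT, ?_⟩
    have := hexp _ _ _ _ (hg q hqT) hqp
    rw [dist_self] at this
    exact dist_le_zero.1 this
  calc Measure.hausdorffMeasure 1 (frontier K) ≤ Measure.hausdorffMeasure 1 (g '' T) :=
        measure_mono hsub
    _ ≤ Measure.hausdorffMeasure 1 T := by
        have := hlip.hausdorffMeasure_image_le (d := 1) zero_le_one
        simpa using this
    _ ≤ Measure.hausdorffMeasure 1 (frontier (box a b S)) := measure_mono fun q hq => hq.1
    _ ≤ _ := hausdorffMeasure_frontier_box_le hS

lemma convex_box (a b S : ℝ) : Convex ℝ (box a b S) := by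
  rintro p ⟨p1, p2, p3, p4⟩ q ⟨q1, q2, q3, q4⟩ s t hs ht hst
  have hb' : t = 1 - s := by linarith
  subst hb'
  refine ⟨?_, ?_, ?_, ?_⟩ <;> simp only [PiLp.add_apply, PiLp.smul_apply, smul_eq_mul] <;> nlinarith

lemma perimeter_le {K : Set Plane} (hc : Convex ℝ K) (hi : (interior K).Nonempty) {a b S : ℝ}
    (hS : 0 < S) (hK : K ⊆ box a b S) : perimeter K ≤ 4 * S :=
  ENNReal.toReal_le_of_le_ofReal (by linarith) (hausdorffMeasure_frontier_le hc hi hS hK)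

lemma width_le_perimeter {K : Set Plane} (hc : Convex ℝ K) (hi : (interior K).Nonempty)
    {a b S : ℝ} (hS : 0 < S) (hK : K ⊆ box a b S) {p q : Plane} (hp : p ∈ K) (hq : q ∈ K)
    (i : Fin 2) : q i - p i ≤ perimeter K := by
  have hfin : Measure.hausdorffMeasure 1 (frontier K) ≠ ⊤ :=
    ((hausdorffMeasure_frontier_le hc hi hS hK).trans_lt ENNReal.ofReal_lt_top).ne
  exact (ENNReal.ofReal_le_iff_le_toReal hfin).1
    (width_le_hausdorffMeasure hc ((isBounded_box a b S).subset hK) hp hq i)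

/-! ### Perimeter packing. -/

namespace Sliver

variable (s : Sliver)

/-- The convex hull of the slivers placed at `v`. -/
noncomputable def hull {n : ℕ} (ξ : Fin n → ℝ) (v : Fin n → Plane) : Set Plane :=
  convexHull ℝ (coveredRegion (s.stream ξ) v)

lemma translate_subset_hull {n : ℕ} (ξ : Fin n → ℝ) (v : Fin n → Plane) (i : Fin n) :
    (s.piece (ξ i)).translate (v i) ⊆ s.hull ξ v :=
  (subset_iUnion (fun i => (s.stream ξ i).translate (v i)) i).trans (subset_convexHull ℝ _)

lemma interior_hull_nonempty {n : ℕ} (hn : 1 ≤ n) (ξ : Fin n → ℝ) (v : Fin n → Plane) :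
    (interior (s.hull ξ v)).Nonempty := by
  have he := s.e_pos
  have hh := s.h_pos
  set i : Fin n := ⟨0, hn⟩
  refine ⟨!₂[ξ i * (s.h / 2) + s.e / 2, s.h / 2] + v i,
    interior_mono (s.translate_subset_hull ξ v i) (s.mem_interior_translate ?_)⟩
  rw [add_sub_cancel_right]
  refine ⟨?_, ?_, ?_, ?_⟩ <;> simp <;> linarith

lemma hull_subset_box {n : ℕ} {ξ : Fin n → ℝ} (hξ : ∀ i, 0 ≤ ξ i ∧ ξ i ≤ 1)
    (v : Fin n → Plane) : ∃ a b S : ℝ, 0 < S ∧ s.hull ξ v ⊆ box a b S := by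
  have he := s.e_pos
  have hh := s.h_pos
  set B : ℝ := ∑ i, (|v i 0| + |v i 1|) + s.e + s.h with hB
  have hB0 : 0 < B := by positivity
  refine ⟨-B, -B, 2 * B, by linarith, convexHull_min ?_ (convex_box _ _ _)⟩
  intro p hp
  obtain ⟨i, hi⟩ := mem_iUnion.1 hp
  obtain ⟨h1, h2, h3, h4⟩ := s.translate_bounds (hξ i).1 (hξ i).2 hi
  have h5 : |v i 0| + |v i 1| ≤ ∑ i, (|v i 0| + |v i 1|) :=
    Finset.single_le_sum (f := fun i => |v i 0| + |v i 1|) (fun _ _ => by positivity)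
      (Finset.mem_univ i)
  have a0 := abs_nonneg (v i 0)
  have a1 := abs_nonneg (v i 1)
  refine ⟨?_, ?_, ?_, ?_⟩ <;>
    linarith [le_abs_self (v i 0), neg_abs_le (v i 0), le_abs_self (v i 1), neg_abs_le (v i 1)]

lemma sub_le_perimeter_cost {n : ℕ} {ξ : Fin n → ℝ} (hξ : ∀ i, 0 ≤ ξ i ∧ ξ i ≤ 1)
    (v : Fin n → Plane) {i j : Fin n} {p q : Plane} (hp : p ∈ (s.piece (ξ i)).translate (v i))
    (hq : q ∈ (s.piece (ξ j)).translate (v j)) (k : Fin 2) :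
    q k - p k ≤ perimeterPacking.cost (s.stream ξ) v := by
  obtain ⟨a, b, S, hS, hbox⟩ := s.hull_subset_box hξ v
  exact width_le_perimeter (convex_convexHull ℝ _)
    (s.interior_hull_nonempty (Nat.one_le_of_lt i.2) ξ v) hS hbox
    (s.translate_subset_hull ξ v i hp) (s.translate_subset_hull ξ v j hq) k

lemma perimeter_sorted_valid {n : ℕ} (ξ : Fin n → ℝ) :
    perimeterPacking.Valid (s.stream ξ) fun i => (!₂[rank ξ i * s.e, 0] : Plane) :=
  fun _ _ hij => s.disjoint_sorted ξ (r := rank ξ) hij id id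

lemma perimeter_opt_le {n : ℕ} (hn : 1 ≤ n) {ξ : Fin n → ℝ} (hξ : ∀ i, 0 ≤ ξ i ∧ ξ i ≤ 1) :
    perimeterPacking.opt (s.stream ξ) ≤ 4 * (n * s.e + s.h) := by
  have he := s.e_pos
  have hh := s.h_pos
  have hbdd : BddBelow {c : ℝ | ∃ v : Fin n → perimeterPacking.Placement,
      perimeterPacking.Valid (s.stream ξ) v ∧ perimeterPacking.cost (s.stream ξ) v = c} := by
    refine ⟨0, ?_⟩
    rintro _ ⟨v, hv, rfl⟩
    exact ENNReal.toReal_nonneg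
  refine (csInf_le hbdd ⟨_, s.perimeter_sorted_valid ξ, rfl⟩).trans ?_
  refine perimeter_le (a := 0) (b := 0) (convex_convexHull ℝ _) (s.interior_hull_nonempty hn ξ _)
    (by positivity) (convexHull_min ?_ (convex_box _ _ _))
  intro p hp
  obtain ⟨i, hi⟩ := mem_iUnion.1 hp
  have h1 := s.translate_bounds (hξ i).1 (hξ i).2 hi
  have h2 : ((rank ξ i + 1 : ℕ) : ℝ) ≤ n := by exact_mod_cast rank_lt ξ i
  push_cast at h2
  have h3 : (0 : ℝ) ≤ rank ξ i * s.e := by positivity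
  have h4 : (rank ξ i : ℝ) * s.e + s.e ≤ n * s.e := by nlinarith
  simp at h1
  refine ⟨?_, ?_, ?_, ?_⟩ <;> nlinarith

lemma le_perimeter_opt {n : ℕ} (hn : 1 ≤ n) {ξ : Fin n → ℝ} (hξ : ∀ i, 0 ≤ ξ i ∧ ξ i ≤ 1) :
    s.h ≤ perimeterPacking.opt (s.stream ξ) := by
  have he := s.e_pos
  have hh := s.h_pos
  refine le_csInf ⟨_, _, s.perimeter_sorted_valid ξ, rfl⟩ ?_
  rintro _ ⟨v, hv, rfl⟩
  change Fin n → Plane at v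
  set i : Fin n := ⟨0, hn⟩
  have hq : (!₂[ξ i * s.h, s.h] : Plane) + v i ∈ (s.piece (ξ i)).translate (v i) := by
    rw [ConvexPolygon.mem_translate, add_sub_cancel_right, mem_piece]
    refine ⟨?_, ?_, ?_, ?_⟩ <;> simp <;> linarith
  have := s.sub_le_perimeter_cost hξ v (s.self_mem_translate (ξ i) (v i)) hq 1
  simpa using this

variable {s} in
lemma Apart.add_right {x y : ℝ} {v w : Plane} (h : s.Apart x v y w) (c : Plane) :
    s.Apart x (v + c) y (w + c) := by
  intro q h1 h2
  refine h (q - c) ?_ ?_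
  · rwa [sub_sub, add_comm c v]
  · rwa [sub_sub, add_comm c w]

lemma getLastD_suffix (x : ℝ) (l : List ℝ) : [(x :: l).getLastD 0] <:+ x :: l := by
  rw [List.getLastD_eq_getLast?, List.getLast?_eq_some_getLast (List.cons_ne_nil x l)]
  exact ⟨_, List.dropLast_append_getLast (List.cons_ne_nil x l)⟩

lemma getLastD_eq_of_suffix {y : ℝ} {l l' : List ℝ} (hs : y :: l' <:+ l) :
    l.getLastD 0 = (y :: l').getLastD 0 := by
  obtain ⟨t, rfl⟩ := hs
  rw [List.getLastD_eq_getLast?, List.getLastD_eq_getLast?, List.getLast?_append,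
    List.getLast?_eq_some_getLast (List.cons_ne_nil y l'), Option.some_or]

/-- If a perimeter packing algorithm has cost at most `X` on all slivers, it gives row placements:
positions are taken relative to that of the first sliver. -/
lemma perimeter_rowPlacement {δ : ℝ} {A : OnlineRule Plane}
    (hA : perimeterPacking.IsOnlineAlgorithm δ A) {n : ℕ}
    (hinst : ∀ ξ : Fin n → ℝ, (∀ i, 0 ≤ ξ i ∧ ξ i ≤ 1) →
      perimeterPacking.IsInstance δ (s.stream ξ))
    {X : ℝ} (hX : 0 ≤ X) (hcost : ∀ ξ : Fin n → ℝ, (∀ i, 0 ≤ ξ i ∧ ξ i ≤ 1) →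
      perimeterPacking.algCost A (s.stream ξ) ≤ X) :
    Nonempty (RowPlacement n (1 * (s.row (2 * X) + 1)) s.e (s.h / 4) (2 * X + s.h)) := by
  have hhp := s.h_pos
  refine ⟨s.rowPlacement (H := 2 * X) (by linarith)
    -- The first sliver, the last entry of the history, is moved to `(X, X)`. Coordinate differences
    -- are at most the cost, so all positions lie in a square of side `2 * X`.
    (fun l => s.place A l + (!₂[X, X] - s.place A [l.getLastD 0])) (fun _ => 0)
    (fun _ _ _ => one_pos) ?_ ?_⟩
  · intro x l hl
    have hξ := slopes_mem (n := n) hl.2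
    have hlen : l.length < n := hl.1
    have hc := hcost _ hξ
    have h0 := s.run_stream A (getLastD_suffix x l) (Nat.zero_lt_of_lt hlen)
    have h1 := s.run_stream A (List.suffix_refl (x :: l)) hlen
    have hb1 := fun k => (s.sub_le_perimeter_cost hξ (A.run (s.stream (slopes n (x :: l))))
      (i := ⟨0, Nat.zero_lt_of_lt hlen⟩) (j := ⟨l.length, hlen⟩)
      (s.self_mem_translate _ _) (s.self_mem_translate _ _) k).trans hc
    have hb2 := fun k => (s.sub_le_perimeter_cost hξ (A.run (s.stream (slopes n (x :: l))))
      (j := ⟨0, Nat.zero_lt_of_lt hlen⟩) (i := ⟨l.length, hlen⟩)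
      (s.self_mem_translate _ _) (s.self_mem_translate _ _) k).trans hc
    have h0' : A.run (s.stream (slopes n (x :: l))) ⟨0, Nat.zero_lt_of_lt hlen⟩ =
      s.place A [(x :: l).getLastD 0] := h0
    rw [h0', h1] at hb1 hb2
    have c1 := hb1 0
    have c2 := hb1 1
    have c3 := hb2 0
    have c4 := hb2 1
    generalize (x :: l).getLastD 0 = z at c1 c2 c3 c4 ⊢
    refine ⟨?_, ?_, ?_, ?_⟩ <;> simp <;> linarith
  · intro x l y l' hl hs _
    have hξ := slopes_mem (n := n) hl.2
    have hlen : l.length < n := hl.1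
    have hlen' : l'.length < l.length := hs.length_le
    have hd := hA n _ (hinst _ hξ) ⟨l.length, hlen⟩ ⟨l'.length, hlen'.trans hlen⟩
      (by simp; omega)
    have hs' : y :: l' <:+ x :: l := hs.trans (List.suffix_cons x l)
    have h1 := apart_of_disjoint hd
    rw [slopes_suffix (List.suffix_refl (x :: l)), slopes_suffix hs'] at h1
    simp only [getLastD_eq_of_suffix hs']
    rw [← s.run_stream A (List.suffix_refl (x :: l)) hlen,
      ← s.run_stream A hs' (hlen'.trans hlen)]
    exact h1.add_right _

lemma perimeter_isInstance {δ : ℝ} (hδ : s.e + 2 * s.h ≤ δ) {n : ℕ} {ξ : Fin n → ℝ}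
    (hξ : ∀ i, 0 ≤ ξ i ∧ ξ i ≤ 1) : perimeterPacking.IsInstance δ (s.stream ξ) :=
  fun i => ⟨trivial, (s.diam_piece_le (hξ i).1 (hξ i).2).trans hδ⟩

end Sliver

lemma exists_quartic_bound {a : ℝ} (ha : 1 ≤ a) : ∃ N : ℕ, ∀ n ≥ N,
    a * (1 / (2 * a) * (Real.log n / Real.log (Real.log n)) ^ (1 / 4 : ℝ) + 1) ^ 4 ≤
      Real.log n / Real.log (Real.log n) := by
  obtain ⟨N, hN⟩ := Filter.eventually_atTop.1
    (tendsto_log_div_log_log.eventually_ge_atTop ((2 * a) ^ 4))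
  refine ⟨N, fun n hn => ?_⟩
  set y := Real.log n / Real.log (Real.log n)
  have hy := hN n hn
  have hy0 : 0 ≤ y := (by positivity : (0 : ℝ) ≤ (2 * a) ^ 4).trans hy
  set z := y ^ (1 / 4 : ℝ) with hz
  have hz0 : 0 ≤ z := Real.rpow_nonneg hy0 _
  have hz4 : z ^ 4 = y := by
    rw [hz, ← Real.rpow_natCast, ← Real.rpow_mul hy0]
    norm_num
  have h1 : 2 * a ≤ z := by
    exact le_of_pow_le_pow_left₀ (by norm_num : (4 : ℕ) ≠ 0) hz0 (hy.trans hz4.ge)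
  have h3 : 1 / (2 * a) * z + 1 ≤ z / a := by
    rw [div_mul_eq_mul_div, one_mul, le_div_iff₀ (by linarith)]
    have : z / (2 * a) * a = z / 2 := by field_simp
    nlinarith
  calc a * (1 / (2 * a) * z + 1) ^ 4 ≤ a * (z / a) ^ 4 := by gcongr
    _ = y / a ^ 3 := by rw [div_pow, hz4]; field_simp
    _ ≤ y := div_le_self hy0 (one_le_pow₀ ha)

theorem perimeter_lower_bound {δ : ℝ} (hδ : 0 < δ) : ∃ c : ℝ, 0 < c ∧ ∃ N : ℕ, ∀ n : ℕ, N ≤ n →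
    ∀ A : OnlineRule perimeterPacking.Placement, perimeterPacking.IsOnlineAlgorithm δ A →
      ∃ I : PieceStream n, perimeterPacking.IsInstance δ I ∧ 0 < perimeterPacking.opt I ∧
        c * (Real.log n / Real.log (Real.log n)) ^ (1 / 4 : ℝ) * perimeterPacking.opt I
          ≤ perimeterPacking.algCost A I := by
  obtain ⟨h, h0, h1, h2⟩ := exists_sliver_height hδ
  set k : ℝ := 2 * (8 / h + 1) with hk
  set a : ℝ := 5376 * (k * (8 / h + 2) + 1) * (k / 1 + 2 * k + 1) with ha
  have ha1 : 1 ≤ a := by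
    have e1 : 0 ≤ k * (8 / h + 2) := by positivity
    have e2 : 0 ≤ k / 1 + 2 * k := by positivity
    rw [ha]; nlinarith
  obtain ⟨N, hN1, hN⟩ := exists_threshold (a := 1) (W := 1) (h := h) le_rfl h0
  obtain ⟨N', hN'⟩ := exists_quartic_bound ha1
  refine ⟨1 / (2 * a) / 8, by positivity, max N N', fun n hn A hA => ?_⟩
  obtain ⟨hWn, hrow, -⟩ := hN n ((le_max_left _ _).trans hn)
  have hquart := hN' n ((le_max_right _ _).trans hn)
  have hn1 : 1 ≤ n := hN1.trans ((le_max_left _ _).trans hn)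
  have hn0 : (0 : ℝ) < n := by positivity
  set s : Sliver := ⟨1 / n, h, by positivity, h0⟩ with hs
  have hse : s.e ≤ h := by
    show 1 / (n : ℝ) ≤ h
    rw [div_le_iff₀ hn0]; exact hWn
  have hne : n * s.e = 1 := by show n * (1 / (n : ℝ)) = 1; field_simp
  have hsh : s.h = h := rfl
  by_contra hcon
  push Not at hcon
  have hinst : ∀ ξ : Fin n → ℝ, (∀ i, 0 ≤ ξ i ∧ ξ i ≤ 1) →
      perimeterPacking.IsInstance δ (s.stream ξ) := fun ξ hξ =>
    s.perimeter_isInstance (by linarith) hξ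
  set y := Real.log n / Real.log (Real.log n) with hy
  have hy0 : 0 ≤ y := le_trans (by positivity) hquart
  set X := 1 / (2 * a) * y ^ (1 / 4 : ℝ) with hX
  have hX0 : 0 ≤ X := by positivity
  obtain ⟨P⟩ := s.perimeter_rowPlacement hA hinst hX0 (by
    intro ξ hξ
    have hopt1 : 0 < perimeterPacking.opt (s.stream ξ) := s.h_pos.trans_le (s.le_perimeter_opt hn1 hξ)
    have hopt2 : perimeterPacking.opt (s.stream ξ) ≤ 8 := by
      refine (s.perimeter_opt_le hn1 hξ).trans ?_
      rw [hne]; linarith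
    refine (hcon _ (hinst ξ hξ) hopt1).le.trans ?_
    calc 1 / (2 * a) / 8 * y ^ (1 / 4 : ℝ) * perimeterPacking.opt (s.stream ξ)
        ≤ 1 / (2 * a) / 8 * y ^ (1 / 4 : ℝ) * 8 := by gcongr
      _ = X := by rw [hX]; field_simp)
  have h3 := hrow _ _ _ _ P
  have hrowX : (s.row (2 * X) : ℝ) + 1 ≤ (8 / h + 1) * (X + 1) := by
    have e1 : (s.row (2 * X) : ℝ) ≤ 4 * (2 * X) / h := Nat.floor_le (by positivity)
    have e2 : 4 * (2 * X) / h = 8 / h * X := by ring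
    have e3 : 0 < 8 / h := by positivity
    nlinarith
  -- Number and length of the rows both grow linearly with the cost; hence `(X + 1) ^ 2 - 1`
  -- replaces `X`, and the final bound is quartic.
  have h4 := row_placement_bound (M := 1 * (s.row (2 * X) + 1)) (n := n) (e := s.e) (h := h)
    (L := 2 * X + s.h) (W := 1) (X := (X + 1) ^ 2 - 1) (k := k) one_pos h0 hn1 rfl
    (by nlinarith) (by have := s.h_pos; positivity) (by positivity) (by
      push_cast
      rw [one_mul, hk, hsh]
      have e1 : 2 * X + h + 1 ≤ 2 * (X + 1) := by linarith
      calc ((s.row (2 * X) : ℝ) + 1) * (2 * X + h + 1)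
          ≤ ((8 / h + 1) * (X + 1)) * (2 * (X + 1)) := by gcongr
        _ = _ := by ring) ha
  have h5 : a * ((X + 1) ^ 2 - 1 + 1) ^ 2 = a * (X + 1) ^ 4 := by ring
  rw [h5] at h4
  exact absurd (h3.trans_le (h4.trans hquart)) (lt_irrefl _)

theorem perimeter_not_competitive {δ : ℝ} (hδ : 0 < δ) :
    ¬ ∃ A : OnlineRule perimeterPacking.Placement,
      perimeterPacking.IsOnlineAlgorithm δ A ∧ perimeterPacking.IsCompetitive δ 0 A := by
  rintro ⟨A, hA, K, hK⟩
  obtain ⟨c, hc, N, hN⟩ := perimeter_lower_bound hδ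
  have ht : Filter.Tendsto
      (fun n : ℕ => c * (Real.log n / Real.log (Real.log n)) ^ (1 / 4 : ℝ))
      Filter.atTop Filter.atTop :=
    ((tendsto_rpow_atTop (by norm_num)).comp tendsto_log_div_log_log).const_mul_atTop hc
  obtain ⟨n, hn, hnK⟩ := ((Filter.eventually_ge_atTop N).and (ht.eventually_gt_atTop K)).exists
  obtain ⟨I, hI, hopt, hle⟩ := hN n hn A hA
  have h1 := hK n I hI hopt.le
  nlinarith
-- The main theorem.
theorem theorem2 :
    -- Strip packing
    (∀ δ : ℝ, 0 < δ →
      (∀ C : ℝ, ¬ ∃ A : OnlineRule stripPacking.Placement,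
        stripPacking.IsOnlineAlgorithm δ A ∧ stripPacking.IsCompetitive δ C A) ∧
      (∀ C : ℝ, ∃ c : ℝ, 0 < c ∧ ∃ N : ℕ, ∀ n : ℕ, N ≤ n →
        ∀ A : OnlineRule stripPacking.Placement, stripPacking.IsOnlineAlgorithm δ A →
          ∃ I : PieceStream n, stripPacking.IsInstance δ I ∧ C ≤ stripPacking.opt I ∧
            c * √(Real.log n / Real.log (Real.log n)) * stripPacking.opt I
              ≤ stripPacking.algCost A I) ∧
      (∃ c : ℝ, 0 < c ∧ ∀ A : OnlineRule stripPacking.Placement,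
        stripPacking.IsOnlineAlgorithm δ A →
          ∀ f : ℕ → ℝ, stripPacking.HasAsymptoticCompetitiveRatio δ A f →
            ∃ N : ℕ, ∀ n : ℕ, N ≤ n → c * √(Real.log n / Real.log (Real.log n)) ≤ f n)) ∧
    -- Bin packing
    (∀ δ : ℝ, 0 < δ →
      (∀ C : ℝ, ¬ ∃ A : OnlineRule binPacking.Placement,
        binPacking.IsOnlineAlgorithm δ A ∧ binPacking.IsCompetitive δ C A) ∧
      (∀ C : ℝ, ∃ c : ℝ, 0 < c ∧ ∃ N : ℕ, ∀ n : ℕ, N ≤ n →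
        ∀ A : OnlineRule binPacking.Placement, binPacking.IsOnlineAlgorithm δ A →
          ∃ I : PieceStream n, binPacking.IsInstance δ I ∧ C ≤ binPacking.opt I ∧
            c * √(Real.log n / Real.log (Real.log n)) * binPacking.opt I
              ≤ binPacking.algCost A I) ∧
      (∃ c : ℝ, 0 < c ∧ ∀ A : OnlineRule binPacking.Placement,
        binPacking.IsOnlineAlgorithm δ A →
          ∀ f : ℕ → ℝ, binPacking.HasAsymptoticCompetitiveRatio δ A f →
            ∃ N : ℕ, ∀ n : ℕ, N ≤ n → c * √(Real.log n / Real.log (Real.log n)) ≤ f n)) ∧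
    -- Perimeter packing
    (∀ δ : ℝ, 0 < δ →
      (¬ ∃ A : OnlineRule perimeterPacking.Placement,
        perimeterPacking.IsOnlineAlgorithm δ A ∧ perimeterPacking.IsCompetitive δ 0 A) ∧
      (∃ c : ℝ, 0 < c ∧ ∃ N : ℕ, ∀ n : ℕ, N ≤ n →
        ∀ A : OnlineRule perimeterPacking.Placement, perimeterPacking.IsOnlineAlgorithm δ A →
          ∃ I : PieceStream n, perimeterPacking.IsInstance δ I ∧
            c * (Real.log n / Real.log (Real.log n)) ^ (1 / 4 : ℝ) * perimeterPacking.opt I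
              ≤ perimeterPacking.algCost A I)) ∧
    -- Square packing
    (∀ δ : ℝ, 0 < δ → δ ≤ 1 →
      (¬ ∃ A : OnlineRule Plane, PacksIntoSquare δ δ A) ∧
      IsGreatest {V : ℝ | 0 ≤ V ∧ ∃ A : OnlineRule Plane, PacksIntoSquare δ V A} 0) ∧
    (∃ K : ℝ, 0 < K ∧ ∀ δ : ℝ, 0 < δ → δ ≤ 1 →
      ∃ N : ℕ, ∀ n : ℕ, N ≤ n → ∀ A : OnlineRule Plane,
        ∃ I : PieceStream n, (∀ i, (I i).diam ≤ δ) ∧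
          ∑ i, (I i).area ≤ K * √(Real.log (Real.log n) / Real.log n) ∧
          ¬ IsPackingIn unitSquare I (A.run I)) := by
  refine ⟨fun δ hδ => ⟨?_, strip_sqrtLowerBound hδ, ?_⟩, fun δ hδ => ⟨?_, bin_sqrtLowerBound hδ, ?_⟩,
    fun δ hδ => ⟨perimeter_not_competitive hδ, ?_⟩, fun δ hδ _ => ⟨?_, isGreatest_square hδ⟩,
    1, one_pos, fun δ hδ _ => square_lower_bound hδ⟩
  · exact PackingProblem.not_competitive_of_sqrtLowerBound (strip_sqrtLowerBound hδ)
  · exact PackingProblem.asymptotic_of_sqrtLowerBound (strip_sqrtLowerBound hδ 1)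
  · exact PackingProblem.not_competitive_of_sqrtLowerBound (bin_sqrtLowerBound hδ)
  · exact PackingProblem.asymptotic_of_sqrtLowerBound (bin_sqrtLowerBound hδ 1)
  · obtain ⟨c, hc, N, hN⟩ := perimeter_lower_bound hδ
    refine ⟨c, hc, N, fun n hn A hA => ?_⟩
    obtain ⟨I, hI, -, hle⟩ := hN n hn A hA
    exact ⟨I, hI, hle⟩
  · rintro ⟨A, hA⟩
    exact not_packsIntoSquare hδ hδ A hA
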